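/- Let $k=\mathbb R$ or $\mathbb C$. A *locally convex $k$-algebra* is an associative, not necessarily unital, $k$-algebra with a complete Hausdorff locally convex topology for which multiplication is jointly continuous; morphisms are continuous $k$-algebra homomorphisms. For such an algebra $A$ let $A^{\infty(I)}$ be the locally convex algebra of smooth maps $f:[0,1]\to A$ with the topology of uniform convergence of all derivatives $f^{(j)}$, $j\ge 0$; let $\mathcal I(A)=\{f\in A^{\infty(I)} : f(0)=0\}$ be the smooth path algebra and $\tau_A:\mathcal I(A)\to A$, $f\mapsto f(1)$. Put $\mathcal I_n(A)=\mathcal I^{n+1}(A)$ for $n\ge -1$. With the faces $d_i=\mathcal I^i\tau\mathcal I^{n-i}:\mathcal I_n(A)\to\mathcal I_{n-1}(A)$, $0\le i\le n$, (and the degeneracies of the smooth path cotriple) this is an augmented simplicial algebra $\mathcal I^+_*(A)$, equal to $A$ in degree $-1$. Let $A^+=A\oplus k$ be the algebra with adjoined unit and $GL(A)=\operatorname{Ker}(GL(A^+)\to GL(k))$, where $GL=\varinjlim_m GL_m$. For $n\ge 1$ let $K_n^{sm}(A)=\pi_{n-2}\,GL(\mathcal I^+_*(A))$ be the homotopy group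 of this augmented simplicial group, that is, the quotient of $\bigcap_{i}\operatorname{Ker}d_i\subseteq GL(\mathcal I_{n-2}(A))$ (all of $GL(A)$ if $n=1$) by the image under $d_0$ of $\bigcap_{i\ge 1}\operatorname{Ker}d_i\subseteq GL(\mathcal I_{n-1}(A))$; in particular $K_1^{sm}(A)=\operatorname{Coker}(GL(\mathcal I(A))\to GL(A))$. Let $K_0^{sm}(A)=K_0(A)=\operatorname{Ker}(K_0(A^+)\to K_0(k))$, where $K_0$ of a unital ring is its Grothendieck group of finitely generated projective modules. **Proposition 1.4.** Let $$0\to A'\xrightarrow{\ \sigma\ }A\xrightarrow{\ \eta\ }A''\to 0$$ be a short exact sequence of locally convex $k$-algebras, that is, $\eta$ is a surjective morphism and $\sigma$ is a morphism which is a homeomorphism of $A'$ onto $\operatorname{Ker}\eta$. Suppose that $\eta$ is a $GL$-fibration with respect to the smooth path cotriple, that is, $GL(\mathcal I_i(A))\to GL(\mathcal I_i(A''))$ is surjective for every $i\ge 0$. Then there are group homomorphisms $\partial_{n+1}:K^{sm}_{n+1}(A'')\to K^{sm}_{n}(A')$, $n\ge 0$, such that $$\cdots\to K^{sm}_{n+1}(A'')\xrightarrow{\partial_{n+1}}K^{sm}_n(A')\to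 K^{sm}_n(A)\to K^{sm}_n(A'')\xrightarrow{\partial_n}K^{sm}_{n-1}(A')\to\cdots$$ $$\cdots\to K^{sm}_1(A')\to K^{sm}_1(A)\to K_1^{sm}(A'')\xrightarrow{\partial_1}K_0(A')\to K_0(A)\to K_0(A'')$$ is exact at every term except possibly the last, the unlabelled maps being those induced by $\sigma$ and $\eta$. Moreover the $\partial_n$ can be taken to be the usual connecting homomorphisms: for $n\ge 2$, $\partial_n$ sends the class of $x\in GL(\mathcal I_{n-2}(A''))$ with all $d_ix=1$ to the class of the element of $GL(\mathcal I_{n-3}(A'))$ whose image under $\sigma$ is $d_0y$, for any $y\in GL(\mathcal I_{n-2}(A))$ over $x$ with $d_iy=1$ for all $i\ge1$; and $\partial_1$ sends the class of $g\in GL_m(A^{\prime\prime +})$, $g\in GL(A'')$, to $[q]-[\operatorname{diag}(1_m,0)]$, where $q$ is the idempotent matrix over $A^{\prime +}$ whose image under $\sigma^+$ is $u\operatorname{diag}(1_m,0)u^{-1}$, for any lift $u\in GL_{2m}(A^+)$ of $\operatorname{diag}(g,g^{-1})$. -/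

import Mathlib

open Filter Topology
open scoped unitInterval ComplexOrder

universe u u₁ u₂ u₃ v

namespace SmoothK

section Curves

variable (k : Type v) [RCLike k]

/-- `HasDerivI k f g`: the curve `f : [0,1] → A` is differentiable at every point of `[0,1]`
(one-sidedly at the end points) with derivative `g`. -/
def HasDerivI {A : Type u} [AddCommGroup A] [Module k A] [TopologicalSpace A]
    (f g : C(I, A)) : Prop :=
  ∀ t : I, Tendsto (fun s : I => (((s : ℝ) - (t : ℝ) : ℝ) : k)⁻¹ • (f s - f t))
    (𝓝[≠] t) (𝓝 (g t))

variable {k}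
variable {A : Type u} [AddCommGroup A] [Module k A]

instance neBot_punctured_unitInterval (t : I) : (𝓝[≠] t).NeBot := by
  infer_instance

theorem polynormable_of_locallyConvex [TopologicalSpace A] [IsTopologicalAddGroup A]
    [ContinuousSMul k A] [LocallyConvexSpace k A] : PolynormableSpace k A := by
  let _ : Module ℝ A := Module.compHom A (algebraMap ℝ k)
  have : IsScalarTower ℝ k A := ⟨fun x y z => by
    rw [Algebra.smul_def, mul_smul]; rfl⟩
  have : ContinuousSMul ℝ A := ⟨by
    have : Continuous fun q : ℝ × A => (q.1 : k) • q.2 := by fun_prop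
    exact this⟩
  exact LocallyConvexSpace.toPolynormableSpace

section lin
variable [TopologicalSpace A]

theorem HasDerivI.const [IsTopologicalAddGroup A] (a : A) :
    HasDerivI k (ContinuousMap.const I a) 0 := by
  intro t
  simpa using tendsto_const_nhds

theorem HasDerivI.add [IsTopologicalAddGroup A] {f g f' g' : C(I, A)}
    (hf : HasDerivI k f f') (hg : HasDerivI k g g') : HasDerivI k (f + g) (f' + g') := by
  intro t
  refine ((hf t).add (hg t)).congr fun s => ?_
  simp only [ContinuousMap.add_apply, ← smul_add]
  congr 1
  abel

theorem HasDerivI.smul [IsTopologicalAddGroup A] [ContinuousSMul k A] (c : k) {f f' : C(I, A)}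
    (hf : HasDerivI k f f') : HasDerivI k (c • f) (c • f') := by
  intro t
  refine ((hf t).const_smul c).congr fun s => ?_
  simp only [ContinuousMap.smul_apply, ← smul_sub]
  rw [smul_comm]

theorem HasDerivI.sum [IsTopologicalAddGroup A] {ι : Type*} (s : Finset ι) {f f' : ι → C(I, A)}
    (h : ∀ i ∈ s, HasDerivI k (f i) (f' i)) : HasDerivI k (∑ i ∈ s, f i) (∑ i ∈ s, f' i) := by
  classical
  induction s using Finset.induction_on with
  | empty => simpa using HasDerivI.const (k := k) (0 : A)
  | insert a s ha ih =>
    rw [Finset.sum_insert ha, Finset.sum_insert ha]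
    exact (h a (by simp)).add (ih fun i hi => h i (by simp [hi]))

theorem HasDerivI.nsmul [IsTopologicalAddGroup A] (c : ℕ) {f f' : C(I, A)}
    (hf : HasDerivI k f f') : HasDerivI k (c • f) (c • f') := by
  have := HasDerivI.sum (Finset.range c) (f := fun _ => f) (f' := fun _ => f') fun _ _ => hf
  simpa using this

theorem HasDerivI.unique [T2Space A] {f g g' : C(I, A)}
    (h : HasDerivI k f g) (h' : HasDerivI k f g') : g = g' := by
  ext t
  exact tendsto_nhds_unique (h t) (h' t)

end lin

theorem HasDerivI.mul {B : Type u} [NonUnitalRing B] [Module k B] [IsScalarTower k B B]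
    [SMulCommClass k B B] [TopologicalSpace B] [IsTopologicalAddGroup B] [ContinuousMul B]
    {f g f' g' : C(I, B)} (hf : HasDerivI k f f') (hg : HasDerivI k g g') :
    HasDerivI k (f * g) (f' * g + f * g') := by
  intro t
  have h1 : Tendsto g (𝓝[≠] t) (𝓝 (g t)) := (g.continuous.tendsto t).mono_left nhdsWithin_le_nhds
  refine (((hf t).mul h1).add ((hg t).const_mul (f t))).congr fun s => ?_
  simp only [ContinuousMap.mul_apply, smul_mul_assoc, mul_smul_comm, ← smul_add]
  congr 1
  noncomm_ring

/-- Mean value inequality with respect to a continuous seminorm. -/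
theorem HasDerivI.seminorm_le [TopologicalSpace A] [IsTopologicalAddGroup A]
    {f g : C(I, A)} (h : HasDerivI k f g)
    (p : Seminorm k A) (hp : Continuous p) (C : ℝ) (s t : I) (hst : s ≤ t)
    (hC : ∀ w ∈ Set.Icc s t, p (g w) ≤ C) : p (f t - f s) ≤ C * ((t : ℝ) - s) := by
  set pr : ℝ → I := Set.projIcc (0 : ℝ) 1 zero_le_one with hpr
  have hprv : ∀ x : I, pr x = x := fun x => Set.projIcc_val _ x
  have hprc : Continuous pr := continuous_projIcc
  have key := image_le_of_liminf_slope_right_le_deriv_boundary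
    (f := fun x => p (f (pr x) - f s)) (a := (s : ℝ)) (b := t)
    (B := fun x => C * (x - s)) (B' := fun _ => C) ?_ ?_ ?_ ?_ ?_
  · have := key (x := (t : ℝ)) ⟨hst, le_rfl⟩
    simpa [hprv] using this
  · exact (hp.comp ((f.continuous.comp hprc).sub continuous_const)).continuousOn
  · simp [hprv]
  · exact (by fun_prop : Continuous fun x : ℝ => C * (x - s)).continuousOn
  · intro x _
    simpa using (((hasDerivAt_id x).sub_const (s : ℝ)).const_mul C).hasDerivWithinAt
  · intro x hx r hr
    apply Eventually.frequently
    have hx0 : 0 ≤ x := s.2.1.trans hx.1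
    have hx1 : x < 1 := hx.2.trans_le t.2.2
    have hxI : (pr x : ℝ) = x := by
      have := hprv ⟨x, hx0, hx1.le⟩
      simpa using congrArg Subtype.val this
    have hlim : Tendsto pr (𝓝[>] x) (𝓝[≠] (pr x)) := by
      rw [tendsto_nhdsWithin_iff]
      refine ⟨(hprc.tendsto x).mono_left nhdsWithin_le_nhds, ?_⟩
      filter_upwards [Ioo_mem_nhdsGT hx1] with z hz
      have hz' : (pr z : ℝ) = z := by
        have := hprv ⟨z, hx0.trans hz.1.le, hz.2.le⟩
        simpa using congrArg Subtype.val this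
      intro hEq
      have : (pr z : ℝ) = pr x := congrArg Subtype.val hEq
      rw [hz', hxI] at this
      exact hz.1.ne' this
    have h2 := ((hp.tendsto _).comp ((h (pr x)).comp hlim))
    have hgx : p (g (pr x)) < r := lt_of_le_of_lt (hC _ ⟨by
      rw [← Subtype.coe_le_coe, hxI]; exact hx.1, by
      rw [← Subtype.coe_le_coe, hxI]; exact hx.2.le⟩) hr
    filter_upwards [h2.eventually_lt_const hgx, Ioo_mem_nhdsGT hx1] with z hz hzx
    have hz' : (pr z : ℝ) = z := by
      have := hprv ⟨z, hx0.trans hzx.1.le, hzx.2.le⟩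
      simpa using congrArg Subtype.val this
    refine lt_of_le_of_lt ?_ hz
    have hpos : 0 < z - x := sub_pos.2 hzx.1
    simp only [Function.comp_apply, map_smul_eq_mul, hz', hxI, norm_inv, RCLike.norm_ofReal,
      abs_of_pos hpos, slope_def_field]
    rw [div_eq_inv_mul]
    refine mul_le_mul_of_nonneg_left ?_ (inv_nonneg.2 hpos.le)
    have := map_add_le_add p (f (pr z) - f (pr x)) (f (pr x) - f s)
    rw [sub_add_sub_cancel] at this
    linarith

theorem HasDerivI.id_smul [TopologicalSpace A] [IsTopologicalAddGroup A] [ContinuousSMul k A]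
    (a : A) (F : C(I, A)) (hF : ∀ t : I, F t = ((t : ℝ) : k) • a) :
    HasDerivI k F (ContinuousMap.const I a) := by
  intro t
  refine tendsto_const_nhds.congr' ?_
  filter_upwards [self_mem_nhdsWithin] with s hs
  have hs' : (((s : ℝ) - (t : ℝ) : ℝ) : k) ≠ 0 := by
    rw [RCLike.ofReal_ne_zero, sub_ne_zero]
    exact fun h => hs (Subtype.ext h)
  rw [hF, hF, ← sub_smul, ← RCLike.ofReal_sub, smul_smul, inv_mul_cancel₀ hs', one_smul]
  rfl

theorem HasDerivI.seminorm_le' [TopologicalSpace A] [IsTopologicalAddGroup A] [ContinuousSMul k A]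
    {f g : C(I, A)} (h : HasDerivI k f g)
    (p : Seminorm k A) (hp : Continuous p) (C : ℝ) (a : A) (s t : I)
    (hC : ∀ w ∈ Set.uIcc s t, p (g w - a) ≤ C) :
    p (f s - f t - (((s : ℝ) - (t : ℝ) : ℝ) : k) • a) ≤ C * |(s : ℝ) - t| := by
  let L : C(I, A) := ⟨fun t => ((t : ℝ) : k) • a, by fun_prop⟩
  have hL : HasDerivI k L (ContinuousMap.const I a) := HasDerivI.id_smul a L fun _ => rfl
  have hfL : HasDerivI k (f + (-1 : k) • L) (g + (-1 : k) • ContinuousMap.const I a) :=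
    h.add (hL.smul _)
  have hval : ∀ w, (g + (-1 : k) • ContinuousMap.const I a) w = g w - a := by
    intro w; simp [sub_eq_add_neg]
  rcases le_total t s with hts | hst
  · have := hfL.seminorm_le p hp C t s hts (fun w hw => by
      rw [hval]; exact hC w (by rwa [Set.uIcc_of_ge hts]))
    have e : (f + (-1 : k) • L) s - (f + (-1 : k) • L) t
        = f s - f t - (((s : ℝ) - (t : ℝ) : ℝ) : k) • a := by
      simp [L, sub_smul]; abel
    rw [e] at this
    rwa [abs_of_nonneg (sub_nonneg.2 (Subtype.coe_le_coe.2 hts))]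
  · have := hfL.seminorm_le p hp C s t hst (fun w hw => by
      rw [hval]; exact hC w (by rwa [Set.uIcc_of_le hst]))
    have e : (f + (-1 : k) • L) t - (f + (-1 : k) • L) s
        = -(f s - f t - (((s : ℝ) - (t : ℝ) : ℝ) : k) • a) := by
      simp [L, sub_smul]; abel
    rw [e, map_neg_eq_map] at this
    rwa [abs_sub_comm, abs_of_nonneg (sub_nonneg.2 (Subtype.coe_le_coe.2 hst))]

theorem isClosed_hasDerivI [TopologicalSpace A] [IsTopologicalAddGroup A] [ContinuousSMul k A]
    [LocallyConvexSpace k A] :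
    IsClosed {q : C(I, A) × C(I, A) | HasDerivI k q.1 q.2} := by
  have : PolynormableSpace k A := polynormable_of_locallyConvex
  have hW := PolynormableSpace.withSeminorms k A
  refine isClosed_of_closure_subset ?_
  rintro ⟨f, g⟩ hfg t
  rw [hW.tendsto_nhds]
  rintro ⟨p, hp⟩ ε hε
  have hg : ∀ᶠ w in 𝓝 t, p (g w - g t) < ε / 2 := by
    have : Tendsto (fun w => p (g w - g t)) (𝓝 t) (𝓝 (p (g t - g t))) :=
      (hp.comp (g.continuous.sub continuous_const)).tendsto t
    exact this.eventually_lt_const (by simpa using half_pos hε)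
  obtain ⟨δ, hδ, hball⟩ := Metric.eventually_nhds_iff.1 hg
  have hs : ∀ᶠ s in 𝓝[≠] t, dist s t < δ :=
    nhdsWithin_le_nhds (Metric.ball_mem_nhds t hδ)
  filter_upwards [hs, self_mem_nhdsWithin] with s hsδ hst
  have hpos : 0 < |(s : ℝ) - t| := abs_pos.2 (sub_ne_zero.2 fun h => hst (Subtype.ext h))
  have hle1 : |(s : ℝ) - t| ≤ 1 :=
    abs_le.2 ⟨by linarith [s.2.1, t.2.2], by linarith [s.2.2, t.2.1]⟩
  have main : p (f s - f t - (((s : ℝ) - (t : ℝ) : ℝ) : k) • g t) ≤ ε / 2 * |(s : ℝ) - t| := by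
    refine le_of_forall_pos_le_add fun η' hη' => ?_
    obtain ⟨η, hη, hη3⟩ : ∃ η > 0, 3 * η = η' := ⟨η' / 3, by positivity, by ring⟩
    have hnhd : ∀ F : C(I, A), {F' : C(I, A) | ∀ x, p (F' x - F x) < η} ∈ 𝓝 F := by
      intro F
      have h0 : ∀ᶠ h : C(I, A) in 𝓝 0, Set.MapsTo h Set.univ (p.ball 0 η) := by
        refine ContinuousMap.eventually_mapsTo isCompact_univ ?_ ?_
        · have : p.ball 0 η = {x | p x < η} := by ext; simp [Seminorm.mem_ball]
          rw [this]
          exact isOpen_lt hp continuous_const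
        · intro x _
          simpa [Seminorm.mem_ball] using hη
      have hc : Tendsto (fun F' : C(I, A) => F' - F) (𝓝 F) (𝓝 0) := by
        have : Continuous fun F' : C(I, A) => F' - F := by fun_prop
        simpa using this.tendsto F
      filter_upwards [hc.eventually h0] with F' hF' x
      simpa [Seminorm.mem_ball] using hF' (Set.mem_univ x)
    obtain ⟨⟨f', g'⟩, ⟨hf', hg'⟩, hd⟩ := mem_closure_iff_nhds.1 hfg _
      (prod_mem_nhds (hnhd f) (hnhd g))
    simp only [Set.mem_ofPred_eq] at hf' hg' hd
    have h1 := hd.seminorm_le' p hp (ε / 2 + η) (g t) s t (fun w hw => by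
      have hw' : p (g w - g t) < ε / 2 := by
        apply hball
        refine lt_of_le_of_lt ?_ hsδ
        rw [Subtype.dist_eq, Subtype.dist_eq, Real.dist_eq, Real.dist_eq]
        rcases le_total s t with h | h
        · rw [Set.uIcc_of_le h] at hw
          have e1 : (s : ℝ) ≤ w := hw.1
          have e2 : (w : ℝ) ≤ t := hw.2
          rw [abs_of_nonpos (by linarith), abs_of_nonpos (by linarith)]; linarith
        · rw [Set.uIcc_of_ge h] at hw
          have e1 : (t : ℝ) ≤ w := hw.1
          have e2 : (w : ℝ) ≤ s := hw.2
          rw [abs_of_nonneg (by linarith), abs_of_nonneg (by linarith)]; linarith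
      have := map_add_le_add p (g' w - g w) (g w - g t)
      rw [sub_add_sub_cancel] at this
      linarith [hg' w])
    have e : f s - f t - (((s : ℝ) - (t : ℝ) : ℝ) : k) • g t
        = (f' s - f' t - (((s : ℝ) - (t : ℝ) : ℝ) : k) • g t) + (-(f' s - f s) + (f' t - f t)) := by
      abel
    rw [e]
    have h2 := map_add_le_add p (f' s - f' t - (((s : ℝ) - (t : ℝ) : ℝ) : k) • g t)
      (-(f' s - f s) + (f' t - f t))
    have h3 := map_add_le_add p (-(f' s - f s)) (f' t - f t)
    rw [map_neg_eq_map] at h3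
    have h4 : η * |(s : ℝ) - t| ≤ η := by nlinarith
    nlinarith [hf' s, hf' t]
  have hne : (((s : ℝ) - (t : ℝ) : ℝ) : k) ≠ 0 := by
    rw [RCLike.ofReal_ne_zero]; exact abs_pos.1 hpos
  have e : (((s : ℝ) - (t : ℝ) : ℝ) : k)⁻¹ • (f s - f t) - g t
      = (((s : ℝ) - (t : ℝ) : ℝ) : k)⁻¹ • (f s - f t - (((s : ℝ) - (t : ℝ) : ℝ) : k) • g t) := by
    rw [smul_sub _ (f s - f t), smul_smul, inv_mul_cancel₀ hne, one_smul]
  show p _ < ε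
  rw [e, map_smul_eq_mul, norm_inv, RCLike.norm_ofReal]
  calc |(s : ℝ) - t|⁻¹ * p (f s - f t - (((s : ℝ) - (t : ℝ) : ℝ) : k) • g t)
      ≤ |(s : ℝ) - t|⁻¹ * (ε / 2 * |(s : ℝ) - t|) := by gcongr
    _ = ε / 2 := by field_simp
    _ < ε := half_lt_self hε

end Curves

section

instance {A : Type u} [AddCommGroup A] [UniformSpace A] [IsUniformAddGroup A] :
    IsUniformAddGroup C(I, A) :=
  ContinuousMap.isUniformEmbedding_toUniformOnFunIsCompact.isUniformInducing.isUniformAddGroup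
    (⟨⟨ContinuousMap.toUniformOnFunIsCompact, rfl⟩, fun _ _ => rfl⟩ :
      C(I, A) →+ UniformOnFun I A {K | IsCompact K})

section Jets

variable (k : Type v) [RCLike k]

/-- The smooth maps `[0,1] → A`, each recorded together with the sequence of its derivatives:
`F 0` is the map itself and `F n` is its `n`-th derivative (they are determined by `F 0`, see
`smoothJets_ext`).  As a subspace of the product of the spaces `C([0,1], A)` with uniform
convergence it carries the topology given by the seminorms
`f ↦ sup_t ∑_{j ≤ r} ‖f^(j)(t)‖_s`. -/
def smoothJets (A : Type u) [AddCommGroup A] [Module k A] [TopologicalSpace A]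
    [IsTopologicalAddGroup A] [ContinuousSMul k A] : Submodule k (ℕ → C(I, A)) where
  carrier := {F | ∀ n, HasDerivI k (F n) (F (n + 1))}
  zero_mem' _ := HasDerivI.const 0
  add_mem' hF hG n := (hF n).add (hG n)
  smul_mem' c _ hF n := (hF n).smul c

variable {k}

theorem smoothJets_ext {A : Type u} [AddCommGroup A] [Module k A] [TopologicalSpace A]
    [IsTopologicalAddGroup A] [ContinuousSMul k A] [T2Space A] {F G : smoothJets k A}
    (h : ∀ t, F.1 0 t = G.1 0 t) : F = G := by
  refine Subtype.ext (funext fun n => ?_)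
  induction n with
  | zero => exact ContinuousMap.ext h
  | succ n ih =>
    have h1 := F.2 n
    rw [ih] at h1
    exact h1.unique (G.2 n)

section
variable {A : Type u} [NonUnitalRing A] [Module k A] [IsScalarTower k A A] [SMulCommClass k A A]
  [TopologicalSpace A] [IsTopologicalAddGroup A] [ContinuousSMul k A] [ContinuousMul A]

/-- The pointwise product; the derivatives are given by the Leibniz rule. -/
instance : Mul (smoothJets k A) where
  mul F G := ⟨fun n => ∑ q ∈ Finset.HasAntidiagonal.antidiagonal n, (n.choose q.1) • (F.1 q.1 * G.1 q.2), by
    intro n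
    have h := HasDerivI.sum (k := k) (Finset.HasAntidiagonal.antidiagonal n)
      (f := fun q => (n.choose q.1) • (F.1 q.1 * G.1 q.2))
      (f' := fun q => (n.choose q.1) • (F.1 (q.1 + 1) * G.1 q.2 + F.1 q.1 * G.1 (q.2 + 1)))
      fun q _ => ((F.2 q.1).mul (G.2 q.2)).nsmul _
    convert h using 1
    beta_reduce
    rw [Finset.sum_antidiagonal_choose_succ_nsmul (fun i j => F.1 i * G.1 j) n,
      ← Finset.sum_add_distrib]
    refine Finset.sum_congr rfl fun q hq => ?_
    rw [smul_add, add_comm, ← Nat.choose_symm_of_eq_add (Finset.HasAntidiagonal.mem_antidiagonal.1 hq).symm]⟩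

theorem smoothJets_mul_apply (F G : smoothJets k A) (t : I) :
    (F * G).1 0 t = F.1 0 t * G.1 0 t := by
  change (∑ q ∈ Finset.HasAntidiagonal.antidiagonal 0, (Nat.choose 0 q.1) • (F.1 q.1 * G.1 q.2)) t = _
  simp

instance [T2Space A] : NonUnitalRing (smoothJets k A) where
  __ := (inferInstance : AddCommGroup (smoothJets k A))
  __ := (inferInstance : Mul (smoothJets k A))
  left_distrib F G H := smoothJets_ext fun t => by
    simp [smoothJets_mul_apply, mul_add]
  right_distrib F G H := smoothJets_ext fun t => by
    simp [smoothJets_mul_apply, add_mul]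
  zero_mul F := smoothJets_ext fun t => by simp [smoothJets_mul_apply]
  mul_zero F := smoothJets_ext fun t => by simp [smoothJets_mul_apply]
  mul_assoc F G H := smoothJets_ext fun t => by simp [smoothJets_mul_apply, mul_assoc]

instance [T2Space A] : IsScalarTower k (smoothJets k A) (smoothJets k A) where
  smul_assoc c F G := smoothJets_ext fun t => by
    simp [smoothJets_mul_apply, smul_mul_assoc]

instance [T2Space A] : SMulCommClass k (smoothJets k A) (smoothJets k A) where
  smul_comm c F G := smoothJets_ext fun t => by
    simp [smoothJets_mul_apply, mul_smul_comm]

instance : ContinuousMul (smoothJets k A) where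
  continuous_mul := by
    refine Continuous.subtype_mk (continuous_pi fun n => ?_) _
    refine continuous_finsetSum _ fun q _ => ?_
    refine Continuous.fun_const_smul ?_ _
    exact ((continuous_apply q.1).comp (continuous_subtype_val.comp continuous_fst)).mul
      ((continuous_apply q.2).comp (continuous_subtype_val.comp continuous_snd))

end

instance {A : Type u} [AddCommGroup A] [Module k A] [UniformSpace A]
    [IsUniformAddGroup A] [ContinuousSMul k A] : IsUniformAddGroup (smoothJets k A) :=
  (smoothJets k A).toAddSubgroup.isUniformAddGroup

instance {A : Type u} [AddCommGroup A] [Module k A] [UniformSpace A]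
    [IsUniformAddGroup A] [ContinuousSMul k A] [LocallyConvexSpace k A] [CompleteSpace A] :
    CompleteSpace (smoothJets k A) := by
  have hc : IsClosed ((smoothJets k A : Submodule k (ℕ → C(I, A))) : Set (ℕ → C(I, A))) := by
    have : ((smoothJets k A : Submodule k (ℕ → C(I, A))) : Set (ℕ → C(I, A)))
        = ⋂ n, (fun F : ℕ → C(I, A) => (F n, F (n + 1))) ⁻¹'
          {q : C(I, A) × C(I, A) | HasDerivI k q.1 q.2} := by
      ext F; simp [smoothJets]
    rw [this]
    exact isClosed_iInter fun n => isClosed_hasDerivI.preimage (by fun_prop)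
  exact hc.completeSpace_coe

end Jets

/-- A locally convex `k`-algebra, `k = ℝ` or `ℂ`: an associative algebra, not necessarily unital,
with a complete Hausdorff locally convex topology for which the multiplication is jointly
continuous. -/
structure LCAlg (k : Type v) [RCLike k] where
  carrier : Type u
  [ring : NonUnitalRing carrier]
  [module : Module k carrier]
  [isScalarTower : IsScalarTower k carrier carrier]
  [smulCommClass : SMulCommClass k carrier carrier]
  [uniformSpace : UniformSpace carrier]
  [isUniformAddGroup : IsUniformAddGroup carrier]
  [continuousSMul : ContinuousSMul k carrier]
  [continuousMul : ContinuousMul carrier]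
  [locallyConvex : LocallyConvexSpace k carrier]
  [t2Space : T2Space carrier]
  [completeSpace : CompleteSpace carrier]

attribute [instance] LCAlg.ring LCAlg.module LCAlg.isScalarTower LCAlg.smulCommClass
  LCAlg.uniformSpace LCAlg.isUniformAddGroup LCAlg.continuousSMul LCAlg.continuousMul
  LCAlg.locallyConvex LCAlg.t2Space LCAlg.completeSpace

instance (k : Type v) [RCLike k] : CoeSort (LCAlg.{u} k) (Type u) := ⟨LCAlg.carrier⟩

variable {k : Type v} [RCLike k]

/-- Morphisms of locally convex algebras: continuous `k`-algebra homomorphisms. -/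
structure LCHom (A : LCAlg.{u₁} k) (B : LCAlg.{u₂} k) extends A →ₙₐ[k] B where
  cont : Continuous toFun

instance (A : LCAlg.{u₁} k) (B : LCAlg.{u₂} k) : CoeFun (LCHom A B) fun _ => A → B :=
  ⟨fun f => f.toNonUnitalAlgHom⟩

theorem LCHom.continuous {A : LCAlg.{u₁} k} {B : LCAlg.{u₂} k} (f : LCHom A B) : Continuous f :=
  f.cont

@[ext] theorem LCHom.ext {A : LCAlg.{u₁} k} {B : LCAlg.{u₂} k} {f g : LCHom A B}
    (h : ∀ a, f a = g a) : f = g := by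
  cases f; cases g
  congr 1
  exact NonUnitalAlgHom.ext h

/-- Composition of morphisms. -/
def LCHom.comp {A : LCAlg.{u₁} k} {B : LCAlg.{u₂} k} {C : LCAlg.{u₃} k}
    (g : LCHom B C) (f : LCHom A B) : LCHom A C where
  toNonUnitalAlgHom := g.toNonUnitalAlgHom.comp f.toNonUnitalAlgHom
  cont := g.continuous.comp f.continuous

/-- The locally convex algebra `A^{∞(I)}` of smooth maps `[0,1] → A`. -/
def smoothCurves (A : LCAlg.{u} k) : LCAlg.{u} k where
  carrier := smoothJets k A

/-- The evaluation `ε_t : A^{∞(I)} → A`, `f ↦ f(t)`. -/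
def eval (A : LCAlg.{u} k) (t : I) : LCHom (smoothCurves A) A where
  toFun := fun F : smoothJets k A => F.1 0 t
  map_smul' _ _ := rfl
  map_zero' := rfl
  map_add' _ _ := rfl
  map_mul' F G := smoothJets_mul_apply (k := k) F G t
  cont := by
    have h : Continuous fun F : smoothJets k A => F.1 0 t :=
      (continuous_eval_const (F := C(I, A)) t).comp
        ((continuous_apply 0).comp continuous_subtype_val)
    exact h

/-- The constant curve with value `a`. -/
def constJet (A : LCAlg.{u} k) (a : A) : smoothJets k A :=
  ⟨fun n => Nat.casesOn n (ContinuousMap.const I a) fun _ => 0, fun n => by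
    cases n
    · exact HasDerivI.const a
    · exact HasDerivI.const 0⟩

/-- The inclusion `A → A^{∞(I)}` as constant curves. -/
def constCurve (A : LCAlg.{u} k) : LCHom A (smoothCurves A) where
  toFun := constJet A
  map_smul' _ _ := smoothJets_ext fun _ => rfl
  map_zero' := smoothJets_ext fun _ => rfl
  map_add' _ _ := smoothJets_ext fun _ => rfl
  map_mul' a b := smoothJets_ext fun t => (smoothJets_mul_apply (constJet A a) (constJet A b) t).symm
  cont := by
    have h : Continuous fun (a : A) (n : ℕ) => (constJet A a).1 n := by
      refine continuous_pi fun n => ?_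
      cases n
      · exact ContinuousMap.continuous_const'
      · exact continuous_const
    exact h.subtype_mk _

/-- The composite `φ ∘ f`. -/
def mapJet {A : LCAlg.{u₁} k} {B : LCAlg.{u₂} k} (φ : LCHom A B) (F : smoothJets k A) :
    smoothJets k B :=
  ⟨fun n => (⟨φ, φ.continuous⟩ : C(A, B)).comp (F.1 n), fun n t => by
    have h := (φ.continuous.tendsto _).comp (F.2 n t)
    refine h.congr fun s => ?_
    simp only [Function.comp_apply, map_smul, map_sub, ContinuousMap.comp_apply,
      ContinuousMap.coe_mk]⟩

/-- The morphism `φ^{∞(I)} : A^{∞(I)} → B^{∞(I)}`, `f ↦ φ ∘ f`. -/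
def curvesMap {A : LCAlg.{u₁} k} {B : LCAlg.{u₂} k} (φ : LCHom A B) :
    LCHom (smoothCurves A) (smoothCurves B) where
  toFun := mapJet φ
  map_smul' c F := smoothJets_ext fun t => map_smul φ.toNonUnitalAlgHom c _
  map_zero' := smoothJets_ext fun t => map_zero φ.toNonUnitalAlgHom
  map_add' F G := smoothJets_ext fun t => map_add φ.toNonUnitalAlgHom _ _
  map_mul' := fun F G : smoothJets k A => smoothJets_ext fun t => by
    have h : φ.toNonUnitalAlgHom ((F * G).1 0 t)
        = φ.toNonUnitalAlgHom (F.1 0 t) * φ.toNonUnitalAlgHom (G.1 0 t) := by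
      rw [smoothJets_mul_apply, map_mul]
    exact h.trans (smoothJets_mul_apply (mapJet φ F) (mapJet φ G) t).symm
  cont := by
    have h : Continuous fun (F : smoothJets k A) (n : ℕ) =>
        (⟨φ, φ.continuous⟩ : C(A, B)).comp (F.1 n) :=
      continuous_pi fun n => (ContinuousMap.continuous_postcomp _).comp
        ((continuous_apply n).comp continuous_subtype_val)
    exact h.subtype_mk _

/-- The path algebra `𝓘(A) = Ker(ε₀)`: the smooth curves `f` with `f(0) = 0`, with the subspace
topology. -/
def pathSub (A : LCAlg.{u} k) : NonUnitalSubalgebra k (smoothCurves A) where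
  carrier := {F | eval A 0 F = 0}
  add_mem' {F G} hF hG := by
    simp only [Set.mem_ofPred_eq, map_add] at *; rw [hF, hG, add_zero]
  zero_mem' := map_zero _
  mul_mem' {F G} hF hG := by
    simp only [Set.mem_ofPred_eq, map_mul] at *; rw [hF, hG, mul_zero]
  smul_mem' c {F} hF := by
    simp only [Set.mem_ofPred_eq, map_smul] at *; rw [hF, smul_zero]

theorem isClosed_pathSub (A : LCAlg.{u} k) : IsClosed (pathSub A : Set (smoothCurves A)) :=
  isClosed_singleton.preimage (eval A 0).continuous

/-- The functor `𝓘` on objects. -/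
def path (A : LCAlg.{u} k) : LCAlg.{u} k :=
  haveI : IsUniformAddGroup (pathSub A) :=
    (pathSub A).toSubmodule.toAddSubgroup.isUniformAddGroup
  haveI : LocallyConvexSpace k (pathSub A) :=
    inferInstanceAs (LocallyConvexSpace k (pathSub A).toSubmodule)
  haveI : ContinuousSMul k (pathSub A) :=
    inferInstanceAs (ContinuousSMul k (pathSub A).toSubmodule)
  haveI : ContinuousMul (pathSub A) := ⟨by
    refine Continuous.subtype_mk ?_ _
    exact (continuous_subtype_val.comp continuous_fst).mul
      (continuous_subtype_val.comp continuous_snd)⟩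
  haveI : CompleteSpace (pathSub A) := (isClosed_pathSub A).completeSpace_coe
  { carrier := pathSub A }

/-- The inclusion `𝓘(A) → A^{∞(I)}`. -/
def pathIncl (A : LCAlg.{u} k) : LCHom (path A) (smoothCurves A) where
  toNonUnitalAlgHom := NonUnitalSubalgebraClass.subtype (pathSub A)
  cont := continuous_subtype_val

/-- The counit `τ_A : 𝓘(A) → A`, `f ↦ f(1)`. -/
def tau (A : LCAlg.{u} k) : LCHom (path A) A := (eval A 1).comp (pathIncl A)

/-- The functor `𝓘` on morphisms. -/
def pathMap {A : LCAlg.{u₁} k} {B : LCAlg.{u₂} k} (φ : LCHom A B) : LCHom (path A) (path B) where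
  toFun := fun F : pathSub A => (⟨curvesMap φ F.1, by
    have h : φ (eval A 0 F.1) = 0 := by
      rw [show eval A 0 F.1 = 0 from F.2]; exact map_zero φ.toNonUnitalAlgHom
    exact h⟩ : pathSub B)
  map_smul' c F := Subtype.ext (map_smul (curvesMap φ).toNonUnitalAlgHom c F.1)
  map_zero' := Subtype.ext (map_zero (curvesMap φ).toNonUnitalAlgHom)
  map_add' F G := Subtype.ext (map_add (curvesMap φ).toNonUnitalAlgHom F.1 G.1)
  map_mul' F G := Subtype.ext (map_mul (curvesMap φ).toNonUnitalAlgHom F.1 G.1)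
  cont := by
    have h : Continuous fun F : pathSub A => curvesMap φ F.1 :=
      (curvesMap φ).continuous.comp continuous_subtype_val
    exact h.subtype_mk _

theorem tau_naturality {A : LCAlg.{u₁} k} {B : LCAlg.{u₂} k} (φ : LCHom A B) :
    (tau B).comp (pathMap φ) = φ.comp (tau A) := rfl

theorem pathMap_comp {A : LCAlg.{u₁} k} {B : LCAlg.{u₂} k} {C : LCAlg.{u₃} k}
    (g : LCHom B C) (f : LCHom A B) : pathMap (g.comp f) = (pathMap g).comp (pathMap f) := rfl

end

section

/-! ### The stable general linear group -/

section StableGL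

variable {R : Type u} [Ring R] {S : Type u₁} [Ring S] {T : Type u₂} [Ring T]

/-- The block sum `diag(p, q)` of two square matrices. -/
def blockSum {m n : ℕ} (p : Matrix (Fin m) (Fin m) R) (q : Matrix (Fin n) (Fin n) R) :
    Matrix (Fin (m + n)) (Fin (m + n)) R :=
  Matrix.reindex finSumFinEquiv finSumFinEquiv (Matrix.fromBlocks p 0 0 q)

/-- The stabilisation `M ↦ diag(M, 1)` from `m × m` to `n × n` matrices, `m ≤ n`. -/
def stabMat {m n : ℕ} (M : Matrix (Fin m) (Fin m) R) : Matrix (Fin n) (Fin n) R :=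
  Matrix.of fun i j =>
    if hi : (i : ℕ) < m then if hj : (j : ℕ) < m then M ⟨i, hi⟩ ⟨j, hj⟩ else 0
    else if i = j then 1 else 0

/-- The stabilisation `M ↦ diag(M, 1)` is multiplicative. -/
def stab (R : Type u) [Ring R] {m n : ℕ} (h : m ≤ n) :
    Matrix (Fin m) (Fin m) R →* Matrix (Fin n) (Fin n) R where
  toFun := stabMat
  map_one' := by
    ext i j
    simp only [stabMat, Matrix.of_apply, Matrix.one_apply, Fin.ext_iff]
    split_ifs <;> first | rfl | omega
  map_mul' M N := by
    obtain ⟨d, rfl⟩ := Nat.exists_eq_add_of_le h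
    ext i j
    rw [Matrix.mul_apply, Fin.sum_univ_add]
    refine Fin.addCases (fun i => ?_) (fun i => ?_) i <;>
    refine Fin.addCases (fun j => ?_) (fun j => ?_) j <;>
    simp [stabMat, Matrix.mul_apply, Fin.ext_iff]
    · have h1 : ∀ x : Fin m, m + (i : ℕ) ≠ x := fun x => by omega
      have h2 : ∀ x : Fin d, m + (x : ℕ) ≠ j := fun x => by omega
      simp [h1, h2]
    · simp [← Fin.ext_iff]

theorem stab_map (f : R →+* S) {m n : ℕ} (h : m ≤ n) (M : Matrix (Fin m) (Fin m) R) :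
    (stab R h M).map f = stab S h (M.map f) := by
  ext i j
  change f (stabMat M i j) = stabMat (M.map f) i j
  simp only [stabMat, Matrix.of_apply, Matrix.map_apply]
  split_ifs <;> simp

/-- The stabilisation homomorphism `GL_m(R) → GL_n(R)`. -/
def stabGL (R : Type u) [Ring R] (m n : ℕ) (h : m ≤ n) :
    (Matrix (Fin m) (Fin m) R)ˣ →* (Matrix (Fin n) (Fin n) R)ˣ :=
  Units.map (stab R h)

instance : DirectedSystem (fun m => (Matrix (Fin m) (Fin m) R)ˣ) (stabGL R · · ·) where
  map_self m x := by
    ext i j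
    change stabMat x.1 i j = _
    simp [stabMat]
  map_map l m n h₁ h₂ x := by
    ext i j
    change stabMat (stabMat x.1) i j = stabMat x.1 i j
    simp only [stabMat, Matrix.of_apply, Fin.ext_iff]
    split_ifs <;> first | rfl | omega

/-- `GL(R) = lim GL_m(R)` for a unital ring `R`. -/
abbrev StableGL (R : Type u) [Ring R] : Type u :=
  DirectLimit (fun m => (Matrix (Fin m) (Fin m) R)ˣ) (stabGL R)

/-- The canonical homomorphism `GL_m(R) → GL(R)`. -/
def StableGL.of (m : ℕ) : (Matrix (Fin m) (Fin m) R)ˣ →* StableGL R where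
  toFun x := ⟦⟨m, x⟩⟧
  map_one' := (DirectLimit.one_def (f := stabGL R) m).symm
  map_mul' x y := (DirectLimit.mul_def (f := stabGL R) m x y).symm

/-- `GL_m(f) : GL_m(R) → GL_m(S)`. -/
def mapGL (f : R →+* S) (m : ℕ) : (Matrix (Fin m) (Fin m) R)ˣ →* (Matrix (Fin m) (Fin m) S)ˣ :=
  Units.map (f.mapMatrix : Matrix (Fin m) (Fin m) R →+* Matrix (Fin m) (Fin m) S)

theorem mapGL_stabGL (f : R →+* S) (m n : ℕ) (h : m ≤ n) (x : (Matrix (Fin m) (Fin m) R)ˣ) :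
    stabGL S m n h (mapGL f m x) = mapGL f n (stabGL R m n h x) := by
  apply Units.ext
  exact (stab_map f h x.1).symm

/-- `GL(f) : GL(R) → GL(S)`. -/
def StableGL.map (f : R →+* S) : StableGL R →* StableGL S where
  toFun := DirectLimit.map (stabGL R) (stabGL S) (fun m => mapGL f m) (mapGL_stabGL f)
  map_one' := by
    rw [DirectLimit.one_def 0, DirectLimit.map_def, map_one, DirectLimit.one_def 0]
  map_mul' := DirectLimit.induction₂ _ fun m x y => by
    rw [DirectLimit.mul_def, DirectLimit.map_def, DirectLimit.map_def, DirectLimit.map_def,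
      map_mul, DirectLimit.mul_def]

@[simp] theorem StableGL.map_of (f : R →+* S) (m : ℕ) (x : (Matrix (Fin m) (Fin m) R)ˣ) :
    StableGL.map f (StableGL.of m x) = StableGL.of m (mapGL f m x) := rfl

theorem StableGL.map_comp (g : S →+* T) (f : R →+* S) (x : StableGL R) :
    StableGL.map (g.comp f) x = StableGL.map g (StableGL.map f x) := by
  induction x using DirectLimit.induction with
  | ih m x => rfl

theorem StableGL.map_id (x : StableGL R) : StableGL.map (RingHom.id R) x = x := by
  induction x using DirectLimit.induction with
  | ih m x => rfl

end StableGL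

variable {k : Type v} [RCLike k]

/-- The unital ring homomorphism `φ⁺ : A⁺ → B⁺`, `A⁺ = A + k`. -/
def plusMap {A : LCAlg.{u₁} k} {B : LCAlg.{u₂} k} (φ : LCHom A B) :
    Unitization k A →+* Unitization k B :=
  (Unitization.lift ((Unitization.inrNonUnitalAlgHom k B).comp φ.toNonUnitalAlgHom)).toRingHom

/-- The augmentation `A⁺ → k`. -/
def aug (A : LCAlg.{u} k) : Unitization k A →+* k := (Unitization.fstHom k A).toRingHom

theorem aug_plusMap {A : LCAlg.{u₁} k} {B : LCAlg.{u₂} k} (φ : LCHom A B) :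
    (aug B).comp (plusMap φ) = aug A := by
  ext x
  simp [aug, plusMap, Unitization.algebraMap_eq_inl]

theorem plusMap_comp {A : LCAlg.{u₁} k} {B : LCAlg.{u₂} k} {C : LCAlg.{u₃} k}
    (g : LCHom B C) (f : LCHom A B) : plusMap (g.comp f) = (plusMap g).comp (plusMap f) := by
  ext x <;> simp [plusMap, LCHom.comp, Unitization.algebraMap_eq_inl]

/-- `GL(A) = Ker(GL(A⁺) → GL(k))`. -/
noncomputable def GLalg (A : LCAlg.{u} k) : Subgroup (StableGL (Unitization k A)) :=
  (StableGL.map (aug A)).ker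

/-- `GL(φ) : GL(A) → GL(B)`. -/
noncomputable def GLmap {A : LCAlg.{u₁} k} {B : LCAlg.{u₂} k} (φ : LCHom A B) : GLalg A →* GLalg B :=
  ((StableGL.map (plusMap φ)).comp (GLalg A).subtype).codRestrict (GLalg B) fun x => by
    have hx : StableGL.map (aug A) x.1 = 1 := x.2
    rw [← aug_plusMap φ, StableGL.map_comp] at hx
    exact hx

theorem GLmap_comp {A : LCAlg.{u₁} k} {B : LCAlg.{u₂} k} {C : LCAlg.{u₃} k}
    (g : LCHom B C) (f : LCHom A B) : GLmap (g.comp f) = (GLmap g).comp (GLmap f) := by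
  ext x
  change StableGL.map (plusMap (g.comp f)) x.1
    = StableGL.map (plusMap g) (StableGL.map (plusMap f) x.1)
  rw [plusMap_comp, StableGL.map_comp]

end

section

section
variable {R : Type u} [Ring R] {S : Type u₁} [Ring S]

theorem stabGL_injective (m n : ℕ) (h : m ≤ n) : Function.Injective (stabGL R m n h) := by
  intro x y hxy
  ext i j
  have h0 : (stabGL R m n h x).1 = (stabGL R m n h y).1 := congrArg Units.val hxy
  have h1 : stabMat x.1 (Fin.castLE h i) (Fin.castLE h j)
      = stabMat y.1 (Fin.castLE h i) (Fin.castLE h j) := congrFun (congrFun h0 _) _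
  simpa [stabMat] using h1

theorem StableGL.of_injective (m : ℕ) : Function.Injective (StableGL.of (R := R) m) :=
  DirectLimit.mk_injective (stabGL R) stabGL_injective m

theorem StableGL.exists_of (x : StableGL R) : ∃ m y, x = StableGL.of m y :=
  DirectLimit.exists_eq_mk (stabGL R) x

theorem mapGL_injective {f : R →+* S} (hf : Function.Injective f) (m : ℕ) :
    Function.Injective (mapGL f m) := by
  intro x y h
  ext i j
  have h0 : (mapGL f m x).1 = (mapGL f m y).1 := congrArg Units.val h
  exact hf (congrFun (congrFun h0 i) j)

theorem StableGL.map_injective {f : R →+* S} (hf : Function.Injective f) :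
    Function.Injective (StableGL.map f) := by
  rw [injective_iff_map_eq_one]
  intro x hx
  obtain ⟨m, y, rfl⟩ := StableGL.exists_of x
  rw [StableGL.map_of, ← map_one (StableGL.of m)] at hx
  rw [mapGL_injective hf m (a₁ := y) (a₂ := 1) (by rw [map_one]; exact StableGL.of_injective m hx),
    map_one]

theorem mapGL_exists {f : R →+* S} (hf : Function.Injective f) {m : ℕ}
    (y : (Matrix (Fin m) (Fin m) S)ˣ) (h1 : ∀ i j, ∃ r, f r = y.1 i j)
    (h2 : ∀ i j, ∃ r, f r = y⁻¹.1 i j) : ∃ x, mapGL f m x = y := by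
  choose a ha using h1
  choose b hb using h2
  have hinj : Function.Injective (f.mapMatrix : Matrix (Fin m) (Fin m) R → _) := by
    intro p q hpq
    ext i j
    exact hf (congrFun (congrFun hpq i) j)
  have ea : f.mapMatrix (Matrix.of a) = y.1 := by ext i j; exact ha i j
  have eb : f.mapMatrix (Matrix.of b) = y⁻¹.1 := by ext i j; exact hb i j
  refine ⟨⟨Matrix.of a, Matrix.of b, hinj ?_, hinj ?_⟩, Units.ext ea⟩
  · rw [map_mul, ea, eb, map_one]; exact y.mul_inv
  · rw [map_mul, ea, eb, map_one]; exact y.inv_mul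

end

variable {k : Type v} [RCLike k]

theorem plusMap_fst {A : LCAlg.{u₁} k} {B : LCAlg.{u₂} k} (φ : LCHom A B) (x : Unitization k A) :
    (plusMap φ x).fst = x.fst := by
  simp [plusMap, Unitization.algebraMap_eq_inl]

theorem plusMap_snd {A : LCAlg.{u₁} k} {B : LCAlg.{u₂} k} (φ : LCHom A B) (x : Unitization k A) :
    (plusMap φ x).snd = φ x.snd := by
  simp [plusMap, Unitization.algebraMap_eq_inl]

theorem plusMap_injective {A : LCAlg.{u₁} k} {B : LCAlg.{u₂} k} {φ : LCHom A B}
    (h : Function.Injective φ) : Function.Injective (plusMap φ) := by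
  intro x y hxy
  refine Unitization.ext ?_ (h ?_)
  · rw [← plusMap_fst φ, hxy, plusMap_fst]
  · rw [← plusMap_snd φ, hxy, plusMap_snd]

theorem GLmap_injective {A : LCAlg.{u₁} k} {B : LCAlg.{u₂} k} {φ : LCHom A B}
    (h : Function.Injective φ) : Function.Injective (GLmap φ) := by
  intro x y hxy
  exact Subtype.ext (StableGL.map_injective (plusMap_injective h) (congrArg Subtype.val hxy))

theorem pathIncl_injective (A : LCAlg.{u} k) : Function.Injective (pathIncl A) :=
  Subtype.val_injective

/-- A curve in `GL(A^{∞(I)})` starting at `1` comes from `GL(𝓘(A))`. -/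
theorem exists_GLmap_pathIncl (A : LCAlg.{u} k) (y : GLalg (smoothCurves A))
    (hy : GLmap (eval A 0) y = 1) : ∃ z, GLmap (pathIncl A) z = y := by
  obtain ⟨m, w, hw⟩ := StableGL.exists_of y.1
  have hw1 : mapGL (plusMap (eval A 0)) m w = 1 := by
    apply StableGL.of_injective m
    rw [← StableGL.map_of, ← hw, map_one]
    exact congrArg Subtype.val hy
  have key : ∀ w : (Matrix (Fin m) (Fin m) (Unitization k (smoothCurves A)))ˣ,
      mapGL (plusMap (eval A 0)) m w = 1 → ∀ i j, ∃ r, plusMap (pathIncl A) r = w.1 i j := by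
    intro w hw i j
    have h0 : (mapGL (plusMap (eval A 0)) m w).1 = 1 := congrArg Units.val hw
    have h1 : plusMap (eval A 0) (w.1 i j) = (1 : Matrix (Fin m) (Fin m) (Unitization k A)) i j :=
      congrFun (congrFun h0 i) j
    have h2 : eval A 0 (w.1 i j).snd = 0 := by
      rw [← plusMap_snd, h1, Matrix.one_apply]
      split_ifs <;> simp
    let a : path A := (⟨(w.1 i j).snd, h2⟩ : pathSub A)
    refine ⟨Unitization.inl (w.1 i j).fst + (a : Unitization k (path A)), ?_⟩
    refine Unitization.ext ?_ ?_
    · rw [plusMap_fst]; simp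
    · rw [plusMap_snd]
      simp only [Unitization.snd_add, Unitization.snd_inl, Unitization.snd_inr, zero_add]
      rfl
  obtain ⟨x, hx⟩ := mapGL_exists (plusMap_injective (pathIncl_injective A)) w (key w hw1)
    (key w⁻¹ (by rw [map_inv, hw1, inv_one]))
  have hmem : StableGL.of m x ∈ GLalg (path A) := by
    change StableGL.map (aug (path A)) (StableGL.of m x) = 1
    rw [← aug_plusMap (pathIncl A), StableGL.map_comp, StableGL.map_of _ m x, hx, ← hw]
    exact y.2
  refine ⟨⟨_, hmem⟩, Subtype.ext ?_⟩
  rw [hw, ← hx]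
  rfl

theorem GLmap_comp_apply {A : LCAlg.{u₁} k} {B : LCAlg.{u₂} k} {C : LCAlg.{u₃} k}
    (g : LCHom B C) (f : LCHom A B) (x : GLalg A) : GLmap (g.comp f) x = GLmap g (GLmap f x) := by
  rw [GLmap_comp]; rfl

theorem GLmap_eval_constCurve (A : LCAlg.{u} k) (t : I) (g : GLalg A) :
    GLmap (eval A t) (GLmap (constCurve A) g) = g := by
  rw [← GLmap_comp_apply]
  refine Subtype.ext ?_
  have : plusMap ((eval A t).comp (constCurve A)) = RingHom.id _ :=
    RingHom.ext fun z => Unitization.ext (plusMap_fst _ z) (plusMap_snd _ z)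
  change StableGL.map (plusMap ((eval A t).comp (constCurve A))) g.1 = g.1
  rw [this, StableGL.map_id]

theorem GLmap_eq_one {A : LCAlg.{u₁} k} {B : LCAlg.{u₂} k} {φ : LCHom A B} (h : ∀ a, φ a = 0)
    (x : GLalg A) : GLmap φ x = 1 := by
  refine Subtype.ext ?_
  have e : plusMap φ = (algebraMap k (Unitization k B)).comp (aug A) := by
    refine RingHom.ext fun z => Unitization.ext (plusMap_fst _ z) ?_
    rw [plusMap_snd, h]
    simp [Unitization.algebraMap_eq_inl]
  change StableGL.map (plusMap φ) x.1 = 1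
  have hx : StableGL.map (aug A) x.1 = 1 := x.2
  rw [e, StableGL.map_comp, hx, map_one]

/-- The conjugate of a curve in `GL(𝓘(A))` by a constant curve again lies in `GL(𝓘(A))`. -/
theorem exists_conj (A : LCAlg.{u} k) (g : GLalg A) (x : GLalg (path A)) :
    ∃ z : GLalg (path A), GLmap (pathIncl A) z
      = GLmap (constCurve A) g * GLmap (pathIncl A) x * (GLmap (constCurve A) g)⁻¹ := by
  apply exists_GLmap_pathIncl
  have h : GLmap (eval A 0) (GLmap (pathIncl A) x) = 1 := by
    rw [← GLmap_comp_apply]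
    exact GLmap_eq_one (φ := (eval A 0).comp (pathIncl A)) (fun a : pathSub A => a.2) x
  rw [map_mul, map_mul, map_inv, GLmap_eval_constCurve, h, mul_one, mul_inv_cancel]

/-! ### The augmented simplicial group `GL(𝓘⁺_*(A))` and its homotopy groups -/

/-- The iterated path algebras: `pathIter A n = 𝓘ⁿ(A)`, so that the augmented simplicial algebra
`𝓘⁺_*(A)` has `𝓘_n(A) = 𝓘^{n+1}(A)` in degree `n ≥ 0` and `A = 𝓘⁰(A)` in degree `-1`. -/
def pathIter (A : LCAlg.{u} k) : ℕ → LCAlg.{u} k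
  | 0 => A
  | n + 1 => path (pathIter A n)

/-- The morphism `𝓘ⁿ(φ) : 𝓘ⁿ(A) → 𝓘ⁿ(B)`. -/
def pathIterMap {A : LCAlg.{u₁} k} {B : LCAlg.{u₂} k} (φ : LCHom A B) :
    (n : ℕ) → LCHom (pathIter A n) (pathIter B n)
  | 0 => φ
  | n + 1 => pathMap (pathIterMap φ n)

/-- The face operators `𝓘^i τ 𝓘^{n-i} : 𝓘^{n+1}(A) → 𝓘ⁿ(A)`, `0 ≤ i ≤ n`. -/
def face (A : LCAlg.{u} k) : (n : ℕ) → Fin (n + 1) → LCHom (pathIter A (n + 1)) (pathIter A n)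
  | 0 => fun _ => tau A
  | n + 1 => Fin.cases (tau (pathIter A (n + 1))) fun i => pathMap (face A n i)

theorem face_zero (A : LCAlg.{u} k) (n : ℕ) : face A n 0 = tau (pathIter A n) := by
  cases n <;> rfl

theorem face_naturality {A : LCAlg.{u₁} k} {B : LCAlg.{u₂} k} (φ : LCHom A B) (n : ℕ)
    (i : Fin (n + 1)) :
    (face B n i).comp (pathIterMap φ (n + 1)) = (pathIterMap φ n).comp (face A n i) := by
  induction n with
  | zero => exact tau_naturality φ
  | succ n ih =>
    cases i using Fin.cases with
    | zero => exact tau_naturality (pathIterMap φ (n + 1))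
    | succ i =>
      change (pathMap (face B n i)).comp (pathMap (pathIterMap φ (n + 1)))
        = (pathMap (pathIterMap φ n)).comp (pathMap (face A n i))
      rw [← pathMap_comp, ih, pathMap_comp]

/-- The Moore subgroup `⋂_{i ≥ 1} Ker d_i` of `GL(𝓘^{n+1}(A))`. -/
noncomputable def moore (A : LCAlg.{u} k) (n : ℕ) : Subgroup (GLalg (pathIter A (n + 1))) :=
  ⨅ i : Fin (n + 1), ⨅ _ : i ≠ 0, (GLmap (face A n i)).ker

/-- The Moore cycles `⋂_{i} Ker d_i` in `GL(𝓘ⁿ(A))` (all of `GL(A)` for `n = 0`). -/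
noncomputable def cycles (A : LCAlg.{u} k) : (n : ℕ) → Subgroup (GLalg (pathIter A n))
  | 0 => ⊤
  | n + 1 => ⨅ i : Fin (n + 1), (GLmap (face A n i)).ker

/-- The Moore boundaries `d_0(⋂_{i ≥ 1} Ker d_i)` in `GL(𝓘ⁿ(A))`. -/
noncomputable def boundaries (A : LCAlg.{u} k) (n : ℕ) : Subgroup (GLalg (pathIter A n)) :=
  (moore A n).map (GLmap (face A n 0))

theorem mem_moore {A : LCAlg.{u} k} {n : ℕ} {x : GLalg (pathIter A (n + 1))} :
    x ∈ moore A n ↔ ∀ i : Fin (n + 1), i ≠ 0 → GLmap (face A n i) x = 1 := by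
  simp [moore, Subgroup.mem_iInf, MonoidHom.mem_ker]

theorem mem_cycles_succ {A : LCAlg.{u} k} {n : ℕ} {x : GLalg (pathIter A (n + 1))} :
    x ∈ cycles A (n + 1) ↔ ∀ i : Fin (n + 1), GLmap (face A n i) x = 1 := by
  simp [cycles, Subgroup.mem_iInf, MonoidHom.mem_ker]

theorem boundaries_le_cycles (A : LCAlg.{u} k) (n : ℕ) : boundaries A n ≤ cycles A n := by
  rintro _ ⟨x, hx, rfl⟩
  cases n with
  | zero => trivial
  | succ n =>
    rw [mem_cycles_succ]
    intro i
    have h1 : (face A n i).comp (face A (n + 1) 0) = (face A n 0).comp (face A (n + 1) i.succ) := by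
      rw [face_zero, face_zero]
      exact (tau_naturality (face A n i)).symm
    have h2 : GLmap (face A (n + 1) i.succ) x = 1 := mem_moore.1 hx _ (Fin.succ_ne_zero i)
    rw [← MonoidHom.comp_apply, ← GLmap_comp, h1, GLmap_comp, MonoidHom.comp_apply, h2, map_one]

/-- Conjugating a curve by a constant curve shows that the boundaries form a normal subgroup. -/
instance boundaries_normal (A : LCAlg.{u} k) (n : ℕ) : (boundaries A n).Normal where
  conj_mem := by
    rintro _ ⟨x, hx, rfl⟩ g
    obtain ⟨z, hz⟩ := exists_conj (pathIter A n) g x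
    refine ⟨z, ?_, ?_⟩
    · refine mem_moore.2 fun i hi => ?_
      obtain ⟨i, rfl⟩ := Fin.exists_succ_eq.2 hi
      cases n with
      | zero => exact i.elim0
      | succ n =>
        apply GLmap_injective (pathIncl_injective (pathIter A n))
        have hx' : GLmap (pathMap (face A n i)) x = 1 := mem_moore.1 hx i.succ hi
        have h1 : ∀ w, GLmap (pathIncl (pathIter A n)) (GLmap (pathMap (face A n i)) w)
            = GLmap (curvesMap (face A n i)) (GLmap (pathIncl (pathIter A (n + 1))) w) := by
          intro w
          rw [← GLmap_comp_apply, ← GLmap_comp_apply]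
          rfl
        change GLmap (pathIncl (pathIter A n)) (GLmap (pathMap (face A n i)) z) = _
        have h2 := h1 x
        rw [hx', map_one] at h2
        rw [h1, hz, map_mul, map_mul, map_inv]
        refine (congrArg (fun w => _ * w * _) h2.symm).trans ?_
        rw [mul_one, mul_inv_cancel]
        exact (map_one (GLmap (pathIncl (pathIter A n)))).symm
    · have h1 : ∀ w, GLmap (tau (pathIter A n)) w
          = GLmap (eval (pathIter A n) 1) (GLmap (pathIncl (pathIter A n)) w) := fun w => by
        rw [← GLmap_comp_apply]; rfl
      rw [face_zero]
      change GLmap (tau (pathIter A n)) z = g * GLmap (tau (pathIter A n)) x * g⁻¹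
      rw [h1, hz, map_mul, map_mul, map_inv, GLmap_eval_constCurve]
      exact congrArg (fun w => g * w * g⁻¹) (h1 x).symm

/-- `π_{n-1}` of the augmented simplicial group `GL(𝓘⁺_*(A))`, as the homology in degree `n - 1`
of its Moore complex (`n ≥ 0`; this only involves the face operators). For `n = 0` it is the
cokernel of `GL(τ_A) : GL(𝓘(A)) → GL(A)`. -/
abbrev piAug (A : LCAlg.{u} k) (n : ℕ) : Type _ :=
  cycles A n ⧸ (boundaries A n).subgroupOf (cycles A n)

theorem GLmap_mem_cycles {A : LCAlg.{u₁} k} {B : LCAlg.{u₂} k} (φ : LCHom A B) (n : ℕ)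
    {x : GLalg (pathIter A n)} (hx : x ∈ cycles A n) :
    GLmap (pathIterMap φ n) x ∈ cycles B n := by
  cases n with
  | zero => trivial
  | succ n =>
    rw [mem_cycles_succ] at hx ⊢
    intro i
    rw [← GLmap_comp_apply, face_naturality, GLmap_comp_apply, hx i, map_one]

theorem GLmap_mem_boundaries {A : LCAlg.{u₁} k} {B : LCAlg.{u₂} k} (φ : LCHom A B) (n : ℕ)
    {x : GLalg (pathIter A n)} (hx : x ∈ boundaries A n) :
    GLmap (pathIterMap φ n) x ∈ boundaries B n := by
  obtain ⟨y, hy, rfl⟩ := hx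
  refine ⟨GLmap (pathIterMap φ (n + 1)) y, mem_moore.2 fun i hi => ?_, ?_⟩
  · rw [← GLmap_comp_apply, face_naturality, GLmap_comp_apply, mem_moore.1 hy i hi, map_one]
  · rw [← GLmap_comp_apply, face_naturality, GLmap_comp_apply]

/-- The map induced by `φ` on Moore cycles. -/
noncomputable def cyclesMap {A : LCAlg.{u₁} k} {B : LCAlg.{u₂} k} (φ : LCHom A B) (n : ℕ) :
    cycles A n →* cycles B n :=
  ((GLmap (pathIterMap φ n)).comp (cycles A n).subtype).codRestrict (cycles B n)
    fun x => GLmap_mem_cycles φ n x.2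

/-- The map induced by `φ` on homotopy groups. -/
noncomputable def piAugMap {A : LCAlg.{u₁} k} {B : LCAlg.{u₂} k} (φ : LCHom A B) (n : ℕ) :
    piAug A n →* piAug B n :=
  QuotientGroup.map _ _ (cyclesMap φ n) fun _ hx => GLmap_mem_boundaries φ n hx

end

section

/-! ### The Grothendieck group `K₀` -/

section KZero

variable {R : Type u} [Ring R] {S : Type u₁} [Ring S] {T : Type u₂} [Ring T]

/-- Algebraic (Murray–von Neumann) equivalence `p = x y`, `q = y x` of square matrices of possibly
different sizes. For idempotents it means that the finitely generated projective modules defined by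
`p` and `q` are isomorphic. -/
def MatEquiv {ι κ : Type*} [Fintype ι] [Fintype κ] (p : Matrix ι ι R) (q : Matrix κ κ R) : Prop :=
  ∃ (x : Matrix ι κ R) (y : Matrix κ ι R), x * y = p ∧ y * x = q

theorem MatEquiv.refl {ι : Type*} [Fintype ι] {p : Matrix ι ι R} (hp : p * p = p) :
    MatEquiv p p := ⟨p, p, hp, hp⟩

theorem MatEquiv.symm {ι κ : Type*} [Fintype ι] [Fintype κ] {p : Matrix ι ι R} {q : Matrix κ κ R}
    (h : MatEquiv p q) : MatEquiv q p := by
  obtain ⟨x, y, h1, h2⟩ := h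
  exact ⟨y, x, h2, h1⟩

theorem MatEquiv.trans {ι κ μ : Type*} [Fintype ι] [Fintype κ] [Fintype μ] {p : Matrix ι ι R}
    {q : Matrix κ κ R} {r : Matrix μ μ R} (hp : p * p = p) (hr : r * r = r)
    (h : MatEquiv p q) (h' : MatEquiv q r) : MatEquiv p r := by
  obtain ⟨x, y, h1, h2⟩ := h
  obtain ⟨x', y', h3, h4⟩ := h'
  refine ⟨x * x', y' * y, ?_, ?_⟩
  · calc x * x' * (y' * y) = x * (x' * y') * y := by simp only [Matrix.mul_assoc]
      _ = (x * y) * (x * y) := by rw [h3, ← h2]; simp only [Matrix.mul_assoc]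
      _ = p := by rw [h1, hp]
  · calc y' * y * (x * x') = y' * (y * x) * x' := by simp only [Matrix.mul_assoc]
      _ = (y' * x') * (y' * x') := by rw [h2, ← h3]; simp only [Matrix.mul_assoc]
      _ = r := by rw [h4, hr]

theorem MatEquiv.submatrix {ι κ : Type*} [Fintype ι] [Fintype κ] {p : Matrix ι ι R}
    (hp : p * p = p) (e : κ ≃ ι) : MatEquiv p (p.submatrix e e) := by
  refine ⟨p.submatrix id e, p.submatrix e id, ?_, ?_⟩
  · rw [Matrix.submatrix_mul_equiv, hp, Matrix.submatrix_id_id]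
  · rw [← Matrix.submatrix_mul _ _ _ _ _ Function.bijective_id, hp]

theorem MatEquiv.fromBlocks {ι κ ι' κ' : Type*} [Fintype ι] [Fintype κ] [Fintype ι'] [Fintype κ']
    {p : Matrix ι ι R} {q : Matrix κ κ R} {p' : Matrix ι' ι' R} {q' : Matrix κ' κ' R}
    (h : MatEquiv p p') (h' : MatEquiv q q') :
    MatEquiv (Matrix.fromBlocks p 0 0 q) (Matrix.fromBlocks p' 0 0 q') := by
  obtain ⟨x, y, h1, h2⟩ := h
  obtain ⟨x', y', h3, h4⟩ := h'
  exact ⟨Matrix.fromBlocks x 0 0 x', Matrix.fromBlocks y 0 0 y', by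
    simp [Matrix.fromBlocks_multiply, h1, h3], by simp [Matrix.fromBlocks_multiply, h2, h4]⟩

/-- Idempotent square matrices over `R`, of arbitrary finite size. -/
structure IdemMat (R : Type u) [Ring R] where
  size : ℕ
  mat : Matrix (Fin size) (Fin size) R
  idem : mat * mat = mat

instance idemSetoid (R : Type u) [Ring R] : Setoid (IdemMat R) where
  r p q := MatEquiv p.mat q.mat
  iseqv := ⟨fun p => .refl p.idem, fun h => h.symm, fun {p _ r} h h' => h.trans p.idem r.idem h'⟩

theorem fromBlocks_idem {ι κ : Type*} [Fintype ι] [Fintype κ] {p : Matrix ι ι R} {q : Matrix κ κ R}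
    (hp : p * p = p) (hq : q * q = q) :
    Matrix.fromBlocks p 0 0 q * Matrix.fromBlocks p 0 0 q = Matrix.fromBlocks p 0 0 q := by
  simp [Matrix.fromBlocks_multiply, hp, hq]

theorem blockSum_idem {m n : ℕ} {p : Matrix (Fin m) (Fin m) R} {q : Matrix (Fin n) (Fin n) R}
    (hp : p * p = p) (hq : q * q = q) : blockSum p q * blockSum p q = blockSum p q := by
  rw [blockSum, Matrix.reindex_apply, Matrix.submatrix_mul_equiv, fromBlocks_idem hp hq]

/-- The block sum of idempotent matrices. -/
def IdemMat.add (p q : IdemMat R) : IdemMat R :=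
  ⟨p.size + q.size, blockSum p.mat q.mat, blockSum_idem p.idem q.idem⟩

theorem IdemMat.add_equiv (p q : IdemMat R) :
    MatEquiv (Matrix.fromBlocks p.mat 0 0 q.mat) (p.add q).mat :=
  MatEquiv.submatrix (fromBlocks_idem p.idem q.idem) finSumFinEquiv.symm

/-- The empty idempotent matrix. -/
def IdemMat.zero : IdemMat R := ⟨0, 0, by simp⟩

/-- The commutative monoid `V(R)` of equivalence classes of idempotent matrices over `R` (that is,
of isomorphism classes of finitely generated projective `R`-modules) under block sum. -/
def VMon (R : Type u) [Ring R] : Type u := Quotient (idemSetoid R)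

theorem IdemMat.add_congr {p q p' q' : IdemMat R} (h : MatEquiv p.mat p'.mat)
    (h' : MatEquiv q.mat q'.mat) : MatEquiv (p.add q).mat (p'.add q').mat := by
  have h1 := (p.add_equiv q).symm.trans (p.add q).idem (fromBlocks_idem p'.idem q'.idem)
    (h.fromBlocks h')
  exact h1.trans (p.add q).idem (p'.add q').idem (p'.add_equiv q')

theorem IdemMat.add_comm_equiv (p q : IdemMat R) : MatEquiv (p.add q).mat (q.add p).mat := by
  have h0 := fromBlocks_idem p.idem q.idem
  have h1 := MatEquiv.submatrix h0 (Equiv.sumComm (Fin q.size) (Fin p.size))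
  have e : (Matrix.fromBlocks p.mat 0 0 q.mat).submatrix
      (Equiv.sumComm (Fin q.size) (Fin p.size)) (Equiv.sumComm (Fin q.size) (Fin p.size))
      = Matrix.fromBlocks q.mat 0 0 p.mat := by
    ext i j
    rcases i with i | i <;> rcases j with j | j <;> simp
  rw [e] at h1
  exact ((p.add_equiv q).symm.trans (p.add q).idem (fromBlocks_idem q.idem p.idem) h1).trans
    (p.add q).idem (q.add p).idem (q.add_equiv p)

theorem IdemMat.zero_add_equiv (p : IdemMat R) : MatEquiv (zero.add p).mat p.mat := by
  have h0 := MatEquiv.submatrix (fromBlocks_idem (zero (R := R)).idem p.idem)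
    (Equiv.emptySum (Fin 0) (Fin p.size)).symm
  exact (IdemMat.add_equiv zero p).symm.trans (zero.add p).idem p.idem h0

theorem IdemMat.add_assoc_equiv (p q r : IdemMat R) :
    MatEquiv ((p.add q).add r).mat (p.add (q.add r)).mat := by
  have i1 := fromBlocks_idem (fromBlocks_idem p.idem q.idem) r.idem
  have i2 := fromBlocks_idem p.idem (fromBlocks_idem q.idem r.idem)
  have h1 : MatEquiv ((p.add q).add r).mat
      (Matrix.fromBlocks (Matrix.fromBlocks p.mat 0 0 q.mat) 0 0 r.mat) :=
    ((p.add q).add_equiv r).symm.trans ((p.add q).add r).idem i1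
      ((p.add_equiv q).symm.fromBlocks (.refl r.idem))
  have h2 : MatEquiv (Matrix.fromBlocks p.mat 0 0 (Matrix.fromBlocks q.mat 0 0 r.mat))
      (p.add (q.add r)).mat :=
    (MatEquiv.fromBlocks (.refl p.idem) (q.add_equiv r)).trans i2 (p.add (q.add r)).idem
      (p.add_equiv (q.add r))
  have h3 := MatEquiv.submatrix i1 (Equiv.sumAssoc (Fin p.size) (Fin q.size) (Fin r.size)).symm
  have e : (Matrix.fromBlocks (Matrix.fromBlocks p.mat 0 0 q.mat) 0 0 r.mat).submatrix
      (Equiv.sumAssoc (Fin p.size) (Fin q.size) (Fin r.size)).symm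
      (Equiv.sumAssoc (Fin p.size) (Fin q.size) (Fin r.size)).symm
      = Matrix.fromBlocks p.mat 0 0 (Matrix.fromBlocks q.mat 0 0 r.mat) := by
    ext i j
    rcases i with i | i | i <;> rcases j with j | j | j <;> simp
  rw [e] at h3
  exact (h1.trans ((p.add q).add r).idem i2 h3).trans ((p.add q).add r).idem
    (p.add (q.add r)).idem h2

instance : Zero (VMon R) := ⟨Quotient.mk _ IdemMat.zero⟩

instance : Add (VMon R) :=
  ⟨Quotient.map₂ IdemMat.add fun _ _ h _ _ h' => IdemMat.add_congr h h'⟩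

instance : AddCommMonoid (VMon R) where
  add_assoc a b c := by
    induction a using Quotient.ind; induction b using Quotient.ind; induction c using Quotient.ind
    exact Quotient.sound (IdemMat.add_assoc_equiv _ _ _)
  zero_add a := by
    induction a using Quotient.ind
    exact Quotient.sound (IdemMat.zero_add_equiv _)
  add_zero a := by
    induction a using Quotient.ind with
    | _ p =>
      exact Quotient.sound ((IdemMat.add_comm_equiv p .zero).trans (p.add .zero).idem p.idem
        (IdemMat.zero_add_equiv p))
  add_comm a b := by
    induction a using Quotient.ind; induction b using Quotient.ind
    exact Quotient.sound (IdemMat.add_comm_equiv _ _)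
  nsmul := nsmulRec

/-- The image of an idempotent matrix under a ring homomorphism. -/
def IdemMat.map (f : R →+* S) (p : IdemMat R) : IdemMat S :=
  ⟨p.size, f.mapMatrix p.mat, by rw [← map_mul, p.idem]⟩

/-- `V(f) : V(R) → V(S)`. -/
def VMon.map (f : R →+* S) : VMon R →+ VMon S where
  toFun := Quotient.map (IdemMat.map f) fun p q h => by
    obtain ⟨x, y, h1, h2⟩ := h
    refine ⟨x.map f, y.map f, ?_, ?_⟩
    · exact Matrix.map_mul.symm.trans (congrArg (fun w => w.map f) h1)
    · exact Matrix.map_mul.symm.trans (congrArg (fun w => w.map f) h2)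
  map_zero' := congrArg (Quotient.mk _) (by
    simp only [IdemMat.map, IdemMat.zero, IdemMat.mk.injEq, heq_eq_eq, true_and]
    exact Subsingleton.elim _ _)
  map_add' a b := by
    induction a using Quotient.ind
    induction b using Quotient.ind
    rename_i p q
    refine congrArg (Quotient.mk _) ?_
    have e : (blockSum p.mat q.mat).map f = blockSum (p.mat.map f) (q.mat.map f) := by
      simp only [blockSum, Matrix.reindex_apply, ← Matrix.submatrix_map, Matrix.fromBlocks_map]
      simp
    simp only [IdemMat.map, IdemMat.add]
    congr 1

/-- `K₀(R)` of a unital ring: the Grothendieck group of `V(R)`. -/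
abbrev KZeroUnital (R : Type u) [Ring R] : Type u := Algebra.GrothendieckAddGroup (VMon R)

/-- The class in `K₀(R)` of an idempotent matrix. -/
noncomputable def KZeroUnital.cls (p : IdemMat R) : KZeroUnital R :=
  Algebra.GrothendieckAddGroup.of (Quotient.mk _ p : VMon R)

/-- `K₀(f) : K₀(R) → K₀(S)`. -/
noncomputable def KZeroUnital.map (f : R →+* S) : KZeroUnital R →+ KZeroUnital S :=
  Algebra.GrothendieckAddGroup.lift ((Algebra.GrothendieckAddGroup.of).comp (VMon.map f))

theorem KZeroUnital.map_cls (f : R →+* S) (p : IdemMat R) :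
    KZeroUnital.map f (KZeroUnital.cls p) = KZeroUnital.cls (p.map f) := by
  exact DFunLike.congr_fun (Algebra.GrothendieckAddGroup.lift.symm_apply_apply
    ((Algebra.GrothendieckAddGroup.of).comp (VMon.map f))) (Quotient.mk _ p : VMon R)

theorem KZeroUnital.map_comp (g : S →+* T) (f : R →+* S) :
    KZeroUnital.map (g.comp f) = (KZeroUnital.map g).comp (KZeroUnital.map f) := by
  apply Algebra.GrothendieckAddGroup.lift.symm.injective
  ext a
  induction a using Quotient.ind with
  | _ p =>
    change KZeroUnital.map (g.comp f) (KZeroUnital.cls p)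
      = KZeroUnital.map g (KZeroUnital.map f (KZeroUnital.cls p))
    rw [KZeroUnital.map_cls, KZeroUnital.map_cls, KZeroUnital.map_cls]
    rfl

end KZero

variable {k : Type v} [RCLike k]

/-- `K₀(A) = Ker(K₀(A⁺) → K₀(k))`. -/
noncomputable def KZero (A : LCAlg.{u} k) : AddSubgroup (KZeroUnital (Unitization k A)) :=
  (KZeroUnital.map (aug A)).ker

/-- `K₀(φ) : K₀(A) → K₀(B)`. -/
noncomputable def KZeroMap {A : LCAlg.{u₁} k} {B : LCAlg.{u₂} k} (φ : LCHom A B) :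
    KZero A →+ KZero B :=
  ((KZeroUnital.map (plusMap φ)).comp (KZero A).subtype).codRestrict (KZero B) fun x => by
    have hx : KZeroUnital.map (aug A) x.1 = 0 := x.2
    rw [← aug_plusMap φ, KZeroUnital.map_comp] at hx
    exact hx

end

section

variable {k : Type v} [RCLike k]

/-! ### The smooth `K`-functors -/

/-- The smooth `K`-groups: `K₀^{sm}(A) = K₀(A)` (written multiplicatively) and
`K_n^{sm}(A) = π_{n-2} GL(𝓘⁺_*(A))` for `n ≥ 1`. -/
def KSm (A : LCAlg.{u} k) : ℕ → Type (max u v)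
  | 0 => Multiplicative (KZero A)
  | n + 1 => piAug A n

noncomputable instance KSm.group (A : LCAlg.{u} k) : (n : ℕ) → Group (KSm A n)
  | 0 => inferInstanceAs (Group (Multiplicative (KZero A)))
  | n + 1 => inferInstanceAs (Group (piAug A n))

/-- The map `K₀(φ)`, written multiplicatively. -/
noncomputable def KZeroMulMap {A : LCAlg.{u₁} k} {B : LCAlg.{u₂} k} (φ : LCHom A B) :
    Multiplicative (KZero A) →* Multiplicative (KZero B) :=
  AddMonoidHom.toMultiplicative (KZeroMap φ)

/-- The homomorphism `K_n^{sm}(φ) : K_n^{sm}(A) → K_n^{sm}(B)`. -/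
noncomputable def KSm.map {A : LCAlg.{u₁} k} {B : LCAlg.{u₂} k} (φ : LCHom A B) :
    (n : ℕ) → KSm A n →* KSm B n
  | 0 => KZeroMulMap φ
  | n + 1 => piAugMap φ n

/-! ### Short exact sequences, fibrations and connecting homomorphisms -/

/-- `0 → A' → A → A'' → 0` is a short exact sequence of locally convex algebras: `η` is surjective
and `j` is a kernel of `η`, that is, a homeomorphism of `A'` onto `Ker η`. -/
structure IsShortExact {A' : LCAlg.{u₁} k} {A : LCAlg.{u₂} k} {A'' : LCAlg.{u₃} k}
    (j : LCHom A' A) (η : LCHom A A'') : Prop where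
  isEmbedding : IsEmbedding j
  exact : Function.Exact j η
  surjective : Function.Surjective η

/-- `η` is a `GL`-fibration with respect to the smooth path cotriple:
`GL(𝓘_i(A)) → GL(𝓘_i(A''))` is surjective for all `i ≥ 0`, where `𝓘_i = 𝓘^{i+1}`. -/
def IsGLFibration {A : LCAlg.{u₁} k} {A'' : LCAlg.{u₂} k} (η : LCHom A A'') : Prop :=
  ∀ i : ℕ, Function.Surjective (GLmap (pathIterMap η (i + 1)))

/-- `δ` is the connecting homomorphism of the short exact sequence of augmented simplicial groups:
it sends the class of a cycle `x` to the class of `d_0 y`, for any lift `y` of `x` that is killed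
by all the other face operators. -/
def IsMooreConnecting {A' : LCAlg.{u₁} k} {A : LCAlg.{u₂} k} {A'' : LCAlg.{u₃} k}
    (j : LCHom A' A) (η : LCHom A A'') (n : ℕ) (δ : piAug A'' (n + 1) →* piAug A' n) : Prop :=
  ∀ (x : cycles A'' (n + 1)) (y : moore A n) (w : cycles A' n),
    GLmap (pathIterMap η (n + 1)) y.1 = x.1 →
    GLmap (pathIterMap j n) w.1 = GLmap (face A n 0) y.1 →
    δ (QuotientGroup.mk x) = QuotientGroup.mk w

theorem one_block_idem (R : Type u) [Ring R] (m : ℕ) :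
    blockSum (1 : Matrix (Fin m) (Fin m) R) (0 : Matrix (Fin m) (Fin m) R) * blockSum 1 0
      = blockSum 1 0 :=
  blockSum_idem (one_mul 1) (zero_mul 0)

/-- `δ` is the connecting homomorphism `K₁ → K₀` of algebraic `K`-theory: if `g ∈ GL_m(A'')` and
`u ∈ GL_{2m}(A⁺)` lifts `diag(g, g⁻¹)`, it sends the class of `g` to
`[u diag(1, 0) u⁻¹] - [diag(1, 0)] ∈ K₀(A') ⊆ K₀(A'⁺)`. -/
def IsIndexConnecting {A' : LCAlg.{u₁} k} {A : LCAlg.{u₂} k} {A'' : LCAlg.{u₃} k}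
    (j : LCHom A' A) (η : LCHom A A'') (δ : piAug A'' 0 →* Multiplicative (KZero A')) : Prop :=
  ∀ (m : ℕ) (g : (Matrix (Fin m) (Fin m) (Unitization k A''))ˣ)
    (hg : StableGL.of m g ∈ GLalg A'')
    (u : (Matrix (Fin (m + m)) (Fin (m + m)) (Unitization k A))ˣ)
    (q : Matrix (Fin (m + m)) (Fin (m + m)) (Unitization k A')) (hq : q * q = q),
    u.1.map (plusMap η) = blockSum g.1 g⁻¹.1 →
    q.map (plusMap j) = u.1 * blockSum 1 0 * u⁻¹.1 →
    ((δ (QuotientGroup.mk ⟨⟨StableGL.of m g, hg⟩, Subgroup.mem_top _⟩)).toAdd :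
        KZeroUnital (Unitization k A'))
      = KZeroUnital.cls ⟨m + m, q, hq⟩
        - KZeroUnital.cls ⟨m + m, blockSum 1 0, one_block_idem _ m⟩

end

end SmoothK

open SmoothK

/-!
The degrees `n ≥ 1` are the long exact homotopy sequence of the simplicial groups
`GL(𝓘_*(A')) → GL(𝓘_*(A)) → GL(𝓘_*(A''))`, and the lowest part is the exact sequence of algebraic
`K`-theory for the ideal `A'` of `A⁺`; the two are joined by the fact that a boundary in `GL(A'')`,
being the end point of a path, lifts to `GL(A)`.

**Higher degrees.** The path functor `𝓘` preserves kernels with their topology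
(`IsTopKernel.pathMap`), because a smooth path in `A` with values in `Ker η` is smooth as a path in
`A'`, and `GL` is left exact (`exists_GLmap_eq`). The point is that an element of the Moore group of
`GL(𝓘_*(A''))` lifts to the Moore group of `GL(𝓘_*(A))`
(`IsGLFibration.exists_moore_lift`). An arbitrary lift `y` exists by hypothesis. Its faces are then
made trivial one at a time: `y` is replaced by `y (s d y)⁻¹`, with `s` the degeneracy splitting the
face `d`. The degeneracy comes from the comultiplication `f ↦ ((s, t) ↦ f(s t))` of the path
cotriple (`comult`). To see that this is a continuous map `𝓘(A) → 𝓘²(A)`, the mixed partial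
derivatives of `f(s t)` are written down explicitly as combinations of `s^a t^b f^{(c)}(s t)`, and a
partial derivative that is continuous in both variables is shown to be a derivative for the uniform
topology in the other variable (`hasDerivI_curry`). Given Moore lifts, the connecting homomorphism
and exactness are the snake argument.

**The lowest part.** The rings `A'⁺`, `A⁺`, `k` and `A''⁺` form a Milnor square
(`AugmentedSquare`): `A'⁺` consists of the elements of `A⁺` whose image in `A''⁺` is a scalar. An
invertible matrix `g` over `A''⁺` glues a free module over `A⁺` and a free module over `k` to a
projective module over `A'⁺`. The relation `IndexRel` says that an idempotent matrix represents
this module, without any choice of lifts: the module is unique up to isomorphism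
(`IndexRel.matEquiv`), it exists and is represented by `u diag(1, 0) u⁻¹` for every lift `u` of
`diag(g, g⁻¹)` (`IndexRel.of_lift`), and `g γ` glues stably the sum of the modules of `g` and `γ`
(`IndexRel.mul`). Hence the homomorphism `indexHom`. Exactness at the three places amounts to the
following: the glued module is stably free exactly when `g` lifts stably, a module that becomes
free over `A⁺` is glued along some `g` with trivial augmentation, and an idempotent over `A⁺` that
becomes free over `A''⁺` is conjugate, stably, to one defined over `A'⁺`.
-/

namespace SmoothK

/-! ### Smooth reparametrisation and the comultiplication of the path cotriple -/

section Homotopies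

variable {k : Type v} [RCLike k]

section TwoVariables

variable {A : Type u} [AddCommGroup A] [Module k A]

/-- Restriction of a function of two variables to `t = const`. -/
def sliceLeft {X : Type*} [TopologicalSpace X] (G : C(I × I, X)) (t : I) : C(I, X) :=
  G.comp ⟨fun s => (s, t), by fun_prop⟩

/-- Restriction of a function of two variables to `s = const`. -/
def sliceRight {X : Type*} [TopologicalSpace X] (G : C(I × I, X)) (s : I) : C(I, X) :=
  G.comp ⟨fun t => (s, t), by fun_prop⟩

theorem sliceLeft_add [TopologicalSpace A] [ContinuousAdd A] (G H : C(I × I, A)) (t : I) :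
    sliceLeft (G + H) t = sliceLeft G t + sliceLeft H t := rfl

theorem sliceRight_add [TopologicalSpace A] [ContinuousAdd A] (G H : C(I × I, A)) (s : I) :
    sliceRight (G + H) s = sliceRight G s + sliceRight H s := rfl

theorem sliceLeft_smul [TopologicalSpace A] [ContinuousConstSMul k A] (r : k) (G : C(I × I, A))
    (t : I) : sliceLeft (r • G) t = r • sliceLeft G t := rfl

theorem sliceRight_smul [TopologicalSpace A] [ContinuousConstSMul k A] (r : k) (G : C(I × I, A))
    (s : I) : sliceRight (r • G) s = r • sliceRight G s := rfl

/-- A continuous pointwise partial derivative of a function of two variables is also the derivative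
for the uniform topology on the functions of the second variable. -/
theorem hasDerivI_curry [UniformSpace A] [IsUniformAddGroup A] [ContinuousSMul k A]
    [LocallyConvexSpace k A] {G H : C(I × I, A)}
    (h : ∀ t, HasDerivI k (sliceLeft G t) (sliceLeft H t)) :
    HasDerivI k G.curry H.curry := by
  have : PolynormableSpace k A := polynormable_of_locallyConvex
  have hW := PolynormableSpace.withSeminorms k A
  intro s₀
  rw [ContinuousMap.tendsto_iff_tendstoUniformly]
  intro V hV
  rw [uniformity_eq_comap_nhds_zero, mem_comap] at hV
  obtain ⟨U, hU, hUV⟩ := hV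
  obtain ⟨J, ε, hε, hJ⟩ := (hW.mem_nhds_iff _ _).1 hU
  set p := J.sup (fun p : {p : Seminorm k A // Continuous p} => p.1) with hpdef
  have hp : Continuous p := by
    refine Seminorm.continuous_of_le ?_ (Seminorm.finset_sup_le_sum _ _)
    have : (⇑(∑ i ∈ J, (i : {p : Seminorm k A // Continuous p}).1) : A → ℝ)
        = fun x => ∑ i ∈ J, i.1 x := by
      ext x
      rw [← FunLike.coeAddMonoidHom_apply, map_sum, Finset.sum_apply]
      rfl
    rw [this]
    exact continuous_finsetSum _ fun i _ => i.2
  have hH : ∀ᶠ w in 𝓝 s₀, ∀ t, p (H (w, t) - H (s₀, t)) < ε / 2 := by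
    have h1 := (ContinuousMap.tendsto_iff_tendstoUniformly.1 (H.curry.continuous.tendsto s₀))
      {q : A × A | p (q.2 - q.1) < ε / 2} (by
        rw [uniformity_eq_comap_nhds_zero, mem_comap]
        refine ⟨{x | p x < ε / 2}, ?_, fun q hq => hq⟩
        exact (isOpen_lt hp continuous_const).mem_nhds (by simpa using half_pos hε))
    exact h1
  obtain ⟨δ, hδ, hball⟩ := Metric.eventually_nhds_iff.1 hH
  have hs : ∀ᶠ s in 𝓝[≠] s₀, dist s s₀ < δ := nhdsWithin_le_nhds (Metric.ball_mem_nhds s₀ hδ)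
  filter_upwards [hs, self_mem_nhdsWithin] with s hsδ hst t
  have hpos : 0 < |(s : ℝ) - s₀| := abs_pos.2 (sub_ne_zero.2 fun h => hst (Subtype.ext h))
  have hne : (((s : ℝ) - (s₀ : ℝ) : ℝ) : k) ≠ 0 := by
    rw [RCLike.ofReal_ne_zero]; exact abs_pos.1 hpos
  have h1 := (h t).seminorm_le' p hp (ε / 2) (H (s₀, t)) s s₀ (fun w hw => by
    refine (hball ?_ t).le
    refine lt_of_le_of_lt ?_ hsδ
    rw [Subtype.dist_eq, Subtype.dist_eq, Real.dist_eq, Real.dist_eq]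
    rcases le_total s s₀ with h | h
    · rw [Set.uIcc_of_le h] at hw
      have e1 : (s : ℝ) ≤ w := hw.1
      have e2 : (w : ℝ) ≤ s₀ := hw.2
      rw [abs_of_nonpos (by linarith), abs_of_nonpos (by linarith)]; linarith
    · rw [Set.uIcc_of_ge h] at hw
      have e1 : (s₀ : ℝ) ≤ w := hw.1
      have e2 : (w : ℝ) ≤ s := hw.2
      rw [abs_of_nonneg (by linarith), abs_of_nonneg (by linarith)]; linarith)
  refine hUV (hJ ?_)
  change (((s : ℝ) - (s₀ : ℝ) : ℝ) : k)⁻¹ • (G (s, t) - G (s₀, t)) - H (s₀, t) ∈ p.ball 0 ε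
  have e : (((s : ℝ) - (s₀ : ℝ) : ℝ) : k)⁻¹ • (G (s, t) - G (s₀, t)) - H (s₀, t)
      = (((s : ℝ) - (s₀ : ℝ) : ℝ) : k)⁻¹ •
        (G (s, t) - G (s₀, t) - (((s : ℝ) - (s₀ : ℝ) : ℝ) : k) • H (s₀, t)) := by
    rw [smul_sub _ (G (s, t) - G (s₀, t)), smul_smul, inv_mul_cancel₀ hne, one_smul]
  rw [Seminorm.mem_ball, sub_zero, e, map_smul_eq_mul, norm_inv, RCLike.norm_ofReal]
  calc |(s : ℝ) - s₀|⁻¹ * p (G (s, t) - G (s₀, t) - (((s : ℝ) - (s₀ : ℝ) : ℝ) : k) • H (s₀, t))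
      ≤ |(s : ℝ) - s₀|⁻¹ * (ε / 2 * |(s : ℝ) - s₀|) := by gcongr; exact h1
    _ = ε / 2 := by field_simp
    _ < ε := half_lt_self hε

section Monomials

variable [TopologicalSpace A] [ContinuousSMul k A]

/-- Chain rule for the substitution `s ↦ s c`. -/
theorem HasDerivI.comp_mul {f f' : C(I, A)} (h : HasDerivI k f f') (c : I) (F F' : C(I, A))
    (hF : ∀ s, F s = f (s * c)) (hF' : ∀ s, F' s = ((c : ℝ) : k) • f' (s * c)) :
    HasDerivI k F F' := by
  intro s₀
  rw [hF']
  rcases eq_or_ne c 0 with rfl | hc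
  · simpa [hF] using tendsto_const_nhds
  have hc0 : ((c : ℝ) : k) ≠ 0 := by
    rw [RCLike.ofReal_ne_zero]; exact fun h => hc (Subtype.ext h)
  have hlim : Tendsto (fun s : I => s * c) (𝓝[≠] s₀) (𝓝[≠] (s₀ * c)) := by
    rw [tendsto_nhdsWithin_iff]
    refine ⟨(Continuous.tendsto (by fun_prop) s₀).mono_left nhdsWithin_le_nhds, ?_⟩
    filter_upwards [self_mem_nhdsWithin] with s hs heq
    apply hs
    have h1 : (s : ℝ) * c = s₀ * c := congrArg Subtype.val heq
    exact Subtype.ext (mul_right_cancel₀ (fun h => hc (Subtype.ext h)) h1)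
  refine (((h (s₀ * c)).comp hlim).const_smul ((c : ℝ) : k)).congr fun s => ?_
  simp only [Function.comp_apply, hF, Set.Icc.coe_mul, smul_smul]
  congr 1
  rw [← sub_mul, RCLike.ofReal_mul, mul_inv, mul_comm _ ((c : ℝ) : k)⁻¹, ← mul_assoc,
    mul_inv_cancel₀ hc0, one_mul]

variable [IsTopologicalAddGroup A]

/-- Product rule for the multiplication by the variable. -/
theorem HasDerivI.var_smul {f f' : C(I, A)} (h : HasDerivI k f f') (F F' : C(I, A))
    (hF : ∀ s, F s = ((s : ℝ) : k) • f s) (hF' : ∀ s, F' s = f s + ((s : ℝ) : k) • f' s) :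
    HasDerivI k F F' := by
  intro s₀
  rw [hF']
  have h1 : Tendsto f (𝓝[≠] s₀) (𝓝 (f s₀)) :=
    (f.continuous.tendsto s₀).mono_left nhdsWithin_le_nhds
  refine (h1.add ((h s₀).const_smul ((s₀ : ℝ) : k))).congr' ?_
  filter_upwards [self_mem_nhdsWithin] with s hs
  have hne : (((s : ℝ) - (s₀ : ℝ) : ℝ) : k) ≠ 0 := by
    rw [RCLike.ofReal_ne_zero, sub_ne_zero]; exact fun h => hs (Subtype.ext h)
  have e : F s - F s₀ = (((s : ℝ) - (s₀ : ℝ) : ℝ) : k) • f s + ((s₀ : ℝ) : k) • (f s - f s₀) := by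
    rw [hF, hF, RCLike.ofReal_sub, sub_smul, smul_sub]; abel
  rw [e, smul_add, smul_smul _ _ (f s), inv_mul_cancel₀ hne, one_smul, smul_comm]

theorem HasDerivI.pow_smul {f f' : C(I, A)} (h : HasDerivI k f f') (a : ℕ) (F F' : C(I, A))
    (hF : ∀ s, F s = ((s : ℝ) : k) ^ a • f s)
    (hF' : ∀ s, F' s = (a : k) • ((s : ℝ) : k) ^ (a - 1) • f s + ((s : ℝ) : k) ^ a • f' s) :
    HasDerivI k F F' := by
  induction a generalizing F F' with
  | zero =>
    have e : F = f := ContinuousMap.ext fun s => by simp [hF]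
    have e' : F' = f' := ContinuousMap.ext fun s => by simp [hF']
    rwa [e, e']
  | succ a ih =>
    have h1 := ih ⟨fun s => ((s : ℝ) : k) ^ a • f s, by fun_prop⟩
      ⟨fun s => (a : k) • ((s : ℝ) : k) ^ (a - 1) • f s + ((s : ℝ) : k) ^ a • f' s, by fun_prop⟩
      (fun _ => rfl) fun _ => rfl
    refine h1.var_smul F F' (fun s => ?_) fun s => ?_
    · rw [hF, pow_succ', mul_smul]; rfl
    · rw [hF']
      change _ = ((s : ℝ) : k) ^ a • f s + ((s : ℝ) : k) •
        ((a : k) • ((s : ℝ) : k) ^ (a - 1) • f s + ((s : ℝ) : k) ^ a • f' s)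
      cases a with
      | zero => simp
      | succ a =>
        simp only [Nat.add_sub_cancel, smul_add, smul_smul, ← add_assoc, ← add_smul]
        congr 2
        · push_cast; ring
        · ring

variable (k) in
/-- The function `(s, t) ↦ s^a t^b f^{(c)}(s t)` attached to a smooth curve `f`. -/
def scaledMonomial (a b c : ℕ) : smoothJets k A →ₗ[k] C(I × I, A) where
  toFun F := ⟨fun q => (((q.1 : ℝ) : k) ^ a * ((q.2 : ℝ) : k) ^ b) • F.1 c (q.1 * q.2), by fun_prop⟩
  map_add' F G := ContinuousMap.ext fun q => smul_add _ _ _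
  map_smul' r F := ContinuousMap.ext fun q => smul_comm _ _ _

theorem scaledMonomial_apply (a b c : ℕ) (F : smoothJets k A) (q : I × I) :
    scaledMonomial k a b c F q
      = (((q.1 : ℝ) : k) ^ a * ((q.2 : ℝ) : k) ^ b) • F.1 c (q.1 * q.2) := rfl

theorem continuous_scaledMonomial (a b c : ℕ) :
    Continuous (scaledMonomial k (A := A) a b c) := by
  refine ContinuousMap.continuous_of_continuous_uncurry _ ?_
  have h1 : Continuous fun F : smoothJets k A => F.1 c :=
    (continuous_apply c).comp continuous_subtype_val
  have h2 : Continuous fun x : smoothJets k A × (I × I) => x.1.1 c (x.2.1 * x.2.2) :=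
    (h1.comp continuous_fst).eval (by fun_prop)
  exact Continuous.smul (by fun_prop) h2

/-- Formal linear combinations of the functions `s^a t^b f^{(c)}(s t)`, indexed by `(a, b, c)`. All
partial derivatives of `f(s t)` are of this form, and at the formal level the two partial derivatives
commute by a computation with coefficients. -/
abbrev ScaledSymbol (k : Type v) [RCLike k] : Type v := (ℕ × ℕ × ℕ) →₀ k

/-- The function of two variables represented by a formal combination. -/
noncomputable def ScaledSymbol.eval (F : smoothJets k A) :
    ScaledSymbol k →ₗ[k] C(I × I, A) :=
  Finsupp.linearCombination k fun x => scaledMonomial k x.1 x.2.1 x.2.2 F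

variable (k) in
/-- The formal partial derivative in the first variable. -/
noncomputable def ScaledSymbol.derivLeft : ScaledSymbol k →ₗ[k] ScaledSymbol k :=
  Finsupp.linearCombination k fun x =>
    Finsupp.single (x.1 - 1, x.2.1, x.2.2) (x.1 : k)
      + Finsupp.single (x.1, x.2.1 + 1, x.2.2 + 1) 1

variable (k) in
/-- The formal partial derivative in the second variable. -/
noncomputable def ScaledSymbol.derivRight : ScaledSymbol k →ₗ[k] ScaledSymbol k :=
  Finsupp.linearCombination k fun x =>
    Finsupp.single (x.1, x.2.1 - 1, x.2.2) (x.2.1 : k)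
      + Finsupp.single (x.1 + 1, x.2.1, x.2.2 + 1) 1

theorem ScaledSymbol.eval_single (F : smoothJets k A) (a b c : ℕ) (r : k) :
    ScaledSymbol.eval F (Finsupp.single (a, b, c) r) = r • scaledMonomial k a b c F := by
  simp [ScaledSymbol.eval]

theorem ScaledSymbol.derivLeft_single (a b c : ℕ) (r : k) :
    derivLeft k (Finsupp.single (a, b, c) r)
      = Finsupp.single (a - 1, b, c) (r * a) + Finsupp.single (a, b + 1, c + 1) r := by
  simp [derivLeft]

theorem ScaledSymbol.derivRight_single (a b c : ℕ) (r : k) :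
    derivRight k (Finsupp.single (a, b, c) r)
      = Finsupp.single (a, b - 1, c) (r * b) + Finsupp.single (a + 1, b, c + 1) r := by
  simp [derivRight]

theorem ScaledSymbol.derivRight_derivLeft (e : ScaledSymbol k) :
    derivRight k (derivLeft k e) = derivLeft k (derivRight k e) := by
  induction e using Finsupp.induction_linear with
  | zero => simp
  | add e e' h h' => simp only [map_add, h, h']
  | single x r =>
    obtain ⟨a, b, c⟩ := x
    simp only [derivLeft_single, derivRight_single, map_add]
    rw [mul_right_comm r (a : k) (b : k)]
    cases a <;> cases b <;>
      simp only [Nat.add_sub_cancel, Nat.cast_succ, Nat.cast_zero, mul_zero, mul_add, mul_one,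
        Finsupp.single_add, Finsupp.single_zero, Nat.zero_sub, zero_add, add_zero] <;> abel

theorem hasDerivI_scaledMonomial_left (F : smoothJets k A) (a b c : ℕ) (t : I) :
    HasDerivI k (sliceLeft (scaledMonomial k a b c F) t)
      ((a : k) • sliceLeft (scaledMonomial k (a - 1) b c F) t
        + sliceLeft (scaledMonomial k a (b + 1) (c + 1) F) t) := by
  let f : C(I, A) := ⟨fun s => F.1 c (s * t), by fun_prop⟩
  let f' : C(I, A) := ⟨fun s => ((t : ℝ) : k) • F.1 (c + 1) (s * t), by fun_prop⟩
  have h : HasDerivI k f f' := (F.2 c).comp_mul t f f' (fun _ => rfl) fun _ => rfl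
  refine (h.smul (((t : ℝ) : k) ^ b)).pow_smul a _ _ (fun s => ?_) fun s => ?_
  · change (((s : ℝ) : k) ^ a * ((t : ℝ) : k) ^ b) • F.1 c (s * t)
      = ((s : ℝ) : k) ^ a • ((t : ℝ) : k) ^ b • F.1 c (s * t)
    rw [mul_smul]
  · change (a : k) • (((s : ℝ) : k) ^ (a - 1) * ((t : ℝ) : k) ^ b) • F.1 c (s * t)
        + (((s : ℝ) : k) ^ a * ((t : ℝ) : k) ^ (b + 1)) • F.1 (c + 1) (s * t)
      = (a : k) • ((s : ℝ) : k) ^ (a - 1) • ((t : ℝ) : k) ^ b • F.1 c (s * t)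
        + ((s : ℝ) : k) ^ a • ((t : ℝ) : k) ^ b • ((t : ℝ) : k) • F.1 (c + 1) (s * t)
    rw [mul_smul, mul_smul, pow_succ, mul_smul]

theorem hasDerivI_scaledMonomial_right (F : smoothJets k A) (a b c : ℕ) (s : I) :
    HasDerivI k (sliceRight (scaledMonomial k a b c F) s)
      ((b : k) • sliceRight (scaledMonomial k a (b - 1) c F) s
        + sliceRight (scaledMonomial k (a + 1) b (c + 1) F) s) := by
  let f : C(I, A) := ⟨fun t => F.1 c (s * t), by fun_prop⟩
  let f' : C(I, A) := ⟨fun t => ((s : ℝ) : k) • F.1 (c + 1) (s * t), by fun_prop⟩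
  have h : HasDerivI k f f' := (F.2 c).comp_mul s f f'
    (fun t => congrArg (F.1 c) (mul_comm s t))
    fun t => congrArg (fun x => ((s : ℝ) : k) • F.1 (c + 1) x) (mul_comm s t)
  refine (h.smul (((s : ℝ) : k) ^ a)).pow_smul b _ _ (fun t => ?_) fun t => ?_
  · change (((s : ℝ) : k) ^ a * ((t : ℝ) : k) ^ b) • F.1 c (s * t)
      = ((t : ℝ) : k) ^ b • ((s : ℝ) : k) ^ a • F.1 c (s * t)
    rw [mul_comm, mul_smul]
  · change (b : k) • (((s : ℝ) : k) ^ a * ((t : ℝ) : k) ^ (b - 1)) • F.1 c (s * t)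
        + (((s : ℝ) : k) ^ (a + 1) * ((t : ℝ) : k) ^ b) • F.1 (c + 1) (s * t)
      = (b : k) • ((t : ℝ) : k) ^ (b - 1) • ((s : ℝ) : k) ^ a • F.1 c (s * t)
        + ((t : ℝ) : k) ^ b • ((s : ℝ) : k) ^ a • ((s : ℝ) : k) • F.1 (c + 1) (s * t)
    rw [mul_comm, mul_smul, mul_comm (((s : ℝ) : k) ^ (a + 1)), mul_smul, pow_succ, mul_smul]

theorem ScaledSymbol.hasDerivI_left (F : smoothJets k A) (e : ScaledSymbol k) (t : I) :
    HasDerivI k (sliceLeft (eval F e) t) (sliceLeft (eval F (derivLeft k e)) t) := by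
  induction e using Finsupp.induction_linear with
  | zero =>
    rw [map_zero, map_zero, map_zero]
    exact HasDerivI.const 0
  | add e e' h h' =>
    rw [map_add, map_add, map_add, sliceLeft_add, sliceLeft_add]
    exact h.add h'
  | single x r =>
    obtain ⟨a, b, c⟩ := x
    have h := (hasDerivI_scaledMonomial_left F a b c t).smul r
    rw [smul_add, smul_smul] at h
    rw [derivLeft_single, map_add, eval_single, eval_single, eval_single, sliceLeft_add,
      sliceLeft_smul, sliceLeft_smul, sliceLeft_smul]
    exact h

theorem ScaledSymbol.hasDerivI_right (F : smoothJets k A) (e : ScaledSymbol k) (s : I) :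
    HasDerivI k (sliceRight (eval F e) s) (sliceRight (eval F (derivRight k e)) s) := by
  induction e using Finsupp.induction_linear with
  | zero =>
    rw [map_zero, map_zero, map_zero]
    exact HasDerivI.const 0
  | add e e' h h' =>
    rw [map_add, map_add, map_add, sliceRight_add, sliceRight_add]
    exact h.add h'
  | single x r =>
    obtain ⟨a, b, c⟩ := x
    have h := (hasDerivI_scaledMonomial_right F a b c s).smul r
    rw [smul_add, smul_smul] at h
    rw [derivRight_single, map_add, eval_single, eval_single, eval_single, sliceRight_add,
      sliceRight_smul, sliceRight_smul, sliceRight_smul]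
    exact h

theorem ScaledSymbol.continuous_eval (e : ScaledSymbol k) :
    Continuous fun F : smoothJets k A => eval F e := by
  induction e using Finsupp.induction_linear with
  | zero =>
    have h : (fun F : smoothJets k A => eval F (0 : ScaledSymbol k)) = fun _ => 0 :=
      funext fun F => map_zero _
    rw [h]
    exact continuous_const
  | add e e' h h' =>
    have h1 : (fun F : smoothJets k A => eval F (e + e')) = fun F => eval F e + eval F e' :=
      funext fun F => map_add _ _ _
    rw [h1]
    exact h.add h'
  | single x r =>
    have h : (fun F : smoothJets k A => eval F (Finsupp.single x r))
        = fun F => r • scaledMonomial k x.1 x.2.1 x.2.2 F := funext fun F => eval_single F _ _ _ r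
    rw [h]
    exact (continuous_scaledMonomial _ _ _).const_smul r

variable (k) in
/-- The symbol of the mixed partial derivative `∂_s^m ∂_t^n` of `(s, t) ↦ f(s t)`. -/
noncomputable def scaledSymbol (m n : ℕ) : ScaledSymbol k :=
  (ScaledSymbol.derivLeft k ^ m) ((ScaledSymbol.derivRight k ^ n) (Finsupp.single (0, 0, 0) 1))

theorem scaledSymbol_succ_left (m n : ℕ) :
    scaledSymbol k (m + 1) n = ScaledSymbol.derivLeft k (scaledSymbol k m n) := by
  rw [scaledSymbol, pow_succ', Module.End.mul_apply, scaledSymbol]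

theorem scaledSymbol_succ_right (m n : ℕ) :
    scaledSymbol k m (n + 1) = ScaledSymbol.derivRight k (scaledSymbol k m n) := by
  have hc : Commute (ScaledSymbol.derivRight k) (ScaledSymbol.derivLeft k ^ m) :=
    Commute.pow_right (LinearMap.ext ScaledSymbol.derivRight_derivLeft) m
  rw [scaledSymbol, pow_succ', Module.End.mul_apply, scaledSymbol]
  exact (LinearMap.congr_fun hc _).symm

theorem scaledSymbol_zero_right (m : ℕ) :
    scaledSymbol k m 0 = Finsupp.single (0, m, m) 1 := by
  induction m with
  | zero => simp [scaledSymbol]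
  | succ m ih => rw [scaledSymbol_succ_left, ih, ScaledSymbol.derivLeft_single]; simp

variable (k) in
/-- The mixed partial derivative `∂_s^m ∂_t^n` of `(s, t) ↦ f(s t)`. -/
noncomputable def scaledDeriv (F : smoothJets k A) (m n : ℕ) : C(I × I, A) :=
  ScaledSymbol.eval F (scaledSymbol k m n)

theorem scaledDeriv_zero_right (F : smoothJets k A) (m : ℕ) (s t : I) :
    scaledDeriv k F m 0 (s, t) = ((t : ℝ) : k) ^ m • F.1 m (s * t) := by
  simp [scaledDeriv, scaledSymbol_zero_right, ScaledSymbol.eval_single, scaledMonomial_apply]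

/-- The jet of the curve `t ↦ ∂_s^m f(s t)`. -/
noncomputable def scaledJet (F : smoothJets k A) (m : ℕ) (s : I) : smoothJets k A :=
  ⟨fun n => sliceRight (scaledDeriv k F m n) s, fun n => by
    have h := ScaledSymbol.hasDerivI_right F (scaledSymbol k m n) s
    rwa [← scaledSymbol_succ_right] at h⟩

end Monomials

end TwoVariables

variable (A : LCAlg.{u} k)

theorem path_ext {A : LCAlg.{u} k} {F G : path A}
    (h : ∀ t, eval A t (pathIncl A F) = eval A t (pathIncl A G)) : F = G :=
  pathIncl_injective A (smoothJets_ext (A := A) h)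

theorem eval_zero_pathIncl (F : path A) : eval A 0 (pathIncl A F) = 0 := F.2

/-- A path together with its derivatives. -/
def pathJets {A : LCAlg.{u} k} (F : path A) : smoothJets k A := pathIncl A F

/-- The curve `t ↦ ∂_s^m f(s t)` in `𝓘(A)`, for a path `f`. -/
noncomputable def scaledPath (F : path A) (m : ℕ) (s : I) : path A :=
  (⟨scaledJet (pathJets F) m s, by
    change scaledDeriv k (pathJets F) m 0 (s, 0) = 0
    rw [scaledDeriv_zero_right]
    cases m with
    | zero => simpa using! eval_zero_pathIncl A F
    | succ m => simp⟩ : pathSub A)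

theorem isInducing_pathJets :
    IsInducing fun (F : path A) => (pathJets F).1 :=
  (IsInducing.subtypeVal (t := {F : ℕ → C(I, A) | F ∈ smoothJets k A})).comp
    (IsInducing.subtypeVal (t := {F : smoothCurves A | F ∈ pathSub A}))

/-- `scaledPath` as a continuous function of the scaling factor. -/
noncomputable def scaledPathCurve (F : path A) (m : ℕ) : C(I, path A) :=
  ⟨scaledPath A F m, (isInducing_pathJets A).continuous_iff.2 <| continuous_pi fun n =>
    (scaledDeriv k (pathJets F) m n).curry.continuous⟩

theorem hasDerivI_scaledPathCurve (F : path A) (m : ℕ) :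
    HasDerivI k (scaledPathCurve A F m) (scaledPathCurve A F (m + 1)) := by
  intro s₀
  rw [(isInducing_pathJets A).tendsto_nhds_iff, tendsto_pi_nhds]
  intro n
  have h : HasDerivI k (scaledDeriv k (pathJets F) m n).curry
      (scaledDeriv k (pathJets F) (m + 1) n).curry := by
    refine hasDerivI_curry fun t => ?_
    unfold scaledDeriv
    rw [scaledSymbol_succ_left]
    exact ScaledSymbol.hasDerivI_left _ _ t
  exact h s₀

/-- The square `(s, t) ↦ f(s t)` attached to a path `f`, as an element of `𝓘²(A)`. -/
noncomputable def comultFun (F : path A) : path (path A) :=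
  (⟨(⟨scaledPathCurve A F, hasDerivI_scaledPathCurve A F⟩ : smoothJets k (path A)), by
    refine path_ext fun t => ?_
    change scaledDeriv k (pathJets F) 0 0 (0, t) = 0
    rw [scaledDeriv_zero_right]
    simpa using! eval_zero_pathIncl A F⟩ : pathSub (path A))

theorem eval_comultFun (F : path A) (s t : I) :
    eval A t (pathIncl A (eval (path A) s (pathIncl (path A) (comultFun A F))))
      = eval A (s * t) (pathIncl A F) := by
  change scaledDeriv k (pathJets F) 0 0 (s, t) = _
  rw [scaledDeriv_zero_right, pow_zero, one_smul]
  rfl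

theorem path_path_ext {A : LCAlg.{u} k} {F G : path (path A)}
    (h : ∀ s t, eval A t (pathIncl A (eval (path A) s (pathIncl (path A) F)))
      = eval A t (pathIncl A (eval (path A) s (pathIncl (path A) G)))) : F = G :=
  path_ext fun s => path_ext (h s)

theorem continuous_comultFun : Continuous (comultFun A) := by
  rw [(isInducing_pathJets (path A)).continuous_iff]
  refine continuous_pi fun m => ?_
  have h1 := ContinuousMap.isInducing_postcomp (X := I)
    (⟨fun F => (pathJets F).1, (isInducing_pathJets A).continuous⟩ : C(path A, ℕ → C(I, A)))
    (isInducing_pathJets A)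
  rw [h1.continuous_iff]
  refine ContinuousMap.continuous_of_continuous_uncurry _ (continuous_pi fun n => ?_)
  have h2 : Continuous fun F : path A =>
      (scaledDeriv k (pathJets F) m n).curry :=
    ContinuousMap.continuous_curry.comp
      ((ScaledSymbol.continuous_eval (A := A) _).comp (pathIncl A).continuous)
  exact (h2.comp continuous_fst).eval continuous_snd

/-- The comultiplication `𝓘(A) → 𝓘²(A)` of the smooth path cotriple, `f ↦ ((s, t) ↦ f(s t))`. -/
noncomputable def comult : LCHom (path A) (path (path A)) where
  toFun := comultFun A
  map_smul' c F := path_path_ext fun s t => by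
    simp only [map_smul, eval_comultFun, MonoidHom.id_apply]
  map_zero' := path_path_ext fun s t => by simp only [map_zero, eval_comultFun]
  map_add' F G := path_path_ext fun s t => by simp only [map_add, eval_comultFun]
  map_mul' F G := path_path_ext fun s t => by simp only [map_mul, eval_comultFun]
  cont := continuous_comultFun A

/-- The degeneracy splits the face `𝓘(τ)`, because `f(s · 1) = f(s)`. -/
theorem pathMap_tau_comult (F : path A) : pathMap (tau A) (comult A F) = F :=
  path_ext fun s => (eval_comultFun A F s 1).trans (by rw [mul_one])

theorem comult_naturality {A : LCAlg.{u₁} k} {B : LCAlg.{u₂} k} (φ : LCHom A B) :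
    (comult B).comp (pathMap φ) = (pathMap (pathMap φ)).comp (comult A) := by
  refine LCHom.ext fun F => path_path_ext fun s t => ?_
  refine (eval_comultFun B (pathMap φ F) s t).trans ?_
  exact (congrArg φ (eval_comultFun A F s t)).symm

end Homotopies

/-! ### Left exactness of the path functor and lifting in Moore groups -/

section PathExactness

variable {k : Type v} [RCLike k]

/-- `j` is a kernel of `η`: a homeomorphism onto `Ker η`. -/
structure IsTopKernel {A' : LCAlg.{u₁} k} {A : LCAlg.{u₂} k} {A'' : LCAlg.{u₃} k}
    (j : LCHom A' A) (η : LCHom A A'') : Prop where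
  isEmbedding : IsEmbedding j
  exact : Function.Exact j η

theorem pathJets_injective {A : LCAlg.{u} k} :
    Function.Injective fun F : path A => (pathJets F).1 :=
  fun _ _ h => Subtype.ext (Subtype.ext h)

theorem isEmbedding_pathMap {A : LCAlg.{u₁} k} {B : LCAlg.{u₂} k} {φ : LCHom A B}
    (h : IsEmbedding φ) : IsEmbedding (pathMap φ) := by
  have h1 : IsEmbedding fun F : ℕ → C(I, A) => fun n => (⟨φ, φ.continuous⟩ : C(A, B)).comp (F n) :=
    IsEmbedding.piMap fun _ => ContinuousMap.isEmbedding_postcomp _ h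
  have hA : IsEmbedding fun F : path A => (pathJets F).1 :=
    ⟨isInducing_pathJets A, pathJets_injective⟩
  exact IsEmbedding.of_comp (pathMap φ).continuous (isInducing_pathJets B).continuous
    (h1.comp hA)

theorem HasDerivI.of_isInducing {A : LCAlg.{u₁} k} {B : LCAlg.{u₂} k} {φ : LCHom A B}
    (h : IsInducing φ) {f f' : C(I, A)} {g g' : C(I, B)} (hg : HasDerivI k g g')
    (hf : ∀ t, φ (f t) = g t) (hf' : ∀ t, φ (f' t) = g' t) : HasDerivI k f f' := by
  intro t
  rw [h.tendsto_nhds_iff, hf']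
  refine (hg t).congr fun s => ?_
  simp only [Function.comp_apply, map_smul, map_sub, hf]

/-- A path in `A` annihilated by `η` is a path in the kernel of `η`, smooth for the topology of the
kernel. -/
theorem IsTopKernel.pathMap {A' : LCAlg.{u₁} k} {A : LCAlg.{u₂} k} {A'' : LCAlg.{u₃} k}
    {j : LCHom A' A} {η : LCHom A A''} (h : IsTopKernel j η) :
    IsTopKernel (pathMap j) (pathMap η) := by
  refine ⟨isEmbedding_pathMap h.isEmbedding, fun F => ⟨fun hF => ?_, ?_⟩⟩
  · have h0 : ∀ n t, η ((pathJets F).1 n t) = 0 := fun n t =>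
      congrArg (fun G : path A'' => (pathJets G).1 n t) hF
    choose f hf using fun n t => (h.exact _).1 (h0 n t)
    let f' : ℕ → C(I, A') := fun n => ⟨f n, h.isEmbedding.continuous_iff.2 <| by
      have e : j ∘ f n = (pathJets F).1 n := funext (hf n)
      rw [e]
      exact ((pathJets F).1 n).continuous⟩
    let G : smoothJets k A' := ⟨f', fun n =>
      ((pathJets F).2 n).of_isInducing h.isEmbedding.isInducing (hf n) (hf (n + 1))⟩
    have hG : G.1 0 0 = 0 := by
      apply h.isEmbedding.injective
      refine Eq.trans ?_ (map_zero j.toNonUnitalAlgHom).symm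
      exact (hf 0 0).trans (eval_zero_pathIncl A F)
    exact ⟨(⟨G, hG⟩ : pathSub A'), path_ext fun t => hf 0 t⟩
  · rintro ⟨G, rfl⟩
    exact path_ext fun t => h.exact.apply_apply_eq_zero _

theorem IsTopKernel.pathIterMap {A' : LCAlg.{u₁} k} {A : LCAlg.{u₂} k} {A'' : LCAlg.{u₃} k}
    {j : LCHom A' A} {η : LCHom A A''} (h : IsTopKernel j η) (n : ℕ) :
    IsTopKernel (pathIterMap j n) (pathIterMap η n) := by
  induction n with
  | zero => exact h
  | succ n ih => exact ih.pathMap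

theorem GLmap_of_forall_eq {A : LCAlg.{u} k} {φ : LCHom A A} (h : ∀ a, φ a = a) (x : GLalg A) :
    GLmap φ x = x := by
  have e : plusMap φ = RingHom.id _ :=
    RingHom.ext fun z => Unitization.ext (plusMap_fst _ z) ((plusMap_snd _ z).trans (h _))
  refine Subtype.ext ?_
  change StableGL.map (plusMap φ) x.1 = x.1
  rw [e, StableGL.map_id]

theorem exists_plusMap_eq {A' : LCAlg.{u₁} k} {A : LCAlg.{u₂} k} {A'' : LCAlg.{u₃} k}
    {j : LCHom A' A} {η : LCHom A A''} (h : Function.Exact j η) (r : Unitization k A)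
    (hr : (plusMap η r).snd = 0) :
    ∃ r', plusMap j r' = r := by
  rw [plusMap_snd] at hr
  obtain ⟨a, ha⟩ := (h _).1 hr
  refine ⟨Unitization.inl r.fst + (a : Unitization k A'), Unitization.ext ?_ ?_⟩
  · rw [plusMap_fst]; simp
  · rw [plusMap_snd]; simpa using ha

/-- The functor `GL` is left exact. -/
theorem exists_GLmap_eq {A' : LCAlg.{u₁} k} {A : LCAlg.{u₂} k} {A'' : LCAlg.{u₃} k}
    {j : LCHom A' A} {η : LCHom A A''} (hj : Function.Injective j) (h : Function.Exact j η)
    {y : GLalg A} (hy : GLmap η y = 1) : ∃ z, GLmap j z = y := by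
  obtain ⟨m, w, hw⟩ := StableGL.exists_of y.1
  have hw1 : mapGL (plusMap η) m w = 1 := by
    apply StableGL.of_injective m
    rw [← StableGL.map_of, ← hw, map_one]
    exact congrArg Subtype.val hy
  have key : ∀ w : (Matrix (Fin m) (Fin m) (Unitization k A))ˣ,
      mapGL (plusMap η) m w = 1 → ∀ i j', ∃ r, plusMap j r = w.1 i j' := by
    intro w hw i j'
    have h0 : (mapGL (plusMap η) m w).1 = 1 := congrArg Units.val hw
    have h1 : plusMap η (w.1 i j') = (1 : Matrix (Fin m) (Fin m) (Unitization k A'')) i j' :=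
      congrFun (congrFun h0 i) j'
    refine exists_plusMap_eq h _ ?_
    rw [h1, Matrix.one_apply]
    split_ifs <;> simp
  obtain ⟨x, hx⟩ := mapGL_exists (plusMap_injective hj) w (key w hw1)
    (key w⁻¹ (by rw [map_inv, hw1, inv_one]))
  have hmem : StableGL.of m x ∈ GLalg A' := by
    change StableGL.map (aug A') (StableGL.of m x) = 1
    rw [← aug_plusMap j, StableGL.map_comp, StableGL.map_of _ m x, hx, ← hw]
    exact y.2
  refine ⟨⟨_, hmem⟩, Subtype.ext ?_⟩
  rw [hw, ← hx]
  rfl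

end PathExactness

section MooreLifting

variable {k : Type v} [RCLike k]

/-- The iterate `𝓘^m(A)`, with the recursion on the inner variable: `𝓘^{m+1}(A) = 𝓘^m(𝓘(A))`
holds by definition. -/
def pathPow : ℕ → LCAlg.{u} k → LCAlg.{u} k
  | 0, A => A
  | m + 1, A => pathPow m (path A)

/-- The morphism `𝓘^m(φ)`, for the iterates `pathPow`. -/
def pathPowMap : (m : ℕ) → {A : LCAlg.{u₁} k} → {B : LCAlg.{u₂} k} → LCHom A B →
    LCHom (pathPow m A) (pathPow m B)
  | 0, _, _, φ => φ
  | m + 1, _, _, φ => pathPowMap m (pathMap φ)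

theorem pathPowMap_comp (m : ℕ) {A : LCAlg.{u₁} k} {B : LCAlg.{u₂} k} {C : LCAlg.{u₃} k}
    (g : LCHom B C) (f : LCHom A B) :
    pathPowMap m (g.comp f) = (pathPowMap m g).comp (pathPowMap m f) := by
  induction m generalizing A B C with
  | zero => rfl
  | succ m ih =>
    change pathPowMap m (pathMap (g.comp f)) = _
    rw [pathMap_comp, ih]
    rfl

theorem pathPowMap_of_forall_eq (m : ℕ) {A : LCAlg.{u} k} {φ : LCHom A A} (h : ∀ a, φ a = a)
    (x : pathPow m A) : pathPowMap m φ x = x := by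
  induction m generalizing A with
  | zero => exact h x
  | succ m ih => exact ih (φ := pathMap φ) (fun F => path_ext fun t => h _) x

theorem IsGLFibration.surjective_pathPowMap {A : LCAlg.{u₁} k} {A'' : LCAlg.{u₂} k}
    {η : LCHom A A''} (hη : IsGLFibration η) (m n : ℕ) :
    Function.Surjective (GLmap (pathPowMap m (pathIterMap η (n + 1)))) := by
  induction m generalizing n with
  | zero => exact hη n
  | succ m ih => exact ih (n + 1)

/-- The composite of the face `𝓘^{m+1}(τ)` and the degeneracy `𝓘^m(comult)`. -/
noncomputable def faceThenDegeneracy (m : ℕ) (B : LCAlg.{u} k) :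
    GLalg (pathPow m (path (path B))) →* GLalg (pathPow m (path (path B))) :=
  (GLmap (pathPowMap m (comult B))).comp (GLmap (pathPowMap m (pathMap (tau B))))

theorem face_faceThenDegeneracy (m : ℕ) (B : LCAlg.{u} k) (y : GLalg (pathPow m (path (path B)))) :
    GLmap (pathPowMap m (pathMap (tau B))) (faceThenDegeneracy m B y)
      = GLmap (pathPowMap m (pathMap (tau B))) y := by
  rw [faceThenDegeneracy, MonoidHom.comp_apply, ← GLmap_comp_apply (pathPowMap m (pathMap (tau B))),
    ← pathPowMap_comp]
  exact GLmap_of_forall_eq (pathPowMap_of_forall_eq m (pathMap_tau_comult B)) _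

theorem faceThenDegeneracy_naturality (m : ℕ) {B : LCAlg.{u₁} k} {C : LCAlg.{u₂} k} (φ : LCHom B C)
    (y : GLalg (pathPow m (path (path B)))) :
    GLmap (pathPowMap m (pathMap (pathMap φ))) (faceThenDegeneracy m B y)
      = faceThenDegeneracy m C (GLmap (pathPowMap m (pathMap (pathMap φ))) y) := by
  simp only [faceThenDegeneracy, MonoidHom.comp_apply, ← GLmap_comp_apply, ← pathPowMap_comp]
  refine congrArg (fun f => GLmap (pathPowMap m f) y) ?_
  change ((pathMap (pathMap φ)).comp (comult B)).comp (pathMap (tau B)) = _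
  rw [← comult_naturality]
  rfl

/-- A lift can be changed so that the face `𝓘^{m+1}(τ)` kills it, keeping the faces that kill it
already. -/
theorem exists_lift_killed_by_tau (m : ℕ) {B : LCAlg.{u₁} k} {B'' : LCAlg.{u₂} k} (ψ : LCHom B B'')
    {y : GLalg (pathPow m (path (path B)))} {x : GLalg (pathPow m (path (path B'')))}
    (hy : GLmap (pathPowMap m (pathMap (pathMap ψ))) y = x)
    (hx : GLmap (pathPowMap m (pathMap (tau B''))) x = 1) :
    ∃ y', GLmap (pathPowMap m (pathMap (pathMap ψ))) y' = x ∧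
      GLmap (pathPowMap m (pathMap (tau B))) y' = 1 ∧
      ∀ (C : LCAlg.{u₁} k) (φ : LCHom B C), GLmap (pathPowMap m (pathMap (pathMap φ))) y = 1 →
        GLmap (pathPowMap m (pathMap (pathMap φ))) y' = 1 := by
  refine ⟨y * (faceThenDegeneracy m B y)⁻¹, ?_, ?_, fun C φ hφ => ?_⟩
  · have h : faceThenDegeneracy m B'' x = 1 := by
      rw [faceThenDegeneracy, MonoidHom.comp_apply, hx, map_one]
    rw [map_mul, map_inv, faceThenDegeneracy_naturality, hy, h, inv_one, mul_one]
  · rw [map_mul, map_inv, face_faceThenDegeneracy, mul_inv_cancel]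
  · rw [map_mul, map_inv, faceThenDegeneracy_naturality, hφ, map_one, inv_one, mul_one]

/-- A degreewise surjective map is surjective on the elements killed by the faces
`𝓘^{m+1}(d_i)`. This is the argument which shows that a surjective map of simplicial groups is a
Kan fibration: a lift is corrected by degeneracies of its non-trivial faces, one face at a time. -/
theorem exists_lift_killed_by_faces {A : LCAlg.{u₁} k} {A'' : LCAlg.{u₂} k} {η : LCHom A A''}
    (hη : IsGLFibration η) (n m : ℕ) (x : GLalg (pathPow m (path (pathIter A'' (n + 1)))))
    (hx : ∀ i, GLmap (pathPowMap m (pathMap (face A'' n i))) x = 1) :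
    ∃ y : GLalg (pathPow m (path (pathIter A (n + 1)))),
      GLmap (pathPowMap m (pathMap (pathIterMap η (n + 1)))) y = x ∧
      ∀ i, GLmap (pathPowMap m (pathMap (face A n i))) y = 1 := by
  induction n generalizing m with
  | zero =>
    obtain ⟨y₀, hy₀⟩ := hη.surjective_pathPowMap (m + 1) 0 x
    obtain ⟨y, h1, h2, -⟩ := exists_lift_killed_by_tau m η hy₀ (hx 0)
    exact ⟨y, h1, fun _ => h2⟩
  | succ n ih =>
    have hx' : ∀ i, GLmap (pathPowMap (m + 1) (pathMap (face A'' n i))) x = 1 :=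
      fun i => hx i.succ
    obtain ⟨y₀, hy₀, hy₁⟩ := ih (m + 1) x hx'
    obtain ⟨y, h1, h2, h3⟩ := exists_lift_killed_by_tau m (pathIterMap η (n + 1)) (y := y₀)
      (x := x) hy₀ (hx 0)
    exact ⟨y, h1, Fin.cases h2 fun i => h3 _ (face A n i) (hy₁ i)⟩

/-- The Moore groups of a `GL`-fibration surject onto those of the base. -/
theorem IsGLFibration.exists_moore_lift {A : LCAlg.{u₁} k} {A'' : LCAlg.{u₂} k} {η : LCHom A A''}
    (hη : IsGLFibration η) (n : ℕ) {x : GLalg (pathIter A'' (n + 1))} (hx : x ∈ moore A'' n) :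
    ∃ y ∈ moore A n, GLmap (pathIterMap η (n + 1)) y = x := by
  cases n with
  | zero =>
    obtain ⟨y, hy⟩ := hη 0 x
    exact ⟨y, mem_moore.2 fun i hi => (hi (Subsingleton.elim (α := Fin 1) _ _)).elim, hy⟩
  | succ n =>
    obtain ⟨y, hy, h⟩ := exists_lift_killed_by_faces hη n 0 x
      fun i => mem_moore.1 hx i.succ (Fin.succ_ne_zero i)
    exact ⟨y, mem_moore.2 <| Fin.cases (fun h0 => (h0 rfl).elim) fun i _ => h i, hy⟩

end MooreLifting

/-! ### The long exact sequence of Moore homotopy groups -/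

section MooreSequence

variable {k : Type v} [RCLike k]

/-- The unit element, which `Function.MulExact` asks for without the group structure. -/
noncomputable instance piAug.instOne (A : LCAlg.{u} k) (n : ℕ) : One (piAug A n) :=
  (QuotientGroup.Quotient.group ((boundaries A n).subgroupOf (cycles A n))).toOne

theorem GLmap_face_GLmap {A : LCAlg.{u₁} k} {B : LCAlg.{u₂} k} (φ : LCHom A B) (n : ℕ)
    (i : Fin (n + 1)) (y : GLalg (pathIter A (n + 1))) :
    GLmap (face B n i) (GLmap (pathIterMap φ (n + 1)) y)
      = GLmap (pathIterMap φ n) (GLmap (face A n i) y) := by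
  rw [← GLmap_comp_apply, face_naturality, GLmap_comp_apply]

theorem GLmap_mem_moore {A : LCAlg.{u₁} k} {B : LCAlg.{u₂} k} (φ : LCHom A B) (n : ℕ)
    {y : GLalg (pathIter A (n + 1))} (hy : y ∈ moore A n) :
    GLmap (pathIterMap φ (n + 1)) y ∈ moore B n :=
  mem_moore.2 fun i hi => by rw [GLmap_face_GLmap, mem_moore.1 hy i hi, map_one]

theorem mem_cycles_of_moore {A : LCAlg.{u} k} {n : ℕ} {y : GLalg (pathIter A (n + 1))}
    (hy : y ∈ moore A n) (h0 : GLmap (face A n 0) y = 1) : y ∈ cycles A (n + 1) :=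
  mem_cycles_succ.2 fun i => if hi : i = 0 then hi ▸ h0 else mem_moore.1 hy i hi

theorem cycles_le_moore (A : LCAlg.{u} k) (n : ℕ) : cycles A (n + 1) ≤ moore A n :=
  fun _ hy => mem_moore.2 fun i _ => mem_cycles_succ.1 hy i

theorem face_zero_mem_cycles {A : LCAlg.{u} k} {n : ℕ} {y : GLalg (pathIter A (n + 1))}
    (hy : y ∈ moore A n) : GLmap (face A n 0) y ∈ cycles A n :=
  boundaries_le_cycles A n ⟨y, hy, rfl⟩

theorem piAug_mk_eq_mk {A : LCAlg.{u} k} {n : ℕ} {x y : cycles A n} :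
    (QuotientGroup.mk x : piAug A n) = QuotientGroup.mk y ↔
      ∃ m ∈ moore A n, y.1 = x.1 * GLmap (face A n 0) m := by
  rw [QuotientGroup.eq, Subgroup.mem_subgroupOf]
  constructor
  · rintro ⟨m, hm, h⟩
    exact ⟨m, hm, (congrArg (x.1 * ·) h |>.trans (mul_inv_cancel_left x.1 y.1)).symm⟩
  · rintro ⟨m, hm, h⟩
    exact ⟨m, hm, (inv_mul_eq_iff_eq_mul.2 h).symm⟩

variable {A' : LCAlg.{u₁} k} {A : LCAlg.{u₂} k} {A'' : LCAlg.{u₃} k}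
  {j : LCHom A' A} {η : LCHom A A''}

theorem IsTopKernel.GLmap_injective (h : IsTopKernel j η) (n : ℕ) :
    Function.Injective (GLmap (SmoothK.pathIterMap j n)) :=
  SmoothK.GLmap_injective (h.pathIterMap n).isEmbedding.injective

theorem IsTopKernel.exists_GLmap_eq (h : IsTopKernel j η) {n : ℕ} {y : GLalg (pathIter A n)}
    (hy : GLmap (SmoothK.pathIterMap η n) y = 1) :
    ∃ z, GLmap (SmoothK.pathIterMap j n) z = y :=
  SmoothK.exists_GLmap_eq (h.pathIterMap n).isEmbedding.injective (h.pathIterMap n).exact hy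

theorem IsTopKernel.GLmap_GLmap (h : IsTopKernel j η) (n : ℕ) (z : GLalg (pathIter A' n)) :
    GLmap (SmoothK.pathIterMap η n) (GLmap (SmoothK.pathIterMap j n) z) = 1 := by
  rw [← GLmap_comp_apply]
  exact GLmap_eq_one (fun a => (h.pathIterMap n).exact.apply_apply_eq_zero a) z

theorem IsTopKernel.mem_moore_of_GLmap (h : IsTopKernel j η) {n : ℕ}
    {z : GLalg (pathIter A' (n + 1))}
    (hz : GLmap (SmoothK.pathIterMap j (n + 1)) z ∈ moore A n) : z ∈ moore A' n :=
  mem_moore.2 fun i hi => h.GLmap_injective n <| by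
    rw [← GLmap_face_GLmap, mem_moore.1 hz i hi, map_one]

theorem IsTopKernel.mem_cycles_of_GLmap (h : IsTopKernel j η) {n : ℕ}
    {z : GLalg (pathIter A' n)}
    (hz : GLmap (SmoothK.pathIterMap j n) z ∈ cycles A n) : z ∈ cycles A' n := by
  cases n with
  | zero => trivial
  | succ n =>
    exact mem_cycles_succ.2 fun i => h.GLmap_injective n <| by
      rw [← GLmap_face_GLmap, mem_cycles_succ.1 hz i, map_one]

/-- `w` is obtained from `x` by the snake construction: `σ(w) = d₀ y` for a lift `y` of `x` in the
Moore complex of `A`. -/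
def MooreRel (j : LCHom A' A) (η : LCHom A A'') (n : ℕ) (x : GLalg (pathIter A'' (n + 1)))
    (w : GLalg (pathIter A' n)) : Prop :=
  ∃ y ∈ moore A n, GLmap (pathIterMap η (n + 1)) y = x ∧
    GLmap (pathIterMap j n) w = GLmap (face A n 0) y

theorem MooreRel.mul {n : ℕ} {x x' : GLalg (pathIter A'' (n + 1))} {w w' : GLalg (pathIter A' n)}
    (h : MooreRel j η n x w) (h' : MooreRel j η n x' w') : MooreRel j η n (x * x') (w * w') := by
  obtain ⟨y, hy, h1, h2⟩ := h
  obtain ⟨y', hy', h1', h2'⟩ := h'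
  exact ⟨y * y', mul_mem hy hy', by rw [map_mul, h1, h1'], by rw [map_mul, map_mul, h2, h2']⟩

theorem exists_mooreRel (h : IsTopKernel j η) (hη : IsGLFibration η) {n : ℕ}
    (x : cycles A'' (n + 1)) : ∃ w : cycles A' n, MooreRel j η n x.1 w.1 := by
  obtain ⟨y, hy, hyx⟩ := hη.exists_moore_lift n (cycles_le_moore A'' n x.2)
  obtain ⟨w, hw⟩ := h.exists_GLmap_eq (y := GLmap (face A n 0) y) (by
    rw [← GLmap_face_GLmap, hyx]
    exact mem_cycles_succ.1 x.2 0)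
  exact ⟨⟨w, h.mem_cycles_of_GLmap (hw ▸ face_zero_mem_cycles hy)⟩, y, hy, hyx, hw⟩

theorem MooreRel.mk_eq (h : IsTopKernel j η) {n : ℕ} {x : GLalg (pathIter A'' (n + 1))}
    {w w' : cycles A' n} (hw : MooreRel j η n x w.1) (hw' : MooreRel j η n x w'.1) :
    (QuotientGroup.mk w : piAug A' n) = QuotientGroup.mk w' := by
  obtain ⟨y, hy, h1, h2⟩ := hw
  obtain ⟨y', hy', h1', h2'⟩ := hw'
  obtain ⟨m, hm⟩ := h.exists_GLmap_eq (y := y⁻¹ * y') (by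
    rw [map_mul, map_inv, h1, h1', inv_mul_cancel])
  refine piAug_mk_eq_mk.2 ⟨m, h.mem_moore_of_GLmap (hm ▸ mul_mem (inv_mem hy) hy'), ?_⟩
  apply h.GLmap_injective n
  rw [map_mul, h2, h2', ← GLmap_face_GLmap, hm, map_mul, map_inv, mul_inv_cancel_left]

/-- The connecting homomorphism on Moore cycles. -/
noncomputable def cyclesConnecting (h : IsTopKernel j η) (hη : IsGLFibration η) (n : ℕ) :
    cycles A'' (n + 1) →* piAug A' n :=
  MonoidHom.mk' (fun x => QuotientGroup.mk (exists_mooreRel h hη x).choose) fun x x' =>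
    MooreRel.mk_eq h (exists_mooreRel h hη (x * x')).choose_spec
      ((exists_mooreRel h hη x).choose_spec.mul (exists_mooreRel h hη x').choose_spec)

theorem cyclesConnecting_eq (h : IsTopKernel j η) (hη : IsGLFibration η) {n : ℕ}
    {x : cycles A'' (n + 1)} {w : cycles A' n} (hw : MooreRel j η n x.1 w.1) :
    cyclesConnecting h hη n x = QuotientGroup.mk w :=
  MooreRel.mk_eq h (exists_mooreRel h hη x).choose_spec hw

/-- The connecting homomorphism `π_n(A'') → π_{n-1}(A')` of the short exact sequence of Moore
complexes. -/
noncomputable def mooreConnecting (h : IsTopKernel j η) (hη : IsGLFibration η) (n : ℕ) :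
    piAug A'' (n + 1) →* piAug A' n :=
  QuotientGroup.lift _ (cyclesConnecting h hη n) fun x hx => by
    obtain ⟨m, hm, hmx⟩ := hx
    obtain ⟨y, hy, rfl⟩ := hη.exists_moore_lift (n + 1) hm
    refine cyclesConnecting_eq h hη (w := 1)
      ⟨GLmap (face A (n + 1) 0) y, cycles_le_moore A n (face_zero_mem_cycles hy), ?_, ?_⟩
    · rw [← GLmap_face_GLmap]; exact hmx
    · rw [mem_cycles_succ.1 (face_zero_mem_cycles hy) 0]
      exact map_one _

theorem mooreConnecting_eq (h : IsTopKernel j η) (hη : IsGLFibration η) {n : ℕ}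
    {x : cycles A'' (n + 1)} {w : cycles A' n} (hw : MooreRel j η n x.1 w.1) :
    mooreConnecting h hη n (QuotientGroup.mk x) = QuotientGroup.mk w :=
  cyclesConnecting_eq h hη hw

theorem isMooreConnecting_mooreConnecting (h : IsTopKernel j η) (hη : IsGLFibration η) (n : ℕ) :
    IsMooreConnecting j η n (mooreConnecting h hη n) :=
  fun _ y _ hyx hw => mooreConnecting_eq h hη ⟨y.1, y.2, hyx, hw⟩

theorem mulExact_piAugMap (h : IsTopKernel j η) (hη : IsGLFibration η) (n : ℕ) :
    Function.MulExact (piAugMap j n) (piAugMap η n) := by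
  intro c
  constructor
  · intro hc
    obtain ⟨z, rfl⟩ := QuotientGroup.mk_surjective c
    obtain ⟨x, hx, hzx⟩ := piAug_mk_eq_mk.1 (hc : (QuotientGroup.mk (cyclesMap η n z) : piAug A'' n)
      = QuotientGroup.mk 1)
    obtain ⟨y, hy, rfl⟩ := hη.exists_moore_lift n hx
    obtain ⟨w, hw⟩ := h.exists_GLmap_eq (y := z.1 * GLmap (face A n 0) y) (by
      rw [map_mul, ← GLmap_face_GLmap]; exact hzx.symm)
    refine ⟨QuotientGroup.mk ⟨w, h.mem_cycles_of_GLmap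
      (hw ▸ mul_mem z.2 (face_zero_mem_cycles hy))⟩, ?_⟩
    exact (piAug_mk_eq_mk.2 ⟨y, hy, hw⟩).symm
  · rintro ⟨c, rfl⟩
    obtain ⟨w, rfl⟩ := QuotientGroup.mk_surjective c
    exact congrArg QuotientGroup.mk (Subtype.ext (h.GLmap_GLmap n w.1))

theorem mulExact_piAugMap_mooreConnecting (h : IsTopKernel j η) (hη : IsGLFibration η) (n : ℕ) :
    Function.MulExact (piAugMap η (n + 1)) (mooreConnecting h hη n) := by
  intro c
  constructor
  · intro hc
    obtain ⟨x, rfl⟩ := QuotientGroup.mk_surjective c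
    obtain ⟨w, y, hy, hyx, hwy⟩ := exists_mooreRel h hη x
    rw [mooreConnecting_eq h hη ⟨y, hy, hyx, hwy⟩] at hc
    obtain ⟨m, hm, hwm⟩ := piAug_mk_eq_mk.1 (hc.trans (QuotientGroup.mk_one _).symm)
    have hwm' : 1 = w.1 * GLmap (face A' n 0) m := hwm
    have hz : y * GLmap (pathIterMap j (n + 1)) m ∈ cycles A (n + 1) := by
      refine mem_cycles_of_moore (mul_mem hy (GLmap_mem_moore j n hm)) ?_
      rw [map_mul, GLmap_face_GLmap, ← hwy, ← map_mul, ← hwm', map_one]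
    refine ⟨QuotientGroup.mk ⟨_, hz⟩, congrArg QuotientGroup.mk (Subtype.ext ?_)⟩
    change GLmap (pathIterMap η (n + 1)) (y * GLmap (pathIterMap j (n + 1)) m) = x.1
    rw [map_mul, h.GLmap_GLmap, mul_one, hyx]
  · rintro ⟨c, rfl⟩
    obtain ⟨z, rfl⟩ := QuotientGroup.mk_surjective c
    refine mooreConnecting_eq h hη (x := cyclesMap η (n + 1) z) (w := 1)
      ⟨z.1, cycles_le_moore A n z.2, rfl, ?_⟩
    rw [mem_cycles_succ.1 z.2 0]
    exact map_one _

theorem mulExact_mooreConnecting_piAugMap (h : IsTopKernel j η) (hη : IsGLFibration η) (n : ℕ) :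
    Function.MulExact (mooreConnecting h hη n) (piAugMap j n) := by
  intro c
  constructor
  · intro hc
    obtain ⟨w, rfl⟩ := QuotientGroup.mk_surjective c
    obtain ⟨y, hy, hwy⟩ := piAug_mk_eq_mk.1 (hc.symm :
      (QuotientGroup.mk 1 : piAug A n) = QuotientGroup.mk (cyclesMap j n w))
    have hwy' : GLmap (pathIterMap j n) w.1 = GLmap (face A n 0) y := by
      refine Eq.trans hwy ?_
      exact one_mul _
    refine ⟨QuotientGroup.mk ⟨GLmap (pathIterMap η (n + 1)) y,
      mem_cycles_of_moore (GLmap_mem_moore η n hy) ?_⟩, mooreConnecting_eq h hη ⟨y, hy, rfl, hwy'⟩⟩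
    rw [GLmap_face_GLmap, ← hwy', h.GLmap_GLmap]
  · rintro ⟨c, rfl⟩
    obtain ⟨x, rfl⟩ := QuotientGroup.mk_surjective c
    obtain ⟨w, y, hy, hyx, hwy⟩ := exists_mooreRel h hη x
    rw [mooreConnecting_eq h hη ⟨y, hy, hyx, hwy⟩]
    refine Eq.symm (piAug_mk_eq_mk.2 ⟨y, hy, ?_⟩ : (QuotientGroup.mk 1 : piAug A n)
      = QuotientGroup.mk (cyclesMap j n w))
    exact hwy.trans (one_mul _).symm

end MooreSequence

/-! ### Classes of idempotent matrices in `K₀` -/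

section IdempotentClasses

open Algebra

variable {R : Type u} [Ring R] {S : Type u₁} [Ring S]

/-- An idempotent matrix indexed by an arbitrary finite type, reindexed by an initial segment of
`ℕ`. -/
noncomputable def finIdem {ι : Type*} [Fintype ι] (p : Matrix ι ι R) (hp : p * p = p) : IdemMat R :=
  ⟨Fintype.card ι, p.submatrix (Fintype.equivFin ι).symm (Fintype.equivFin ι).symm,
    by rw [Matrix.submatrix_mul_equiv, hp]⟩

theorem matEquiv_finIdem {ι : Type*} [Fintype ι] {p : Matrix ι ι R} (hp : p * p = p) :
    MatEquiv p (finIdem p hp).mat := MatEquiv.submatrix hp _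

/-- The class in `K₀(R)` of an idempotent matrix indexed by an arbitrary finite type. -/
noncomputable def idemClass {ι : Type*} [Fintype ι] (p : Matrix ι ι R) (hp : p * p = p) :
    KZeroUnital R :=
  KZeroUnital.cls (finIdem p hp)

theorem cls_eq_cls {p q : IdemMat R} (h : MatEquiv p.mat q.mat) :
    KZeroUnital.cls p = KZeroUnital.cls q :=
  congrArg GrothendieckAddGroup.of (Quotient.sound h)

theorem idemClass_eq_cls {ι : Type*} [Fintype ι] {p : Matrix ι ι R} (hp : p * p = p)
    {q : IdemMat R} (h : MatEquiv p q.mat) : idemClass p hp = KZeroUnital.cls q :=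
  cls_eq_cls ((matEquiv_finIdem hp).symm.trans (finIdem p hp).idem q.idem h)

theorem idemClass_congr {ι κ : Type*} [Fintype ι] [Fintype κ] {p : Matrix ι ι R}
    {q : Matrix κ κ R} (h : MatEquiv p q) (hp : p * p = p) (hq : q * q = q) :
    idemClass p hp = idemClass q hq :=
  idemClass_eq_cls hp (h.trans hp (finIdem q hq).idem (matEquiv_finIdem hq))

theorem cls_eq_idemClass (p : IdemMat R) : KZeroUnital.cls p = idemClass p.mat p.idem :=
  (idemClass_eq_cls p.idem (.refl p.idem)).symm

theorem cls_add (p q : IdemMat R) :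
    KZeroUnital.cls (p.add q) = KZeroUnital.cls p + KZeroUnital.cls q :=
  map_add GrothendieckAddGroup.of (id (Quotient.mk _ p) : VMon R) (id (Quotient.mk _ q) : VMon R)

theorem idemClass_fromBlocks {ι κ : Type*} [Fintype ι] [Fintype κ] {p : Matrix ι ι R}
    {q : Matrix κ κ R} (hp : p * p = p) (hq : q * q = q) :
    idemClass (Matrix.fromBlocks p 0 0 q) (fromBlocks_idem hp hq)
      = idemClass p hp + idemClass q hq := by
  refine Eq.trans ?_ (cls_add _ _)
  apply idemClass_eq_cls
  refine MatEquiv.trans (fromBlocks_idem hp hq) (IdemMat.idem _) ?_ (IdemMat.add_equiv _ _)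
  exact (matEquiv_finIdem hp).fromBlocks (matEquiv_finIdem hq)

theorem idemClass_zero (ι : Type*) [Fintype ι] :
    idemClass (0 : Matrix ι ι R) (zero_mul 0) = 0 := by
  refine (idemClass_eq_cls (q := IdemMat.zero) _ ⟨0, 0, by simp, ?_⟩).trans
    (map_zero GrothendieckAddGroup.of)
  exact Subsingleton.elim (α := Matrix (Fin 0) (Fin 0) R) _ _

theorem idemClass_fromBlocks_zero {ι κ : Type*} [Fintype ι] [Fintype κ] {p : Matrix ι ι R}
    (hp : p * p = p) :
    idemClass (Matrix.fromBlocks p 0 0 (0 : Matrix κ κ R)) (fromBlocks_idem hp (zero_mul 0))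
      = idemClass p hp := by
  rw [idemClass_fromBlocks hp (zero_mul 0), idemClass_zero, add_zero]

variable (R) in
/-- The class of the free module with a given finite basis. -/
noncomputable def freeClass (ι : Type*) [Fintype ι] [DecidableEq ι] : KZeroUnital R :=
  idemClass (1 : Matrix ι ι R) (one_mul 1)

theorem freeClass_sum (ι κ : Type*) [Fintype ι] [Fintype κ] [DecidableEq ι] [DecidableEq κ] :
    freeClass R (ι ⊕ κ) = freeClass R ι + freeClass R κ := by
  rw [freeClass, freeClass, freeClass, ← idemClass_fromBlocks]
  congr 1
  exact Matrix.fromBlocks_one.symm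

theorem idemClass_eq_freeClass {ι κ : Type*} [Fintype ι] [Fintype κ] [DecidableEq κ]
    {p : Matrix ι ι R} (hp : p * p = p) (h : MatEquiv p (1 : Matrix κ κ R)) :
    idemClass p hp = freeClass R κ := idemClass_congr h hp (one_mul 1)

theorem freeClass_congr {ι κ : Type*} [Fintype ι] [Fintype κ] [DecidableEq ι] [DecidableEq κ]
    (e : ι ≃ κ) : freeClass R ι = freeClass R κ := by
  refine idemClass_eq_freeClass _ (MatEquiv.symm ?_)
  have h := MatEquiv.submatrix (one_mul (1 : Matrix κ κ R)) e
  rwa [Matrix.submatrix_one_equiv] at h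

theorem map_idemClass (f : R →+* S) {ι : Type*} [Fintype ι] {p : Matrix ι ι R} (hp : p * p = p)
    (hq : p.map f * p.map f = p.map f) :
    KZeroUnital.map f (idemClass p hp) = idemClass (p.map f) hq :=
  KZeroUnital.map_cls f _

theorem map_freeClass (f : R →+* S) (ι : Type*) [Fintype ι] [DecidableEq ι] :
    KZeroUnital.map f (freeClass R ι) = freeClass S ι := by
  have e : (1 : Matrix ι ι R).map f = 1 := Matrix.map_one f (map_zero f) (map_one f)
  rw [freeClass, map_idemClass f _ (by rw [e, one_mul])]
  simp only [e]
  rfl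

theorem map_idem (f : R →+* S) {ι : Type*} [Fintype ι] {p : Matrix ι ι R} (hp : p * p = p) :
    p.map f * p.map f = p.map f := by rw [← Matrix.map_mul, hp]

theorem one_sub_idem {ι : Type*} [Fintype ι] [DecidableEq ι] {p : Matrix ι ι R} (hp : p * p = p) :
    (1 - p) * (1 - p) = 1 - p := by
  rw [mul_sub, sub_mul, sub_mul, hp]; simp

theorem idemClass_add_one_sub {ι : Type*} [Fintype ι] [DecidableEq ι] {p : Matrix ι ι R}
    (hp : p * p = p) :
    idemClass p hp + idemClass (1 - p) (one_sub_idem hp) = freeClass R ι := by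
  rw [← idemClass_fromBlocks]
  have h1 : p * (1 - p) = 0 := by rw [mul_sub, hp, mul_one, sub_self]
  have h2 : (1 - p) * p = 0 := by rw [sub_mul, hp, one_mul, sub_self]
  refine idemClass_eq_freeClass _ ⟨Matrix.fromRows p (1 - p), Matrix.fromCols p (1 - p), ?_, ?_⟩
  · rw [Matrix.fromRows_mul_fromCols, hp, one_sub_idem hp, h1, h2]
  · rw [Matrix.fromCols_mul_fromRows, hp, one_sub_idem hp]; simp

/-- Every class is `[p] - [Rⁿ]`: the negative summand is completed to a free module. -/
theorem exists_eq_idemClass_sub (x : KZeroUnital R) :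
    ∃ (a n : ℕ) (p : Matrix (Fin a) (Fin a) R) (hp : p * p = p),
      x = idemClass p hp - freeClass R (Fin n) := by
  have h0 : ∃ p q : IdemMat R, x = KZeroUnital.cls p - KZeroUnital.cls q := by
    obtain ⟨⟨a, s, hs⟩, h⟩ := (AddLocalization.addMonoidOf (⊤ : AddSubmonoid (VMon R))).surj x
    induction a using Quotient.ind with
    | _ p =>
      induction s using Quotient.ind with
      | _ q => exact ⟨p, q, eq_sub_of_add_eq h⟩
  obtain ⟨p, q, rfl⟩ := h0
  have hq := idemClass_add_one_sub q.idem
  refine ⟨_, q.size, (p.add ⟨q.size, 1 - q.mat, one_sub_idem q.idem⟩).mat, IdemMat.idem _, ?_⟩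
  rw [← cls_eq_idemClass, cls_add, ← hq, cls_eq_idemClass, cls_eq_idemClass, cls_eq_idemClass]
  abel

/-- `p ⊕ 1 ≃ (1 - r) ⊕ r ⊕ p`: an idempotent `r` can be completed to an identity matrix. -/
theorem matEquiv_fromBlocks_one_sub {ι κ : Type*} [Fintype ι] [Fintype κ] [DecidableEq κ]
    {p : Matrix ι ι R} {r : Matrix κ κ R} (hp : p * p = p) (hr : r * r = r) :
    MatEquiv (Matrix.fromBlocks p 0 0 (1 : Matrix κ κ R))
      (Matrix.fromBlocks (1 - r) 0 0 (Matrix.fromBlocks r 0 0 p)) := by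
  have h1 : r * (1 - r) = 0 := by rw [mul_sub, hr, mul_one, sub_self]
  have h2 : (1 - r) * r = 0 := by rw [sub_mul, hr, one_mul, sub_self]
  refine ⟨Matrix.fromBlocks 0 (Matrix.fromCols 0 p) (1 - r) (Matrix.fromCols r 0),
    Matrix.fromBlocks 0 (1 - r) (Matrix.fromRows 0 p) (Matrix.fromRows r 0), ?_, ?_⟩
  · simp [Matrix.fromBlocks_multiply, Matrix.fromCols_mul_fromRows, hp, hr, one_sub_idem hr]
  · simp only [Matrix.fromBlocks_multiply, Matrix.mul_fromCols, Matrix.fromRows_mul,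
      Matrix.zero_mul, Matrix.mul_zero, hp, hr, h1, h2,
      one_sub_idem hr, zero_add]
    congr 1 <;> ext i j <;> (try rcases i with i | i) <;> (try rcases j with j | j) <;> simp

theorem matEquiv_add_finIdem {ι : Type*} [Fintype ι] (r : IdemMat R) {p : Matrix ι ι R}
    (hp : p * p = p) : MatEquiv (Matrix.fromBlocks r.mat 0 0 p) (r.add (finIdem p hp)).mat :=
  ((MatEquiv.refl r.idem).fromBlocks (matEquiv_finIdem hp)).trans (fromBlocks_idem r.idem hp)
    (IdemMat.idem _) (IdemMat.add_equiv r _)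

/-- Equality in `K₀` is stable equivalence of idempotents. -/
theorem exists_matEquiv_of_idemClass_eq {ι κ : Type*} [Fintype ι] [Fintype κ]
    {p : Matrix ι ι R} {q : Matrix κ κ R} {hp : p * p = p} {hq : q * q = q}
    (h : idemClass p hp = idemClass q hq) :
    ∃ N : ℕ, MatEquiv (Matrix.fromBlocks p 0 0 (1 : Matrix (Fin N) (Fin N) R))
      (Matrix.fromBlocks q 0 0 (1 : Matrix (Fin N) (Fin N) R)) := by
  have h0 : ∃ r : IdemMat R, MatEquiv (r.add (finIdem p hp)).mat (r.add (finIdem q hq)).mat := by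
    obtain ⟨⟨c, hc⟩, h⟩ :=
      (AddLocalization.addMonoidOf (⊤ : AddSubmonoid (VMon R))).eq_iff_exists.1 h
    induction c using Quotient.ind with
    | _ r => exact ⟨r, Quotient.exact h⟩
  obtain ⟨r, hr⟩ := h0
  have hpq : MatEquiv (Matrix.fromBlocks r.mat 0 0 p) (Matrix.fromBlocks r.mat 0 0 q) :=
    ((matEquiv_add_finIdem r hp).trans (fromBlocks_idem r.idem hp) (IdemMat.idem _) hr).trans
      (fromBlocks_idem r.idem hp) (fromBlocks_idem r.idem hq) (matEquiv_add_finIdem r hq).symm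
  have i1 := fromBlocks_idem hp (one_mul (1 : Matrix (Fin r.size) (Fin r.size) R))
  have i2 := fromBlocks_idem hq (one_mul (1 : Matrix (Fin r.size) (Fin r.size) R))
  have i3 := fromBlocks_idem (one_sub_idem r.idem) (fromBlocks_idem r.idem hq)
  exact ⟨r.size, ((matEquiv_fromBlocks_one_sub hp r.idem).trans i1 i3
    ((MatEquiv.refl (one_sub_idem r.idem)).fromBlocks hpq)).trans i1 i2
    (matEquiv_fromBlocks_one_sub hq r.idem).symm⟩

end IdempotentClasses

/-! ### Gluing modules along an invertible matrix -/

section IndexMap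

open Matrix

variable {R' : Type u₁} [Ring R'] {R : Type u₂} [Ring R] {S : Type u₃} [Ring S] {K : Type v} [Ring K]

/-- A ring `R` over a ring `K` of constants, a surjection `f : R → S` compatible with an
augmentation `ε : S → K`, and the subring `R'` of those elements of `R` whose image in `S` is a
constant. This is the Milnor square with corners `R'`, `R`, `K`, `S`. -/
structure AugmentedSquare (i : R' →+* R) (f : R →+* S) (c : K →+* R) (ε : S →+* K) : Prop where
  injective : Function.Injective i
  surjective : Function.Surjective f
  aug_const : ∀ a, ε (f (c a)) = a
  map_map : ∀ r, f (i r) = f (c (ε (f (i r))))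
  exists_eq : ∀ r a, f r = f (c a) → ∃ r', i r' = r

variable {i : R' →+* R} {f : R →+* S} {c : K →+* R} {ε : S →+* K}

namespace AugmentedSquare

variable (h : AugmentedSquare i f c ε)
include h

theorem map_injective {α β : Type*} : Function.Injective fun M : Matrix α β R' => M.map i :=
  fun _ _ hMN => Matrix.ext fun a b => h.injective (congrFun (congrFun hMN a) b)

theorem map_const_injective {α β : Type*} :
    Function.Injective fun M : Matrix α β K => (M.map c).map f := by
  intro M N hMN
  ext a b
  rw [← h.aug_const (M a b), ← h.aug_const (N a b)]
  exact congrArg ε (congrFun (congrFun hMN a) b)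

theorem exists_map_eq {α β : Type*} {M : Matrix α β R} {N : Matrix α β K}
    (hM : M.map f = (N.map c).map f) : ∃ M' : Matrix α β R', M'.map i = M := by
  choose M' hM' using fun a b => h.exists_eq (M a b) (N a b) (congrFun (congrFun hM a) b)
  exact ⟨of M', by ext a b; exact hM' a b⟩

theorem map_map_matrix {α β : Type*} (M : Matrix α β R') :
    (M.map i).map f = ((((M.map i).map f).map ε).map c).map f := by
  ext a b
  exact h.map_map _

theorem map_const_map_aug {α β : Type*} (M : Matrix α β K) : ((M.map c).map f).map ε = M := by
  ext a b
  exact h.aug_const _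

end AugmentedSquare

/-- An invertible matrix `diag(g, g⁻¹)` lifts to an invertible matrix along any surjection of
rings. -/
theorem exists_lift_diag (hf : Function.Surjective f) {ν : Type*} [Fintype ν] [DecidableEq ν]
    {g g' : Matrix ν ν S} (h1 : g * g' = 1) (h2 : g' * g = 1) :
    ∃ U U' : Matrix (ν ⊕ ν) (ν ⊕ ν) R, U * U' = 1 ∧ U' * U = 1 ∧
      U.map f = fromBlocks g 0 0 g' ∧ U'.map f = fromBlocks g' 0 0 g := by
  choose s hs using hf
  set a : Matrix ν ν R := g.map s with ha
  set b : Matrix ν ν R := g'.map s with hb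
  have ea : f.mapMatrix a = g := by ext; simp [ha, hs]
  have eb : f.mapMatrix b = g' := by ext; simp [hb, hs]
  -- `U` is the product of `[1, a; 0, 1]`, `[1, 0; -b, 1]`, `[1, a; 0, 1]` and `[0, -1; 1, 0]`, so
  -- that it is invertible although `a` and `b` need not be
  refine ⟨fromBlocks (2 * a - a * b * a) (a * b - 1) (1 - b * a) b,
    fromBlocks b (1 - b * a) (a * b - 1) (2 * a - a * b * a), ?_, ?_, ?_, ?_⟩
  · rw [fromBlocks_multiply, ← fromBlocks_one]
    congr 1 <;> noncomm_ring
  · rw [fromBlocks_multiply, ← fromBlocks_one]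
    congr 1 <;> noncomm_ring
  · rw [fromBlocks_map]
    change fromBlocks (f.mapMatrix _) (f.mapMatrix _) (f.mapMatrix _) (f.mapMatrix _) = _
    simp only [map_sub, map_mul, ea, eb, map_one, map_ofNat, h1, h2, sub_self, one_mul]
    congr 1
    noncomm_ring
  · rw [fromBlocks_map]
    change fromBlocks (f.mapMatrix _) (f.mapMatrix _) (f.mapMatrix _) (f.mapMatrix _) = _
    simp only [map_sub, map_mul, ea, eb, map_one, map_ofNat, h1, h2, sub_self, one_mul]
    congr 1
    noncomm_ring

/-- Stabilisation is the block sum with an identity matrix. -/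
theorem stabMat_eq_submatrix {m d : ℕ} (M : Matrix (Fin m) (Fin m) S) :
    (stabMat M : Matrix (Fin (m + d)) (Fin (m + d)) S)
      = (fromBlocks M 0 0 1).submatrix finSumFinEquiv.symm finSumFinEquiv.symm := by
  ext a b
  refine Fin.addCases (fun a => ?_) (fun a => ?_) a <;>
  refine Fin.addCases (fun b => ?_) (fun b => ?_) b <;>
  simp [stabMat, Matrix.one_apply, Fin.ext_iff]
  omega

/-- The idempotent `p` over `R'` represents the module obtained by gluing free modules over `R` and
over `K` along the invertible matrix `g` over `S` (with inverse `g'`): over `R` it factors as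
`p = a b` with `b a = 1`, and over `S` the bases `a`, `b` agree up to `g` with bases `E`, `F` defined
over the constants. -/
def IndexRel (i : R' →+* R) (f : R →+* S) (c : K →+* R) {ν ι : Type*} [Fintype ν] [DecidableEq ν]
    [Fintype ι] (g g' : Matrix ν ν S) (p : Matrix ι ι R') : Prop :=
  ∃ (a : Matrix ι ν R) (b : Matrix ν ι R) (E : Matrix ι ν K) (F : Matrix ν ι K),
    b * a = 1 ∧ a * b = p.map i ∧ a.map f = (E.map c).map f * g ∧ b.map f = g' * (F.map c).map f

namespace IndexRel

variable {ν ι κ μ : Type*} [Fintype ν] [DecidableEq ν] [Fintype ι] [Fintype κ] [Fintype μ]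
  [DecidableEq μ] {g g' : Matrix ν ν S} {p : Matrix ι ι R'} {q : Matrix κ κ R'}

theorem idem (h : AugmentedSquare i f c ε) (hp : IndexRel i f c g g' p) : p * p = p := by
  obtain ⟨a, b, E, F, h1, h2, -, -⟩ := hp
  apply h.map_injective
  change (p * p).map i = p.map i
  rw [Matrix.map_mul, ← h2, Matrix.mul_assoc, ← Matrix.mul_assoc b, h1, Matrix.one_mul]

theorem matEquiv_map (hp : IndexRel i f c g g' p) : MatEquiv (p.map i) (1 : Matrix ν ν R) := by
  obtain ⟨a, b, E, F, h1, h2, -, -⟩ := hp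
  exact ⟨a, b, h2, h1⟩

/-- The glued module is determined by `g`. -/
theorem matEquiv (h : AugmentedSquare i f c ε) (hg : g * g' = 1) (hp : IndexRel i f c g g' p)
    (hq : IndexRel i f c g g' q) : MatEquiv p q := by
  obtain ⟨a, b, E, F, h1, h2, h3, h4⟩ := hp
  obtain ⟨a', b', E', F', h1', h2', h3', h4'⟩ := hq
  obtain ⟨x, hx⟩ := h.exists_map_eq (M := a * b') (N := E * F') (by
    rw [Matrix.map_mul, h3, h4', Matrix.mul_assoc, ← Matrix.mul_assoc g, hg, Matrix.one_mul,
      ← Matrix.map_mul, ← Matrix.map_mul])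
  obtain ⟨y, hy⟩ := h.exists_map_eq (M := a' * b) (N := E' * F) (by
    rw [Matrix.map_mul, h3', h4, Matrix.mul_assoc, ← Matrix.mul_assoc g, hg, Matrix.one_mul,
      ← Matrix.map_mul, ← Matrix.map_mul])
  refine ⟨x, y, h.map_injective ?_, h.map_injective ?_⟩
  · change (x * y).map i = p.map i
    rw [Matrix.map_mul, hx, hy, Matrix.mul_assoc, ← Matrix.mul_assoc b', h1', Matrix.one_mul, h2]
  · change (y * x).map i = q.map i
    rw [Matrix.map_mul, hx, hy, Matrix.mul_assoc, ← Matrix.mul_assoc b, h1, Matrix.one_mul, h2']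

theorem one (i : R' →+* R) (f : R →+* S) (c : K →+* R) (ν : Type*) [Fintype ν] [DecidableEq ν] :
    IndexRel i f c (1 : Matrix ν ν S) 1 (1 : Matrix ν ν R') :=
  ⟨1, 1, 1, 1, by simp, by simp, by simp, by simp⟩

theorem fromBlocks {γ γ' : Matrix μ μ S} (hp : IndexRel i f c g g' p)
    (hq : IndexRel i f c γ γ' q) :
    IndexRel i f c (Matrix.fromBlocks g 0 0 γ) (Matrix.fromBlocks g' 0 0 γ')
      (Matrix.fromBlocks p 0 0 q) := by
  obtain ⟨a, b, E, F, h1, h2, h3, h4⟩ := hp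
  obtain ⟨a', b', E', F', h1', h2', h3', h4'⟩ := hq
  refine ⟨Matrix.fromBlocks a 0 0 a', Matrix.fromBlocks b 0 0 b', Matrix.fromBlocks E 0 0 E',
    Matrix.fromBlocks F 0 0 F', ?_, ?_, ?_, ?_⟩
  · simp [fromBlocks_multiply, h1, h1']
  · simp [fromBlocks_multiply, fromBlocks_map, h2, h2']
  · simp only [fromBlocks_map, fromBlocks_multiply, h3, h3']
    simp
  · simp only [fromBlocks_map, fromBlocks_multiply, h4, h4']
    simp

theorem reindex (e : μ ≃ ν) (hp : IndexRel i f c g g' p) :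
    IndexRel i f c (g.submatrix e e) (g'.submatrix e e) p := by
  obtain ⟨a, b, E, F, h1, h2, h3, h4⟩ := hp
  refine ⟨a.submatrix id e, b.submatrix e id, E.submatrix id e, F.submatrix e id, ?_, ?_, ?_, ?_⟩
  · rw [← submatrix_mul _ _ _ _ _ Function.bijective_id, h1, submatrix_one_equiv]
  · rw [submatrix_mul_equiv, h2, submatrix_id_id]
  · rw [← submatrix_map, h3, ← submatrix_map, ← submatrix_map]
    exact (submatrix_mul_equiv _ _ _ _ _).symm
  · rw [← submatrix_map, h4, ← submatrix_map, ← submatrix_map]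
    exact (submatrix_mul_equiv _ _ _ _ _).symm

/-- Changing the basis over `R` does not change the glued module. -/
theorem mul_map {C C' : Matrix ν ν R} (h1 : C * C' = 1) (h2 : C' * C = 1)
    (hp : IndexRel i f c g g' p) :
    IndexRel i f c (g * C.map f) (C'.map f * g') p := by
  obtain ⟨a, b, E, F, ha, hb, h3, h4⟩ := hp
  refine ⟨a * C, C' * b, E, F, ?_, ?_, ?_, ?_⟩
  · rw [Matrix.mul_assoc, ← Matrix.mul_assoc b, ha, Matrix.one_mul, h2]
  · rw [Matrix.mul_assoc, ← Matrix.mul_assoc C, h1, Matrix.one_mul, hb]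
  · rw [Matrix.map_mul, h3, Matrix.mul_assoc]
  · rw [Matrix.map_mul, h4, Matrix.mul_assoc]

theorem stab {m n d : ℕ} (hn : n = m + d) {g g' : Matrix (Fin m) (Fin m) S}
    (hp : IndexRel i f c g g' p) :
    IndexRel i f c (stabMat g : Matrix (Fin n) (Fin n) S) (stabMat g')
      (Matrix.fromBlocks p 0 0 (1 : Matrix (Fin d) (Fin d) R')) := by
  subst hn
  rw [stabMat_eq_submatrix, stabMat_eq_submatrix]
  exact (hp.fromBlocks (one i f c (Fin d))).reindex finSumFinEquiv.symm

/-- Any lift of `diag(g, g⁻¹)` exhibits the glued module of `g`. -/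
theorem of_lift {U U' : Matrix (ν ⊕ ν) (ν ⊕ ν) R} (hU : U' * U = 1)
    (h1 : U.map f = Matrix.fromBlocks g 0 0 g') (h2 : U'.map f = Matrix.fromBlocks g' 0 0 g)
    {p : Matrix (ν ⊕ ν) (ν ⊕ ν) R'} (hp : p.map i = U * Matrix.fromBlocks 1 0 0 0 * U') :
    IndexRel i f c g g' p := by
  have e1 : U.submatrix id Sum.inl = U * (Matrix.fromRows 1 0 : Matrix (ν ⊕ ν) ν R) := by
    ext a b; simp [Matrix.mul_apply, Matrix.one_apply]
  have e2 : U'.submatrix Sum.inl id = (Matrix.fromCols 1 0 : Matrix ν (ν ⊕ ν) R) * U' := by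
    ext a b; simp [Matrix.mul_apply, Matrix.one_apply]
  refine ⟨U.submatrix id Sum.inl, U'.submatrix Sum.inl id, Matrix.fromRows 1 0,
    Matrix.fromCols 1 0, ?_, ?_, ?_, ?_⟩
  · rw [← submatrix_mul _ _ _ _ _ Function.bijective_id, hU]
    ext a b; simp [Matrix.one_apply]
  · rw [e1, e2, hp, Matrix.mul_assoc, ← Matrix.mul_assoc (Matrix.fromRows _ _),
      Matrix.fromRows_mul_fromCols, ← Matrix.mul_assoc]
    simp
  · rw [← submatrix_map, h1]
    ext a b
    rcases a with a | a <;> simp [Matrix.mul_apply, Matrix.one_apply]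
  · rw [← submatrix_map, h2]
    ext a b
    rcases b with b | b <;> simp [Matrix.mul_apply, Matrix.one_apply]

theorem exists_of_lift (h : AugmentedSquare i f c ε) {U U' : Matrix (ν ⊕ ν) (ν ⊕ ν) R}
    (hg : g * g' = 1) (hU : U' * U = 1)
    (h1 : U.map f = Matrix.fromBlocks g 0 0 g') (h2 : U'.map f = Matrix.fromBlocks g' 0 0 g) :
    ∃ p : Matrix (ν ⊕ ν) (ν ⊕ ν) R', IndexRel i f c g g' p := by
  obtain ⟨p, hp⟩ := h.exists_map_eq (M := U * Matrix.fromBlocks 1 0 0 0 * U')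
    (N := Matrix.fromBlocks 1 0 0 0) (by
      rw [Matrix.map_mul, Matrix.map_mul, h1, h2]
      simp [fromBlocks_map, fromBlocks_multiply, hg])
  exact ⟨p, of_lift hU h1 h2 hp⟩

theorem exists_idem (h : AugmentedSquare i f c ε) (h1 : g * g' = 1) (h2 : g' * g = 1) :
    ∃ p : Matrix (ν ⊕ ν) (ν ⊕ ν) R', IndexRel i f c g g' p := by
  obtain ⟨U, U', -, hU, e1, e2⟩ := exists_lift_diag h.surjective h1 h2
  exact exists_of_lift h h1 hU e1 e2

/-- `diag(g γ, 1)` and `diag(g, γ)` have the same glued module, since they differ by the liftable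
matrix `diag(γ, γ⁻¹)`. -/
theorem mul (h : AugmentedSquare i f c ε) {γ γ' : Matrix ν ν S} (h1 : γ * γ' = 1) (h2 : γ' * γ = 1)
    (hp : IndexRel i f c g g' p) (hq : IndexRel i f c γ γ' q) :
    IndexRel i f c (Matrix.fromBlocks (g * γ) 0 0 (1 : Matrix ν ν S))
      (Matrix.fromBlocks (γ' * g') 0 0 (1 : Matrix ν ν S))
      (Matrix.fromBlocks p 0 0 q) := by
  obtain ⟨U, U', hU, hU', e1, e2⟩ := exists_lift_diag h.surjective h1 h2
  have := (hp.fromBlocks hq).mul_map hU hU'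
  rw [e1, e2] at this
  simpa [fromBlocks_multiply, h1, h2] using this

/-- If the glued module of `g` is free then `g` lifts to an invertible matrix over `R`. -/
theorem exists_lift_of_matEquiv_one (h : AugmentedSquare i f c ε) (hg : g * g' = 1)
    (hp : IndexRel i f c g g' p) (hp1 : MatEquiv p (1 : Matrix ν ν R')) :
    ∃ C C' : Matrix ν ν R, C * C' = 1 ∧ C' * C = 1 ∧ C.map f = g := by
  have hpp := hp.idem h
  obtain ⟨a, b, E, F, hba, hab, ha, hb⟩ := hp
  obtain ⟨X, Y, hXY, hYX⟩ := hp1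
  set X₀ : Matrix ι ν K := ((X.map i).map f).map ε with hX₀
  set Y₀ : Matrix ν ι K := ((Y.map i).map f).map ε with hY₀
  have hYX₀ : Y₀ * X₀ = 1 := by
    rw [hX₀, hY₀, ← Matrix.map_mul, ← Matrix.map_mul, ← Matrix.map_mul, hYX]; simp
  have hEF : X₀ * Y₀ = E * F := by
    rw [hX₀, hY₀, ← Matrix.map_mul, ← Matrix.map_mul, ← Matrix.map_mul, hXY, ← hab,
      Matrix.map_mul, ha, hb, Matrix.mul_assoc, ← Matrix.mul_assoc g, hg, Matrix.one_mul,
      ← Matrix.map_mul, ← Matrix.map_mul, h.map_const_map_aug]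
  have hFE : F * E = 1 := by
    have h1 : g' * (F.map c).map f * ((E.map c).map f * g) = 1 := by
      rw [← ha, ← hb, ← Matrix.map_mul, hba]; simp
    apply h.map_const_injective
    change ((F * E).map c).map f = ((1 : Matrix ν ν K).map c).map f
    rw [Matrix.map_mul, Matrix.map_mul]
    calc (F.map c).map f * (E.map c).map f
        = (g * g') * ((F.map c).map f * (E.map c).map f) * (g * g') := by
          rw [hg, Matrix.one_mul, Matrix.mul_one]
      _ = g * (g' * (F.map c).map f * ((E.map c).map f * g)) * g' := by
          simp only [Matrix.mul_assoc]
      _ = 1 := by rw [h1, Matrix.mul_one, hg]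
      _ = _ := by simp
  have h1 : F * X₀ * (Y₀ * E) = 1 := by
    rw [Matrix.mul_assoc, ← Matrix.mul_assoc X₀, hEF, Matrix.mul_assoc E, hFE, Matrix.mul_one, hFE]
  have h2 : Y₀ * E * (F * X₀) = 1 := by
    rw [Matrix.mul_assoc, ← Matrix.mul_assoc E, ← hEF, Matrix.mul_assoc X₀, hYX₀, Matrix.mul_one,
      hYX₀]
  have h3 : Y.map i * a * (b * X.map i) = 1 := by
    rw [Matrix.mul_assoc, ← Matrix.mul_assoc a, hab, ← Matrix.map_mul, ← Matrix.map_mul, ← hXY,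
      Matrix.mul_assoc X, hYX, Matrix.mul_one, hYX]
    simp
  have h4 : b * X.map i * (Y.map i * a) = 1 := by
    rw [Matrix.mul_assoc, ← Matrix.mul_assoc (X.map i), ← Matrix.map_mul, hXY, ← hab,
      Matrix.mul_assoc a, hba, Matrix.mul_one, hba]
  refine ⟨(F * X₀).map c * (Y.map i * a), b * X.map i * (Y₀ * E).map c, ?_, ?_, ?_⟩
  · rw [Matrix.mul_assoc, ← Matrix.mul_assoc (Y.map i * a), h3, Matrix.one_mul, ← Matrix.map_mul,
      h1]
    simp
  · rw [Matrix.mul_assoc, ← Matrix.mul_assoc ((Y₀ * E).map c), ← Matrix.map_mul, h2]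
    simp [h4]
  · have hY : (Y.map i).map f = (Y₀.map c).map f := h.map_map_matrix Y
    have hYa : (Y.map i * a).map f = ((Y₀ * E).map c).map f * g := by
      rw [Matrix.map_mul, ha, hY, ← Matrix.mul_assoc, ← Matrix.map_mul, ← Matrix.map_mul]
    rw [Matrix.map_mul, hYa, ← Matrix.mul_assoc, ← Matrix.map_mul, ← Matrix.map_mul, h1]
    simp

/-- A module over `R'` that becomes free over `R` is glued along some `g` with trivial
augmentation. -/
theorem exists_of_matEquiv_one (h : AugmentedSquare i f c ε)
    (hp : MatEquiv (p.map i) (1 : Matrix ν ν R)) :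
    ∃ g g' : Matrix ν ν S, g * g' = 1 ∧ g' * g = 1 ∧ g.map ε = 1 ∧ IndexRel i f c g g' p := by
  obtain ⟨X, Y, hXY, hYX⟩ := hp
  set X₀ : Matrix ι ν K := (X.map f).map ε with hX₀
  set Y₀ : Matrix ν ι K := (Y.map f).map ε with hY₀
  have hYX₀ : Y₀ * X₀ = 1 := by
    rw [hX₀, hY₀, ← Matrix.map_mul, ← Matrix.map_mul, hYX]; simp
  have hYXf : Y.map f * X.map f = 1 := by rw [← Matrix.map_mul, hYX]; simp
  have hXYf : X.map f * Y.map f = (X₀.map c).map f * (Y₀.map c).map f := by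
    rw [← Matrix.map_mul, hXY, ← Matrix.map_mul, ← Matrix.map_mul, hX₀, hY₀, ← Matrix.map_mul,
      ← Matrix.map_mul, hXY]
    exact h.map_map_matrix p
  have hYX₀f : (Y₀.map c).map f * (X₀.map c).map f = 1 := by
    rw [← Matrix.map_mul, ← Matrix.map_mul, hYX₀]; simp
  refine ⟨(Y₀.map c).map f * X.map f, Y.map f * (X₀.map c).map f, ?_, ?_, ?_,
    X, Y, X₀, Y₀, hYX, hXY, ?_, ?_⟩
  · rw [Matrix.mul_assoc, ← Matrix.mul_assoc (X.map f), hXYf, Matrix.mul_assoc, hYX₀f,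
      Matrix.mul_one, hYX₀f]
  · rw [Matrix.mul_assoc, ← Matrix.mul_assoc ((X₀.map c).map f), ← hXYf,
      Matrix.mul_assoc (X.map f), hYXf, Matrix.mul_one, hYXf]
  · rw [Matrix.map_mul, h.map_const_map_aug, hYX₀]
  · rw [← Matrix.mul_assoc, ← hXYf, Matrix.mul_assoc, hYXf, Matrix.mul_one]
  · rw [Matrix.mul_assoc, ← hXYf, ← Matrix.mul_assoc, hYXf, Matrix.one_mul]

end IndexRel

end IndexMap

/-! ### The index map of an augmented square -/

section IndexHom

open Matrix

variable {R' : Type u₁} [Ring R'] {R : Type u₂} [Ring R] {S : Type u₃} [Ring S] {K : Type v} [Ring K]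
variable {i : R' →+* R} {f : R →+* S} {c : K →+* R} {ε : S →+* K}

theorem StableGL.of_stabGL {m n : ℕ} (hmn : m ≤ n) (g : (Matrix (Fin m) (Fin m) R)ˣ) :
    StableGL.of n (stabGL R m n hmn g) = StableGL.of m g :=
  (DirectLimit.eq_of_le (f := stabGL R) (⟨m, g⟩ : Σ m, (Matrix (Fin m) (Fin m) R)ˣ) n hmn).symm

/-- Stabilisation turns `g` into `diag(g, 1)`. -/
theorem StableGL.of_eq_of {m n : ℕ} (hmn : m ≤ n) {g : (Matrix (Fin m) (Fin m) R)ˣ}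
    {γ : (Matrix (Fin n) (Fin n) R)ˣ} (h : γ.1 = stabMat g.1) :
    StableGL.of n γ = StableGL.of m g := by
  rw [← StableGL.of_stabGL hmn g]
  exact congrArg _ (Units.ext h)

theorem freeClass_fin_add (m d : ℕ) :
    freeClass R (Fin (m + d)) = freeClass R (Fin m) + freeClass R (Fin d) := by
  rw [← freeClass_sum, freeClass_congr finSumFinEquiv]

/-- `z = [p] - [R'^m]`, where `p` represents the module glued along a matrix `g ∈ GL_m(S)` of stable
class `x`. -/
def IsIndexAt (i : R' →+* R) (f : R →+* S) (c : K →+* R) (x : StableGL S) (z : KZeroUnital R')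
    (m : ℕ) : Prop :=
  ∃ (g : (Matrix (Fin m) (Fin m) S)ˣ) (ι : Type) (_ : Fintype ι) (p : Matrix ι ι R')
    (hp : p * p = p), x = StableGL.of m g ∧ IndexRel i f c g.1 g⁻¹.1 p ∧
      z = idemClass p hp - freeClass R' (Fin m)

theorem IsIndexAt.stab {x : StableGL S} {z : KZeroUnital R'} {m : ℕ}
    (hz : IsIndexAt i f c x z m) (d : ℕ) : IsIndexAt i f c x z (m + d) := by
  obtain ⟨g, ι, _, p, hp, rfl, hg, rfl⟩ := hz
  refine ⟨stabGL S m (m + d) (Nat.le_add_right m d) g, ι ⊕ Fin d, inferInstance,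
    Matrix.fromBlocks p 0 0 1, fromBlocks_idem hp (one_mul 1), (StableGL.of_stabGL _ g).symm,
    hg.stab rfl, ?_⟩
  rw [idemClass_fromBlocks hp (one_mul 1), freeClass_fin_add]
  exact (add_sub_add_right_eq_sub _ _ _).symm

theorem IsIndexAt.eq_of_eq (h : AugmentedSquare i f c ε) {x : StableGL S} {z z' : KZeroUnital R'}
    {m : ℕ} (hz : IsIndexAt i f c x z m) (hz' : IsIndexAt i f c x z' m) : z = z' := by
  obtain ⟨g, ι, _, p, hp, rfl, hg, rfl⟩ := hz
  obtain ⟨g', ι', _, p', hp', hgg, hg', rfl⟩ := hz'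
  obtain rfl := StableGL.of_injective m hgg
  rw [idemClass_congr (hg.matEquiv h g.mul_inv hg') hp hp']

/-- The class depends only on the stable class of the matrix. -/
theorem IsIndexAt.unique (h : AugmentedSquare i f c ε) {x : StableGL S} {z z' : KZeroUnital R'}
    {m m' : ℕ} (hz : IsIndexAt i f c x z m) (hz' : IsIndexAt i f c x z' m') : z = z' :=
  (hz.stab m').eq_of_eq h (add_comm m' m ▸ hz'.stab m)

theorem exists_isIndexAt_of (h : AugmentedSquare i f c ε) {m : ℕ}
    (g : (Matrix (Fin m) (Fin m) S)ˣ) : ∃ z, IsIndexAt i f c (StableGL.of m g) z m := by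
  obtain ⟨p, hp⟩ := IndexRel.exists_idem h g.mul_inv g.inv_mul
  exact ⟨_, g, Fin m ⊕ Fin m, inferInstance, p, hp.idem h, rfl, hp, rfl⟩

theorem IsIndexAt.mul (h : AugmentedSquare i f c ε) {x y : StableGL S} {z w : KZeroUnital R'}
    {m : ℕ} (hz : IsIndexAt i f c x z m) (hw : IsIndexAt i f c y w m) :
    IsIndexAt i f c (x * y) (z + w) (m + m) := by
  obtain ⟨g, ι, _, p, hp, rfl, hg, rfl⟩ := hz
  obtain ⟨γ, κ, _, q, hq, rfl, hγ, rfl⟩ := hw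
  refine ⟨stabGL S m (m + m) (Nat.le_add_right m m) (g * γ), ι ⊕ κ, inferInstance,
    Matrix.fromBlocks p 0 0 q, fromBlocks_idem hp hq, ?_, ?_, ?_⟩
  · rw [StableGL.of_stabGL, map_mul]
  · have h1 := (IndexRel.mul h γ.mul_inv γ.inv_mul hg hγ).reindex finSumFinEquiv.symm
    rw [← stabMat_eq_submatrix, ← stabMat_eq_submatrix] at h1
    rw [← map_inv, _root_.mul_inv_rev]
    exact h1
  · rw [idemClass_fromBlocks hp hq, freeClass_fin_add]
    abel

theorem exists_isIndexAt (h : AugmentedSquare i f c ε) (x : StableGL S) :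
    ∃ z, ∃ m, IsIndexAt i f c x z m := by
  obtain ⟨m, g, rfl⟩ := StableGL.exists_of x
  obtain ⟨z, hz⟩ := exists_isIndexAt_of h g
  exact ⟨z, m, hz⟩

/-- The index map `GL(S) → K₀(R')` of an augmented square. -/
noncomputable def indexHom (h : AugmentedSquare i f c ε) :
    StableGL S →* Multiplicative (KZeroUnital R') :=
  MonoidHom.mk' (fun x => Multiplicative.ofAdd (exists_isIndexAt h x).choose) fun x y => by
    obtain ⟨m, hm⟩ := (exists_isIndexAt h x).choose_spec
    obtain ⟨n, hn⟩ := (exists_isIndexAt h y).choose_spec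
    obtain ⟨l, hl⟩ := (exists_isIndexAt h (x * y)).choose_spec
    exact congrArg Multiplicative.ofAdd
      (hl.unique h ((hm.stab n).mul h (add_comm n m ▸ hn.stab m)))

theorem indexHom_eq (h : AugmentedSquare i f c ε) {x : StableGL S} {z : KZeroUnital R'} {m : ℕ}
    (hz : IsIndexAt i f c x z m) : (indexHom h x).toAdd = z := by
  obtain ⟨n, hn⟩ := (exists_isIndexAt h x).choose_spec
  exact hn.unique h hz

theorem exists_isIndexAt_indexHom (h : AugmentedSquare i f c ε) (x : StableGL S) :
    ∃ m, IsIndexAt i f c x (indexHom h x).toAdd m :=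
  (exists_isIndexAt h x).choose_spec

/-- The index map is trivial on `GL(R)`: an invertible matrix over `R` glues a free module. -/
theorem indexHom_map (h : AugmentedSquare i f c ε) (x : StableGL R) :
    indexHom h (StableGL.map f x) = 1 := by
  obtain ⟨m, C, rfl⟩ := StableGL.exists_of x
  refine congrArg Multiplicative.ofAdd (indexHom_eq h (z := 0) (m := m) ?_)
  have h1 := (IndexRel.one i f c (Fin m)).mul_map (C := C.1) (C' := C⁻¹.1) C.mul_inv C.inv_mul
  rw [Matrix.one_mul, Matrix.mul_one] at h1
  exact ⟨mapGL f m C, Fin m, inferInstance, 1, one_mul 1, rfl, h1, (sub_self _).symm⟩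

/-- The kernel of the index map is the image of `GL(R)`: after stabilising, the glued module is not
merely stably free but free, so the matrix lifts. -/
theorem exists_map_eq_of_indexHom_eq_one (h : AugmentedSquare i f c ε) {x : StableGL S}
    (hx : indexHom h x = 1) : ∃ C, StableGL.map f C = x := by
  obtain ⟨m, hm⟩ := exists_isIndexAt_indexHom h x
  rw [hx] at hm
  obtain ⟨g, ι, _, p, hp, rfl, hg, hz⟩ := hm
  obtain ⟨N, hN⟩ := exists_matEquiv_of_idemClass_eq (sub_eq_zero.1 hz.symm)
  have i1 := fromBlocks_idem hp (one_mul (1 : Matrix (Fin N) (Fin N) R'))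
  rw [fromBlocks_one] at hN
  have e := MatEquiv.submatrix (one_mul (1 : Matrix (Fin m ⊕ Fin N) (Fin m ⊕ Fin N) R'))
    finSumFinEquiv.symm
  rw [submatrix_one_equiv] at e
  have hu : (stabGL S m (m + N) (Nat.le_add_right m N) g).1
      * (stabGL S m (m + N) (Nat.le_add_right m N) g)⁻¹.1 = 1 := Units.mul_inv _
  obtain ⟨C, C', h1, h2, h3⟩ := (hg.stab (rfl : m + N = m + N)).exists_lift_of_matEquiv_one h
    hu (hN.trans i1 (one_mul 1) e)
  refine ⟨StableGL.of (m + N) ⟨C, C', h1, h2⟩, ?_⟩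
  rw [StableGL.map_of]
  exact StableGL.of_eq_of (Nat.le_add_right m N) h3

/-- An element of the kernel of `K₀(ψ)` is `[p] - [free]` with `ψ(p)` equivalent to the identity. -/
theorem exists_matEquiv_one_of_map_eq_zero {T : Type*} [Ring T] (ψ : R →+* T) {x : KZeroUnital R}
    (hx : KZeroUnital.map ψ x = 0) :
    ∃ (ι : Type) (_ : Fintype ι) (_ : DecidableEq ι) (n : ℕ) (p : Matrix ι ι R) (hp : p * p = p),
      x = idemClass p hp - freeClass R (Fin n) ∧
      MatEquiv (p.map ψ) (1 : Matrix (Fin n) (Fin n) T) := by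
  obtain ⟨a, n, p, hp, rfl⟩ := exists_eq_idemClass_sub x
  rw [map_sub, map_freeClass, map_idemClass ψ hp (map_idem ψ hp), sub_eq_zero] at hx
  obtain ⟨N, hN⟩ := exists_matEquiv_of_idemClass_eq hx
  have i1 := fromBlocks_idem hp (one_mul (1 : Matrix (Fin N) (Fin N) R))
  refine ⟨Fin a ⊕ Fin N, inferInstance, inferInstance, n + N, Matrix.fromBlocks p 0 0 1, i1, ?_, ?_⟩
  · rw [idemClass_fromBlocks hp (one_mul 1), freeClass_fin_add]
    exact (add_sub_add_right_eq_sub _ _ _).symm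
  · have e := MatEquiv.submatrix (one_mul (1 : Matrix (Fin n ⊕ Fin N) (Fin n ⊕ Fin N) T))
      finSumFinEquiv.symm
    rw [submatrix_one_equiv] at e
    rw [fromBlocks_one] at hN
    have e1 : (Matrix.fromBlocks p 0 0 (1 : Matrix (Fin N) (Fin N) R)).map ψ
        = Matrix.fromBlocks (p.map ψ) 0 0 1 := by simp [fromBlocks_map]
    rw [e1]
    refine hN.trans ?_ (one_mul 1) e
    rw [← e1]
    exact map_idem ψ i1

/-- The glued module is free over `R`. -/
theorem map_indexHom (h : AugmentedSquare i f c ε) (x : StableGL S) :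
    KZeroUnital.map i (indexHom h x).toAdd = 0 := by
  obtain ⟨m, g, ι, _, p, hp, -, hg, hz⟩ := exists_isIndexAt_indexHom h x
  rw [hz, map_sub, map_freeClass, map_idemClass i hp (map_idem i hp), sub_eq_zero]
  exact idemClass_eq_freeClass _ hg.matEquiv_map

/-- A class killed by `K₀(R') → K₀(R)` is in the image of the index map on `Ker(GL(S) → GL(K))`. -/
theorem exists_indexHom_eq (h : AugmentedSquare i f c ε) {z : KZeroUnital R'}
    (hz : KZeroUnital.map i z = 0) :
    ∃ x, StableGL.map ε x = 1 ∧ (indexHom h x).toAdd = z := by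
  obtain ⟨ι, _, _, n, p, hp, rfl, hpn⟩ := exists_matEquiv_one_of_map_eq_zero i hz
  obtain ⟨g, g', h1, h2, hε, hg⟩ := IndexRel.exists_of_matEquiv_one h hpn
  refine ⟨StableGL.of n ⟨g, g', h1, h2⟩, ?_,
    indexHom_eq h ⟨⟨g, g', h1, h2⟩, ι, inferInstance, p, hp, rfl, hg, rfl⟩⟩
  rw [StableGL.map_of, ← map_one (StableGL.of n)]
  exact congrArg _ (Units.ext hε)

/-- A class `w` killed by `K₀(R) → K₀(S)` comes from `Ker(K₀(R') → K₀(K))`. Over `S` an idempotent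
`p = x y` equivalent to the identity `y x = 1` becomes conjugate to `diag(0, 1)` after adding a zero
block, by the involution `W` below. After doubling the size the conjugating matrix lifts to `R`,
and the conjugate of `p` by the lift is constant over `S`, hence defined over `R'`. -/
theorem exists_map_eq_of_map_eq_zero (h : AugmentedSquare i f c ε) {w : KZeroUnital R}
    (hw : KZeroUnital.map f w = 0) :
    ∃ z, KZeroUnital.map i z = w ∧ KZeroUnital.map (ε.comp (f.comp i)) z = 0 := by
  obtain ⟨ι, _, _, n, p, hp, rfl, X, Y, hXY, hYX⟩ := exists_matEquiv_one_of_map_eq_zero f hw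
  have hpX : p.map f * X = X := by rw [← hXY, Matrix.mul_assoc, hYX, Matrix.mul_one]
  have hYp : Y * p.map f = Y := by rw [← hXY, ← Matrix.mul_assoc, hYX, Matrix.one_mul]
  have hpf := map_idem f hp
  set W : Matrix (ι ⊕ Fin n) (ι ⊕ Fin n) S := Matrix.fromBlocks (1 - p.map f) X Y 0 with hW
  have hWW : W * W = 1 := by
    rw [hW, fromBlocks_multiply, one_sub_idem hpf, hXY, hYX, Matrix.sub_mul, Matrix.mul_sub, hpX,
      hYp, ← fromBlocks_one]
    simp
  obtain ⟨U, U', hU, hU', e1, e2⟩ := exists_lift_diag h.surjective hWW hWW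
  set P : Matrix ((ι ⊕ Fin n) ⊕ (ι ⊕ Fin n)) ((ι ⊕ Fin n) ⊕ (ι ⊕ Fin n)) R :=
    Matrix.fromBlocks (Matrix.fromBlocks p 0 0 0) 0 0 0 with hP
  have iP : P * P = P := fromBlocks_idem (fromBlocks_idem hp (zero_mul 0)) (zero_mul 0)
  have hPf : (U * P * U').map f
      = Matrix.fromBlocks (Matrix.fromBlocks 0 0 0 1) 0 0 0 := by
    rw [Matrix.map_mul, Matrix.map_mul, e1, e2, hP, hW]
    simp only [fromBlocks_map, fromBlocks_multiply, Matrix.map_zero f (map_zero f),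
      Matrix.mul_zero, Matrix.zero_mul, add_zero, Matrix.sub_mul, Matrix.mul_sub,
      hpf, hYp, hYX, Matrix.one_mul, Matrix.mul_one, sub_self]
  obtain ⟨p', hp'⟩ := h.exists_map_eq (M := U * P * U')
    (N := Matrix.fromBlocks (Matrix.fromBlocks 0 0 0 1) 0 0 0) (by
      rw [hPf]; simp [fromBlocks_map])
  have ip' : p' * p' = p' := by
    apply h.map_injective
    change (p' * p').map i = p'.map i
    rw [Matrix.map_mul, hp']
    calc U * P * U' * (U * P * U') = U * (P * (U' * U) * P) * U' := by
          simp only [Matrix.mul_assoc]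
      _ = U * P * U' := by rw [hU', Matrix.mul_one, iP]
  have hq : MatEquiv (p'.map i) P := by
    refine ⟨U * P, P * U', ?_, ?_⟩
    · rw [hp', ← Matrix.mul_assoc, Matrix.mul_assoc U, iP]
    · rw [Matrix.mul_assoc, ← Matrix.mul_assoc U', hU', Matrix.one_mul, iP]
  refine ⟨idemClass p' ip' - freeClass R' (Fin n), ?_, ?_⟩
  · rw [map_sub, map_freeClass, map_idemClass i ip' (map_idem i ip'),
      idemClass_congr hq (map_idem i ip') iP]
    congr 1
    exact (idemClass_fromBlocks_zero (fromBlocks_idem hp (zero_mul 0))).trans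
      (idemClass_fromBlocks_zero hp)
  · rw [map_sub, map_freeClass, map_idemClass _ ip' (map_idem _ ip'), sub_eq_zero]
    have e : p'.map (ε.comp (f.comp i))
        = Matrix.fromBlocks (Matrix.fromBlocks 0 0 0 1) 0 0 0 := by
      change ((p'.map i).map f).map ε = _
      rw [hp', hPf]
      simp [fromBlocks_map]
    have iQ := fromBlocks_idem (fromBlocks_idem (zero_mul (0 : Matrix ι ι K))
      (one_mul (1 : Matrix (Fin n) (Fin n) K)))
      (zero_mul (0 : Matrix (ι ⊕ Fin n) (ι ⊕ Fin n) K))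
    have he : MatEquiv (p'.map (ε.comp (f.comp i)))
        (Matrix.fromBlocks (Matrix.fromBlocks (0 : Matrix ι ι K) 0 0 (1 : Matrix (Fin n) (Fin n) K))
          0 0 (0 : Matrix (ι ⊕ Fin n) (ι ⊕ Fin n) K)) := by
      rw [e]; exact .refl iQ
    rw [idemClass_congr he _ iQ,
      idemClass_fromBlocks_zero (fromBlocks_idem (zero_mul 0) (one_mul 1)),
      idemClass_fromBlocks (zero_mul 0) (one_mul 1), idemClass_zero, zero_add, freeClass]

end IndexHom

/-! ### The connecting homomorphisms -/

section IndexConnecting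

variable {k : Type v} [RCLike k]
  {A' : LCAlg.{u₁} k} {A : LCAlg.{u₂} k} {A'' : LCAlg.{u₃} k}
  {j : LCHom A' A} {η : LCHom A A''}

theorem plusMap_algebraMap {B : LCAlg.{u₁} k} {C : LCAlg.{u₂} k} (φ : LCHom B C) (a : k) :
    plusMap φ (algebraMap k (Unitization k B) a) = algebraMap k (Unitization k C) a := by
  refine Unitization.ext ?_ ?_
  · rw [plusMap_fst, Unitization.algebraMap_eq_inl, Unitization.algebraMap_eq_inl]; simp
  · rw [plusMap_snd, Unitization.algebraMap_eq_inl, Unitization.algebraMap_eq_inl]; simp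

theorem plusMap_plusMap (h : Function.Exact j η) (r : Unitization k A') :
    plusMap η (plusMap j r) = algebraMap k (Unitization k A'') (aug A' r) := by
  refine Unitization.ext ?_ ?_
  · rw [plusMap_fst, plusMap_fst]; simp [aug, Unitization.algebraMap_eq_inl]
  · rw [plusMap_snd, plusMap_snd, h.apply_apply_eq_zero]
    simp [Unitization.algebraMap_eq_inl]

theorem aug_comp_plusMap_comp_plusMap :
    (aug A'').comp ((plusMap η).comp (plusMap j)) = aug A' := by
  rw [← RingHom.comp_assoc, aug_plusMap, aug_plusMap]

/-- The unitization of a short exact sequence is a Milnor square over the ground field. -/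
theorem IsShortExact.augmentedSquare (h : IsShortExact j η) :
    AugmentedSquare (plusMap j) (plusMap η) (algebraMap k (Unitization k A)) (aug A'') where
  injective := plusMap_injective h.isEmbedding.injective
  surjective s := by
    obtain ⟨a, ha⟩ := h.surjective s.snd
    refine ⟨Unitization.inl s.fst + (a : Unitization k A), Unitization.ext ?_ ?_⟩
    · rw [plusMap_fst]; simp
    · rw [plusMap_snd]; simpa using ha
  aug_const a := by
    rw [plusMap_algebraMap]; simp [aug, Unitization.algebraMap_eq_inl]
  map_map r := by
    rw [plusMap_algebraMap, plusMap_plusMap h.exact]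
    simp [aug, Unitization.algebraMap_eq_inl]
  exists_eq r a hr := exists_plusMap_eq h.exact r (by
    rw [hr, plusMap_algebraMap]; simp [Unitization.algebraMap_eq_inl])

theorem IsShortExact.isTopKernel (h : IsShortExact j η) : IsTopKernel j η :=
  ⟨h.isEmbedding, h.exact⟩

theorem IsShortExact.indexHom_mem (h : IsShortExact j η) (x : StableGL (Unitization k A'')) :
    (indexHom h.augmentedSquare x).toAdd ∈ KZero A' := by
  change KZeroUnital.map (aug A') _ = 0
  rw [← aug_plusMap j, KZeroUnital.map_comp, AddMonoidHom.comp_apply, map_indexHom, map_zero]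

/-- The index map, as a homomorphism on the cycles in degree `-1` of the augmented simplicial group,
which are all of `GL(A'')`. -/
noncomputable def cyclesIndex (h : IsShortExact j η) :
    cycles A'' 0 →* Multiplicative (KZero A') :=
  MonoidHom.mk' (fun x => Multiplicative.ofAdd ⟨_, h.indexHom_mem x.1.1⟩) fun x y =>
    congrArg Multiplicative.ofAdd <| Subtype.ext <|
      congrArg Multiplicative.toAdd (map_mul (indexHom h.augmentedSquare) x.1.1 y.1.1)

theorem cyclesIndex_eq_one (h : IsShortExact j η) {x : cycles A'' 0} :
    cyclesIndex h x = 1 ↔ indexHom h.augmentedSquare x.1.1 = 1 :=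
  ⟨fun hx => congrArg (fun z : Multiplicative (KZero A') => Multiplicative.ofAdd z.toAdd.1) hx,
    fun hx => congrArg Multiplicative.ofAdd (Subtype.ext (congrArg Multiplicative.toAdd hx))⟩

/-- The connecting homomorphism `K₁ → K₀`. It is well defined because a boundary in `GL(A'')` is the
end point of a path, which lifts to `GL(𝓘(A))`, so that the boundary itself lifts to `GL(A)`. -/
noncomputable def indexConnecting (h : IsShortExact j η) (hη : IsGLFibration η) :
    piAug A'' 0 →* Multiplicative (KZero A') :=
  QuotientGroup.lift _ (cyclesIndex h) fun x hx => by
    obtain ⟨m, hm, hmx⟩ := Subgroup.mem_subgroupOf.1 hx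
    obtain ⟨y, -, rfl⟩ := hη.exists_moore_lift 0 hm
    rw [GLmap_face_GLmap] at hmx
    refine (cyclesIndex_eq_one h).2 ?_
    have hx' : StableGL.map (plusMap η) (GLmap (face A 0 0) y).1 = x.1.1 :=
      congrArg Subtype.val hmx
    rw [← hx']
    exact indexHom_map h.augmentedSquare (GLmap (face A 0 0) y).1

theorem mem_GLalg_of_map {x : StableGL (Unitization k A)}
    (hx : StableGL.map (plusMap η) x ∈ GLalg A'') : x ∈ GLalg A := by
  change StableGL.map (aug A) x = 1
  rw [← aug_plusMap η, StableGL.map_comp]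
  exact hx

theorem mulExact_piAugMap_indexConnecting (h : IsShortExact j η) (hη : IsGLFibration η) :
    Function.MulExact (piAugMap η 0) (indexConnecting h hη) := by
  intro c
  constructor
  · intro hc
    obtain ⟨x, rfl⟩ := QuotientGroup.mk_surjective c
    obtain ⟨C, hC⟩ := exists_map_eq_of_indexHom_eq_one h.augmentedSquare
      ((cyclesIndex_eq_one h).1 hc)
    have hmem : C ∈ GLalg A := mem_GLalg_of_map (η := η) (hC ▸ x.1.2)
    exact ⟨QuotientGroup.mk ⟨⟨C, hmem⟩, Subgroup.mem_top _⟩,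
      congrArg QuotientGroup.mk (Subtype.ext (Subtype.ext hC))⟩
  · rintro ⟨c, rfl⟩
    obtain ⟨z, rfl⟩ := QuotientGroup.mk_surjective c
    exact (cyclesIndex_eq_one h (x := cyclesMap η 0 z)).2 (indexHom_map h.augmentedSquare z.1.1)

theorem mulExact_indexConnecting_KZeroMulMap (h : IsShortExact j η) (hη : IsGLFibration η) :
    Function.MulExact (indexConnecting h hη) (KZeroMulMap j) := by
  intro z
  constructor
  · intro hz
    have hz' : KZeroUnital.map (plusMap j) z.toAdd.1 = 0 :=
      congrArg (fun w : Multiplicative (KZero A) => w.toAdd.1) hz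
    obtain ⟨x, hx, hxz⟩ := exists_indexHom_eq h.augmentedSquare hz'
    exact ⟨QuotientGroup.mk ⟨⟨x, hx⟩, Subgroup.mem_top _⟩,
      congrArg Multiplicative.ofAdd (Subtype.ext hxz)⟩
  · rintro ⟨c, rfl⟩
    obtain ⟨x, rfl⟩ := QuotientGroup.mk_surjective c
    exact congrArg Multiplicative.ofAdd (Subtype.ext (map_indexHom h.augmentedSquare x.1.1))

theorem mulExact_KZeroMulMap (h : IsShortExact j η) :
    Function.MulExact (KZeroMulMap j) (KZeroMulMap η) := by
  intro w
  constructor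
  · intro hw
    have hw' : KZeroUnital.map (plusMap η) w.toAdd.1 = 0 :=
      congrArg (fun w : Multiplicative (KZero A'') => w.toAdd.1) hw
    obtain ⟨z, hz, hz0⟩ := exists_map_eq_of_map_eq_zero h.augmentedSquare hw'
    rw [aug_comp_plusMap_comp_plusMap] at hz0
    exact ⟨Multiplicative.ofAdd ⟨z, hz0⟩, congrArg Multiplicative.ofAdd (Subtype.ext hz)⟩
  · rintro ⟨z, rfl⟩
    refine congrArg Multiplicative.ofAdd (Subtype.ext ?_)
    change KZeroUnital.map (plusMap η) (KZeroUnital.map (plusMap j) z.toAdd.1) = 0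
    have e : (plusMap η).comp (plusMap j) = (algebraMap k (Unitization k A'')).comp (aug A') :=
      RingHom.ext (plusMap_plusMap h.exact)
    have hz : KZeroUnital.map (aug A') z.toAdd.1 = 0 := z.toAdd.2
    rw [← AddMonoidHom.comp_apply, ← KZeroUnital.map_comp, e, KZeroUnital.map_comp,
      AddMonoidHom.comp_apply, hz, map_zero]

theorem blockSum_submatrix {R : Type u} [Ring R] {m n : ℕ} (p : Matrix (Fin m) (Fin m) R)
    (q : Matrix (Fin n) (Fin n) R) :
    (blockSum p q).submatrix finSumFinEquiv finSumFinEquiv = Matrix.fromBlocks p 0 0 q := by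
  ext a b
  simp [blockSum]

theorem cls_blockSum_one_zero (R : Type u) [Ring R] (m : ℕ) :
    KZeroUnital.cls ⟨m + m, blockSum 1 0, one_block_idem R m⟩ = freeClass R (Fin m) := by
  have h := MatEquiv.submatrix (one_block_idem R m) finSumFinEquiv
  rw [blockSum_submatrix] at h
  rw [cls_eq_idemClass, idemClass_congr h _ (fromBlocks_idem (one_mul 1) (zero_mul 0)),
    idemClass_fromBlocks_zero (one_mul 1), freeClass]

/-- The idempotents `u diag(1, 0) u⁻¹` are glued modules, for every choice of the lift `u`. -/
theorem isIndexConnecting_indexConnecting (h : IsShortExact j η) (hη : IsGLFibration η) :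
    IsIndexConnecting j η (indexConnecting h hη) := by
  intro m g hg u q hq hu hqu
  rw [cls_blockSum_one_zero]
  refine indexHom_eq h.augmentedSquare (m := m) ?_
  let e : Fin m ⊕ Fin m ≃ Fin (m + m) := finSumFinEquiv
  have hq' : q.submatrix e e * q.submatrix e e = q.submatrix e e := by
    rw [Matrix.submatrix_mul_equiv, hq]
  -- the inverse of a lift of `diag(g, g⁻¹)` is a lift of `diag(g⁻¹, g)`
  have hu' : u⁻¹.1.map (plusMap η) = blockSum g⁻¹.1 g.1 := by
    have h1 : blockSum g⁻¹.1 g.1 * blockSum g.1 g⁻¹.1 = 1 := by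
      rw [blockSum, blockSum, Matrix.reindex_apply, Matrix.reindex_apply,
        Matrix.submatrix_mul_equiv]
      simp [Matrix.fromBlocks_multiply]
    have h2 : u.1.map (plusMap η) * u⁻¹.1.map (plusMap η) = 1 := by
      rw [← Matrix.map_mul, u.mul_inv, Matrix.map_one _ (map_zero _) (map_one _)]
    rw [hu] at h2
    exact (left_inv_eq_right_inv h1 h2).symm
  refine ⟨g, Fin m ⊕ Fin m, inferInstance, q.submatrix e e, hq', rfl,
    IndexRel.of_lift (U := u.1.submatrix e e) (U' := u⁻¹.1.submatrix e e) ?_ ?_ ?_ ?_, ?_⟩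
  · rw [Matrix.submatrix_mul_equiv, u.inv_mul, Matrix.submatrix_one_equiv]
  · rw [← Matrix.submatrix_map, hu, blockSum_submatrix]
  · rw [← Matrix.submatrix_map, hu', blockSum_submatrix]
  · rw [← Matrix.submatrix_map, hqu, ← blockSum_submatrix, Matrix.submatrix_mul_equiv,
      Matrix.submatrix_mul_equiv]
  · rw [cls_eq_idemClass, idemClass_congr (MatEquiv.submatrix hq e) hq hq']

/-- The connecting homomorphisms of the long exact sequence. -/
noncomputable def connecting (h : IsShortExact j η) (hη : IsGLFibration η) :
    (n : ℕ) → KSm A'' (n + 1) →* KSm A' n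
  | 0 => indexConnecting h hη
  | n + 1 => mooreConnecting h.isTopKernel hη n

end IndexConnecting

end SmoothK

theorem proposition1p4 {k : Type v} [RCLike k]
    {A' : LCAlg.{u₁} k} {A : LCAlg.{u₂} k} {A'' : LCAlg.{u₃} k}
    (j : LCHom A' A) (η : LCHom A A'') (hex : IsShortExact j η) (hη : IsGLFibration η) :
    ∃ δ : (n : ℕ) → KSm A'' (n + 1) →* KSm A' n,
      (∀ n, Function.MulExact (KSm.map j n) (KSm.map η n)) ∧
      (∀ n, Function.MulExact (KSm.map η (n + 1)) (δ n)) ∧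
      (∀ n, Function.MulExact (δ n) (KSm.map j n)) ∧
      IsIndexConnecting j η (δ 0) ∧
      (∀ n, IsMooreConnecting j η n (δ (n + 1))) := by
  refine ⟨connecting hex hη, ?_, ?_, ?_, isIndexConnecting_indexConnecting hex hη,
    isMooreConnecting_mooreConnecting hex.isTopKernel hη⟩
  · rintro (_ | n)
    · exact mulExact_KZeroMulMap hex
    · exact mulExact_piAugMap hex.isTopKernel hη n
  · rintro (_ | n)
    · exact mulExact_piAugMap_indexConnecting hex hη
    · exact mulExact_piAugMap_mooreConnecting hex.isTopKernel hη n
  · rintro (_ | n)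
    · exact mulExact_indexConnecting_KZeroMulMap hex hη
    · exact mulExact_mooreConnecting_piAugMap hex.isTopKernel hη n
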